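/- For a quadratic number field $F$ with discriminant $d_F$, let $\chi_F=\left(\frac{d_F}{\cdot}\right)$ be the associated quadratic Dirichlet character modulo $|d_F|$ (Kronecker symbol), and let $L(s,\chi_F)$ be its Dirichlet $L$-function, continued analytically to $\mathbb{C}$. For $\alpha>0$, say that $L(s,\chi_F)$ is zero-free in the box of width $\alpha$ if $$L(\sigma+it,\chi_F)\neq 0\quad\text{for all } 1-\alpha\le\sigma\le 1,\ |t|\le(\log|d_F|)^2 .$$ A prime number $p$ is inert in $F$ if $p\mathcal{O}_F$ is a prime ideal. There is an absolute constant $A>0$ such that the following two statements hold. (i) There is an absolute constant $C>0$ such that, for every quadratic field $F$ and every real $\alpha>0$ with $\alpha\log|d_F|\ge 1$, if $L(s,\chi_F)$ is zero-free in the box of width $\alpha$, then there is a prime $p$, inert in $F$, with $$p\le C\,(A\,\alpha\log|d_F|)^{1/\alpha}.$$ (ii) For every real $\alpha>0$ there is a constant $C_\alpha>0$ (depending only on $\alpha$) such that, for every quadratic field $F$ for which $L(s,\chi_F)$ is zero-free in the box of width $\alpha$, there is a prime $p$, inert in $F$, with $$p\le C_\alpha\,(A\,\alpha\log|d_F|)^{1/\alpha}.$$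 -/

import Mathlib

open scoped NumberTheorySymbols

universe u

/-- The Kronecker symbol `(d / n)` for an integer `d` and a natural number `n`.  The prime `2`
contributes `(d / 2) = ZMod.χ₈ d` (which is `0` for even `d`, `1` for `d ≡ ±1 mod 8`, `-1` for
`d ≡ ±3 mod 8`) for each of its occurrences in `n`, and the odd part of `n` contributes the Jacobi
symbol; `(d / 0)` is `1` if `d = ±1` and `0` otherwise. -/
def kroneckerSym (d : ℤ) (n : ℕ) : ℤ :=
  if n = 0 then (if d.natAbs = 1 then 1 else 0)
  else ZMod.χ₈ (d : ZMod 8) ^ padicValNat 2 n * J(d | n / 2 ^ padicValNat 2 n)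

lemma exists_two_pow_mul_odd (n : ℕ) (hn : n ≠ 0) :
    ∃ m : ℕ, Odd m ∧ n = 2 ^ padicValNat 2 n * m ∧ n / 2 ^ padicValNat 2 n = m := by
  obtain ⟨m, hm⟩ := pow_padicValNat_dvd (p := 2) (n := n)
  refine ⟨m, ?_, hm, ?_⟩
  · rw [← Nat.not_even_iff_odd, even_iff_two_dvd]
    rintro ⟨k, rfl⟩
    exact pow_succ_padicValNat_not_dvd (p := 2) hn ⟨k, by rw [pow_succ, mul_assoc]; exact hm⟩
  · exact Nat.div_eq_of_eq_mul_right (by positivity) hm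

lemma jacobiSym_swap (d : ℤ) (hd : d % 4 = 1) (m : ℕ) (hm : Odd m) :
    J(d | m) = J((m : ℤ) | d.natAbs) := by
  rcases Int.natAbs_eq d with h | h
  · have h1 : d.natAbs % 4 = 1 := by omega
    conv_lhs => rw [h]
    exact jacobiSym.quadratic_reciprocity_one_mod_four h1 hm
  · have h1 : d.natAbs % 4 = 3 := by omega
    conv_lhs => rw [h]
    rw [jacobiSym.neg _ hm]
    rcases (Nat.odd_mod_four_iff.mp (Nat.odd_iff.mp hm)) with h3 | h3
    · rw [ZMod.χ₄_nat_one_mod_four h3, one_mul]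
      exact jacobiSym.quadratic_reciprocity_one_mod_four' (by rw [Nat.odd_iff]; omega) h3
    · rw [ZMod.χ₄_nat_three_mod_four h3, jacobiSym.quadratic_reciprocity_three_mod_four h1 h3]
      ring

lemma chi8_eq_jacobiSym (d : ℤ) (hd : d % 4 = 1) :
    ZMod.χ₈ (d : ZMod 8) = J(2 | d.natAbs) := by
  rw [jacobiSym.at_two (by rw [Nat.odd_iff]; omega), ZMod.χ₈_int_eq_if_mod_eight,
    ZMod.χ₈_nat_eq_if_mod_eight]
  split_ifs <;> first | rfl | omega

lemma kroneckerSym_of_one_mod_four (d : ℤ) (hd : d % 4 = 1) (n : ℕ) :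
    kroneckerSym d n = J((n : ℤ) | d.natAbs) := by
  unfold kroneckerSym
  split_ifs with h0 h1
  · simp [h0, h1]
  · rw [h0, Nat.cast_zero, jacobiSym.zero_left (by omega)]
  · obtain ⟨m, hm, hnm, hq⟩ := exists_two_pow_mul_odd n h0
    rw [hq, jacobiSym_swap d hd m hm, chi8_eq_jacobiSym d hd]
    conv_rhs => rw [hnm]
    push_cast
    rw [jacobiSym.mul_left, jacobiSym.pow_left]

lemma kroneckerSym_of_zero_mod_four (d : ℤ) (hd : d % 4 = 0) (n : ℕ) :
    kroneckerSym d n = if Odd n then J(d | n) else 0 := by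
  unfold kroneckerSym
  split_ifs with h0 h1 h2 h2 h2
  · omega
  · omega
  · simp [h0] at h2
  · rfl
  · rw [padicValNat.eq_zero_of_not_dvd (by rw [← even_iff_two_dvd, Nat.not_even_iff_odd]; exact h2)]
    simp
  · have h8 : ZMod.χ₈ (d : ZMod 8) = 0 := by
      rw [ZMod.χ₈_int_eq_if_mod_eight, if_pos (by omega)]
    have : padicValNat 2 n ≠ 0 := by
      rw [Nat.not_odd_iff_even, even_iff_two_dvd] at h2
      have := one_le_padicValNat_of_dvd h0 h2
      omega
    rw [h8, zero_pow this, zero_mul]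

lemma kroneckerSym_mod (d : ℤ) (hd : d % 4 = 0 ∨ d % 4 = 1) (n : ℕ) :
    kroneckerSym d (n % d.natAbs) = kroneckerSym d n := by
  rcases hd with hd | hd
  · rw [kroneckerSym_of_zero_mod_four d hd, kroneckerSym_of_zero_mod_four d hd]
    obtain ⟨m, rfl⟩ : (4 : ℤ) ∣ d := Int.dvd_of_emod_eq_zero hd
    have hN : (4 * m).natAbs = 4 * m.natAbs := by simp [Int.natAbs_mul]
    have hpar : Odd (n % (4 * m).natAbs) ↔ Odd n := by
      rw [hN, Nat.odd_iff, Nat.odd_iff, Nat.mod_mod_of_dvd _ (by omega)]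
    by_cases h : Odd n
    · have h' := hpar.mpr h
      rw [if_pos h', if_pos h, jacobiSym.mul_left, jacobiSym.mul_left, jacobiSym.at_four h,
        jacobiSym.at_four h', one_mul, one_mul, hN, ← jacobiSym.mod_right m h]
    · rw [if_neg h, if_neg (fun h' => h (hpar.mp h'))]
  · rw [kroneckerSym_of_one_mod_four d hd, kroneckerSym_of_one_mod_four d hd, Int.natCast_mod]
    exact (jacobiSym.mod_left _ _).symm

lemma kroneckerSym_mul (d : ℤ) (hd : d % 4 = 0 ∨ d % 4 = 1) (m n : ℕ) :
    kroneckerSym d (m * n) = kroneckerSym d m * kroneckerSym d n := by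
  rcases hd with hd | hd
  · simp only [kroneckerSym_of_zero_mod_four d hd, Nat.odd_mul]
    by_cases hm : Odd m <;> by_cases hn : Odd n <;> simp only [hm, hn, and_self, and_true,
      and_false, if_true, if_false, mul_zero, zero_mul]
    exact jacobiSym.mul_right' d hm.pos.ne' hn.pos.ne'
  · simp only [kroneckerSym_of_one_mod_four d hd, Nat.cast_mul, jacobiSym.mul_left]

lemma kroneckerSym_one (d : ℤ) : kroneckerSym d 1 = 1 := by
  simp [kroneckerSym]

lemma kroneckerSym_eq_zero (d : ℤ) (hd : d % 4 = 0 ∨ d % 4 = 1) (h0 : d ≠ 0) (n : ℕ)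
    (h : ¬ n.Coprime d.natAbs) : kroneckerSym d n = 0 := by
  rcases hd with hd | hd
  · rw [kroneckerSym_of_zero_mod_four d hd]
    split_ifs with hn
    · rw [jacobiSym.eq_zero_iff]
      refine ⟨hn.pos.ne', fun h1 => h ?_⟩
      rw [Nat.coprime_comm]
      simpa [Int.gcd] using h1
    · rfl
  · rw [kroneckerSym_of_one_mod_four d hd, jacobiSym.eq_zero_iff]
    exact ⟨by simpa using h0, fun h1 => h h1⟩

/-- For a nonzero discriminant `d` (an integer `≡ 0, 1 mod 4`), the Dirichlet character modulo `|d|`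
whose value at `n` is the Kronecker symbol `(d / n)`. -/
noncomputable def kroneckerChar (d : ℤ) [NeZero d.natAbs] (hd : d % 4 = 0 ∨ d % 4 = 1) :
    DirichletCharacter ℂ d.natAbs where
  toFun a := (kroneckerSym d a.val : ℂ)
  map_one' := by
    rw [ZMod.val_one_eq_one_mod, kroneckerSym_mod d hd, kroneckerSym_one, Int.cast_one]
  map_mul' a b := by
    rw [ZMod.val_mul, kroneckerSym_mod d hd, kroneckerSym_mul d hd, Int.cast_mul]
  map_nonunit' a ha := by
    rw [kroneckerSym_eq_zero d hd (by simpa using NeZero.ne d.natAbs) a.val, Int.cast_zero]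
    intro hc
    exact ha (by simpa using (ZMod.isUnit_iff_coprime a.val d.natAbs).mpr hc)

theorem kroneckerChar_natCast (d : ℤ) [NeZero d.natAbs] (hd : d % 4 = 0 ∨ d % 4 = 1) (n : ℕ) :
    kroneckerChar d hd (n : ZMod d.natAbs) = (kroneckerSym d n : ℂ) := by
  change (kroneckerSym d (n : ZMod d.natAbs).val : ℂ) = _
  rw [ZMod.val_natCast, kroneckerSym_mod d hd]

instance neZero_natAbs_discr (F : Type*) [Field F] [NumberField F] :
    NeZero (NumberField.discr F).natAbs :=
  ⟨by simpa using NumberField.discr_ne_zero F⟩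

/-- The discriminant of a quadratic field is `≡ 0, 1 mod 4`. -/
theorem discr_mod_four_of_quadratic (F : Type*) [Field F] [NumberField F]
    (hF : Module.finrank ℚ F = 2) :
    NumberField.discr F % 4 = 0 ∨ NumberField.discr F % 4 = 1 := by
  classical
  let b := NumberField.integralBasis F
  have hb : ∀ i, ∃ x : NumberField.RingOfIntegers F, (x : F) = b i := fun i =>
    ⟨NumberField.RingOfIntegers.basis F i, (NumberField.integralBasis_apply F i).symm⟩
  have hcE : Fintype.card (F →ₐ[ℚ] ℂ) = 2 := by rw [AlgHom.card, hF]
  have hcI : Fintype.card (Module.Free.ChooseBasisIndex ℤ (NumberField.RingOfIntegers F)) = 2 := by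
    rw [← hF, Module.finrank_eq_card_basis b]
  let e := Fintype.equivFinOfCardEq hcE
  let f := Fintype.equivFinOfCardEq hcI
  obtain ⟨x, hx⟩ := hb (f.symm 0)
  obtain ⟨y, hy⟩ := hb (f.symm 1)
  let σ : F →ₐ[ℚ] ℂ := e.symm 0
  let τ : F →ₐ[ℚ] ℂ := e.symm 1
  have hsum : ∀ g : (F →ₐ[ℚ] ℂ) → ℂ, ∑ φ, g φ = g σ + g τ := fun g => by
    rw [← e.symm.sum_comp, Fin.sum_univ_two]
  have hprod : ∀ g : (F →ₐ[ℚ] ℂ) → ℂ, ∏ φ, g φ = g σ * g τ := fun g => by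
    rw [← e.symm.prod_comp, Fin.prod_univ_two]
  have htr : ∀ z : NumberField.RingOfIntegers F,
      ((Algebra.trace ℤ (NumberField.RingOfIntegers F) z : ℤ) : ℂ) = σ z + τ z := fun z => by
    rw [← hsum (fun φ => φ (z : F)), ← trace_eq_sum_embeddings ℂ (K := ℚ) (x := (z : F)),
      ← Algebra.coe_trace_int]
    simp
  have hnm : ∀ z : NumberField.RingOfIntegers F,
      ((Algebra.norm ℤ z : ℤ) : ℂ) = σ z * τ z := fun z => by
    rw [← hprod (fun φ => φ (z : F)), ← Algebra.norm_eq_prod_embeddings ℚ ℂ (z : F),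
      ← Algebra.coe_norm_int]
    simp
  have hd : ((NumberField.discr F : ℤ) : ℂ) = (σ x * τ y - τ x * σ y) ^ 2 := by
    have h1 : ((NumberField.discr F : ℤ) : ℂ) = algebraMap ℚ ℂ (Algebra.discr ℚ b) := by
      rw [← NumberField.coe_discr]; simp
    have h2 : Algebra.discr ℚ b = Algebra.discr ℚ (b ∘ f.symm) :=
      (Algebra.discr_reindex ℚ b f).symm
    rw [h1, h2, Algebra.discr_eq_det_embeddingsMatrixReindex_pow_two ℚ ℂ _ e.symm,
      Matrix.det_fin_two]
    simp only [Algebra.embeddingsMatrixReindex, Matrix.reindex_apply, Matrix.submatrix_apply,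
      Algebra.embeddingsMatrix_apply, Function.comp_apply, Equiv.refl_symm, Equiv.refl_apply,
      Equiv.symm_symm, hx, hy, σ, τ]
  have key : NumberField.discr F = (Algebra.trace ℤ _ x * Algebra.trace ℤ _ y -
      Algebra.trace ℤ _ (x * y)) ^ 2 - 4 * (Algebra.norm ℤ x * Algebra.norm ℤ y) := by
    have : ((NumberField.discr F : ℤ) : ℂ) = (((Algebra.trace ℤ _ x * Algebra.trace ℤ _ y -
      Algebra.trace ℤ _ (x * y)) ^ 2 - 4 * (Algebra.norm ℤ x * Algebra.norm ℤ y) : ℤ) : ℂ) := by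
      push_cast
      rw [hd, htr, htr, htr, hnm, hnm]
      simp only [map_mul]
      ring
    exact_mod_cast this
  rw [key]
  generalize Algebra.trace ℤ _ x * Algebra.trace ℤ _ y - Algebra.trace ℤ _ (x * y) = u
  generalize Algebra.norm ℤ x * Algebra.norm ℤ y = v
  rcases Int.even_or_odd' u with ⟨k, rfl | rfl⟩
  · left; ring_nf; omega
  · right; ring_nf; omega

/-- The quadratic Dirichlet character `χ_F = (d_F / ·)` modulo `|d_F|` of a quadratic field `F` with
discriminant `d_F`. -/
noncomputable def quadraticFieldChar (F : Type*) [Field F] [NumberField F]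
    (hF : Module.finrank ℚ F = 2) : DirichletCharacter ℂ (NumberField.discr F).natAbs :=
  kroneckerChar (NumberField.discr F) (discr_mod_four_of_quadratic F hF)

/-- `logDiscr F = log |d_F|`. -/
noncomputable def logDiscr (F : Type*) [Field F] [NumberField F] : ℝ :=
  Real.log |(NumberField.discr F : ℝ)|

/-- `L(s, χ_F)` (continued analytically to the whole plane) has no zero `s = σ + it` in the box
`1 - α ≤ σ ≤ 1`, `|t| ≤ (log |d_F|) ^ 2`. -/
def ZeroFreeBox (F : Type*) [Field F] [NumberField F] (hF : Module.finrank ℚ F = 2) (α : ℝ) :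
    Prop :=
  ∀ s : ℂ, 1 - α ≤ s.re → s.re ≤ 1 → |s.im| ≤ logDiscr F ^ 2 →
    DirichletCharacter.LFunction (quadraticFieldChar F hF) s ≠ 0

/-- The rational prime `p` is inert in the number field `F`: the ideal `p 𝓞_F` is a prime ideal. -/
def IsInertPrime (F : Type*) [Field F] [NumberField F] (p : ℕ) : Prop :=
  p.Prime ∧ (Ideal.span {(p : NumberField.RingOfIntegers F)}).IsPrime

/-! Write q = |d_F|, χ = χ_F and take δ = α ≤ 0.6. Suppose that χ(n) = 1 for every prime power n ≤ X
prime to q. The k-th derivative of L'/L at 1 + η, with k = m² and η = mδ/10, is evaluated in two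
ways.

By the Dirichlet series it is, up to sign, the sum of χ(n) Λ(n) (log n)^k n^(-1-η). The weight peaks
at log n = 10m/δ with width about 10/δ, so for log X = 10(m+6)/δ almost all of its mass lies below
X. Mertens' theorem then bounds the sum below by a constant times k!/η^(k+1), apart from a small
loss from the primes dividing q (`le_tsum_vonMangoldt_of_eq_one`, `factorial_sq_le`).

By the local partial fraction expansion it is at most k! times the sum of |1+η-ρ|^(-k-1) over the
nearby zeros, plus a small error. The zero-free box keeps these zeros at distance at least η + δ,
which saves the factor (1 + 10/m)^(-m²), roughly e^(-10m). A Jensen-type bound shows that all of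
them together cost only a factor of order δ log q
(`exists_norm_iteratedDeriv_logDeriv_LFunction_le`). The two evaluations conflict once e^(10m)
exceeds a large multiple of δ log q. The least such m gives X ≤ (A δ log q)^(1/δ), which is
`exists_isPrimePow_ne_one`.

A width α > 0.6 is impossible for large q. The functional equation gives |L'/L(1/2)| ≥ (log q)/2 -
O(1), while absence of zeros with Re s ≥ 2/5 near the real axis would force |L'/L(1/2)| ≤ (log q)/4
+ O(1) (`exists_LFunction_eq_zero`).

Bounded discriminants are finite in number, and each has an inert prime by Dirichlet's theorem on
primes in progressions. In (ii) the case α log q < 1 is also a case of bounded discriminant. -/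

section

/-! ### Zeros of an entire function in a disc: Blaschke products, Jensen, Borel–Carathéodory. -/

open Complex Metric Set Filter Topology
open scoped ComplexConjugate Nat

/-- The entire function `f` is divisible by `∏ (z - ρ)`, the product over the multiset `Z`. -/
def DividesBy (f : ℂ → ℂ) (Z : Multiset ℂ) (g : ℂ → ℂ) : Prop :=
  Differentiable ℂ g ∧ ∀ z, f z = (Z.map (z - ·)).prod * g z

/-- The product of the numerators of the Blaschke factors of the disc of centre `c`, radius `R`. -/
noncomputable def blaschkeNum (Z : Multiset ℂ) (c : ℂ) (R : ℝ) (z : ℂ) : ℂ :=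
  (Z.map fun ρ => ((R : ℂ) ^ 2 - conj (ρ - c) * (z - c)) / R).prod

/-- A zero of the cofactor is split off with `dslope`, which fills the removable singularity.
Multiplicities are thus recorded by the multiset, without orders of vanishing. -/
lemma DividesBy.cons {f g : ℂ → ℂ} {Z : Multiset ℂ} (h : DividesBy f Z g) {ρ : ℂ} (hρ : g ρ = 0) :
    DividesBy f (ρ ::ₘ Z) (dslope g ρ) := by
  refine ⟨?_, fun z => ?_⟩
  · have := (Complex.differentiableOn_dslope (c := ρ) (f := g) (s := univ) univ_mem).2
      h.1.differentiableOn
    exact differentiableOn_univ.1 this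
  · have h1 : (z - ρ) * dslope g ρ z = g z := by
      have := sub_smul_dslope g ρ z
      simpa [hρ] using this
    rw [h.2, Multiset.map_cons, Multiset.prod_cons, ← h1]
    ring

lemma DividesBy.zero_of_mem {f g : ℂ → ℂ} {Z : Multiset ℂ} (h : DividesBy f Z g) {ρ : ℂ}
    (hρ : ρ ∈ Z) : f ρ = 0 := by
  rw [h.2, Multiset.prod_eq_zero, zero_mul]
  exact Multiset.mem_map.2 ⟨ρ, hρ, sub_self ρ⟩

/-- Needed to apply Jensen's bound to only those zeros of a given multiset that lie in a smaller
disc. -/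
lemma DividesBy.of_le {f g : ℂ → ℂ} {Z Z' : Multiset ℂ} (h : DividesBy f Z g) (hZ : Z' ≤ Z) :
    ∃ g', DividesBy f Z' g' := by
  obtain ⟨Y, rfl⟩ := Multiset.le_iff_exists_add.1 hZ
  refine ⟨fun z => (Y.map (z - ·)).prod * g z, ?_, fun z => ?_⟩
  · refine Differentiable.mul ?_ h.1
    clear h hZ
    induction Y using Multiset.induction_on with
    | empty => simp
    | cons a Y ih =>
      simp only [Multiset.map_cons, Multiset.prod_cons]
      exact (differentiable_id.sub_const a).mul ih
  · rw [h.2, Multiset.map_add, Multiset.prod_add]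
    ring

lemma differentiable_blaschkeNum (Z : Multiset ℂ) (c : ℂ) (R : ℝ) :
    Differentiable ℂ (blaschkeNum Z c R) := by
  induction Z using Multiset.induction_on with
  | empty =>
    have : blaschkeNum 0 c R = fun _ => 1 := by ext z; simp [blaschkeNum]
    rw [this]; exact differentiable_const _
  | cons a Z ih =>
    have : blaschkeNum (a ::ₘ Z) c R =
        fun z => ((R : ℂ) ^ 2 - conj (a - c) * (z - c)) / R * blaschkeNum Z c R z := by
      ext z; simp [blaschkeNum]
    rw [this]
    exact Differentiable.mul (by fun_prop) ih

/-- On the circle R² = conj(z-c)(z-c), so the numerator is conj(z-ρ)(z-c), of modulus R |z-ρ|. -/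
lemma norm_blaschke_factor {c ρ z : ℂ} {R : ℝ} (hR : 0 < R) (hz : ‖z - c‖ = R) :
    ‖((R : ℂ) ^ 2 - conj (ρ - c) * (z - c)) / R‖ = ‖z - ρ‖ := by
  have h1 : (R : ℂ) ^ 2 = conj (z - c) * (z - c) := by
    rw [mul_comm, Complex.mul_conj, Complex.normSq_eq_norm_sq, hz]; push_cast; rfl
  rw [h1, ← sub_mul, norm_div, norm_mul, hz, Complex.norm_real, Real.norm_of_nonneg hR.le,
    mul_div_assoc, div_self hR.ne', mul_one, ← map_sub, Complex.norm_conj]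
  congr 1; ring

lemma blaschke_factor_ne_zero {c ρ z : ℂ} {R : ℝ} (hρ : ‖ρ - c‖ < R)
    (hz : ‖z - c‖ ≤ R) : ((R : ℂ) ^ 2 - conj (ρ - c) * (z - c)) / R ≠ 0 := by
  have hR : 0 < R := (norm_nonneg _).trans_lt hρ
  refine div_ne_zero (fun h => ?_) (by exact_mod_cast hR.ne')
  have h2 : ‖(R : ℂ) ^ 2‖ = ‖conj (ρ - c) * (z - c)‖ := by rw [sub_eq_zero.1 h]
  rw [norm_mul, Complex.norm_conj, norm_pow, Complex.norm_real, Real.norm_of_nonneg hR.le] at h2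
  nlinarith [norm_nonneg (ρ - c), norm_nonneg (z - c)]

lemma norm_blaschkeNum (Z : Multiset ℂ) {c z : ℂ} {R : ℝ} (hR : 0 < R) (hz : ‖z - c‖ = R) :
    ‖blaschkeNum Z c R z‖ = ‖(Z.map (z - ·)).prod‖ := by
  induction Z using Multiset.induction_on with
  | empty => simp [blaschkeNum]
  | cons a Z ih =>
    simp only [blaschkeNum, Multiset.map_cons, Multiset.prod_cons, norm_mul] at ih ⊢
    rw [ih, norm_blaschke_factor hR hz]

lemma blaschkeNum_center (Z : Multiset ℂ) {c : ℂ} {R : ℝ} (hR : 0 < R) :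
    blaschkeNum Z c R c = (R : ℂ) ^ Z.card := by
  have : (R : ℂ) ≠ 0 := by exact_mod_cast hR.ne'
  simp [blaschkeNum, pow_two, this]

lemma blaschkeNum_ne_zero {Z : Multiset ℂ} {c z : ℂ} {R : ℝ} (hZ : ∀ ρ ∈ Z, ‖ρ - c‖ < R)
    (hz : ‖z - c‖ ≤ R) : blaschkeNum Z c R z ≠ 0 := by
  intro h
  rw [blaschkeNum, Multiset.prod_eq_zero_iff] at h
  obtain ⟨ρ, hρ, h0⟩ := Multiset.mem_map.1 h
  exact blaschke_factor_ne_zero (hZ ρ hρ) hz h0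

lemma norm_prod_sub_le {Z : Multiset ℂ} {c : ℂ} {r : ℝ}
    (hZ : ∀ ρ ∈ Z, ‖ρ - c‖ ≤ r) : ‖(Z.map (c - ·)).prod‖ ≤ r ^ Z.card := by
  induction Z using Multiset.induction_on with
  | empty => simp
  | cons a Z ih =>
    simp only [Multiset.map_cons, Multiset.prod_cons, norm_mul, Multiset.card_cons, pow_succ']
    have ha := hZ a (Multiset.mem_cons_self a Z)
    rw [norm_sub_rev] at ha
    exact mul_le_mul ha (ih fun ρ hρ => hZ ρ (Multiset.mem_cons_of_mem hρ)) (norm_nonneg _)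
      ((norm_nonneg _).trans ha)

/-- The zero-free part of `f` is bounded in the disc by the maximum of `f`. -/
lemma DividesBy.norm_mul_blaschkeNum_le {f g : ℂ → ℂ} {Z : Multiset ℂ} (h : DividesBy f Z g)
    {c : ℂ} {R B : ℝ} (hR : 0 < R) (hB : ∀ z, ‖z - c‖ ≤ R → ‖f z‖ ≤ B) {z : ℂ}
    (hz : ‖z - c‖ ≤ R) : ‖g z * blaschkeNum Z c R z‖ ≤ B := by
  have hd : Differentiable ℂ fun z => g z * blaschkeNum Z c R z :=
    h.1.mul (differentiable_blaschkeNum Z c R)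
  -- Maximum principle: on the circle the Blaschke numerators have the modulus of the linear factors
  -- they replace, so the product has the modulus of f there.
  refine Complex.norm_le_of_forall_mem_frontier_norm_le (U := ball c R) isBounded_ball
    hd.diffContOnCl (fun w hw => ?_) ?_
  · rw [frontier_ball c hR.ne', mem_sphere_iff_norm] at hw
    rw [norm_mul, norm_blaschkeNum Z hR hw, mul_comm, ← norm_mul, ← h.2]
    exact hB w hw.le
  · rw [closure_ball c hR.ne', mem_closedBall_iff_norm]; exact hz

/-- At the centre each factor |c-ρ| ≤ r is replaced by R, a gain of at least R/r per zero. Against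
the maximum principle this yields Jensen's bound. -/
lemma DividesBy.pow_mul_norm_le {f g : ℂ → ℂ} {Z : Multiset ℂ} (h : DividesBy f Z g)
    {c : ℂ} {r R : ℝ} (hr : 0 < r) (hR : 0 < R) (hZ : ∀ ρ ∈ Z, ‖ρ - c‖ ≤ r) :
    (R / r) ^ Z.card * ‖f c‖ ≤ ‖g c * blaschkeNum Z c R c‖ := by
  rw [blaschkeNum_center Z hR, h.2 c, norm_mul, norm_mul, norm_pow, Complex.norm_real,
    Real.norm_of_nonneg hR.le, div_pow]
  have := norm_prod_sub_le hZ
  calc R ^ Z.card / r ^ Z.card * (‖(Z.map (c - ·)).prod‖ * ‖g c‖)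
      ≤ R ^ Z.card / r ^ Z.card * (r ^ Z.card * ‖g c‖) := by gcongr
    _ = ‖g c‖ * R ^ Z.card := by field_simp

/-- Jensen's bound for the number of zeros in a disc. -/
lemma DividesBy.card_mul_log_le {f g : ℂ → ℂ} {Z : Multiset ℂ} (h : DividesBy f Z g)
    {c : ℂ} {r R M : ℝ} (hr : 0 < r) (hrR : r < R) (hfc : f c ≠ 0)
    (hB : ∀ z, ‖z - c‖ ≤ R → ‖f z‖ ≤ Real.exp M * ‖f c‖) (hZ : ∀ ρ ∈ Z, ‖ρ - c‖ ≤ r) :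
    Z.card * Real.log (R / r) ≤ M := by
  have hR := hr.trans hrR
  have h1 := h.pow_mul_norm_le hr hR hZ
  have h2 := h.norm_mul_blaschkeNum_le hR hB (z := c) (by simpa using hR.le)
  have h3 : (R / r) ^ Z.card ≤ Real.exp M :=
    le_of_mul_le_mul_right (h1.trans h2) (norm_pos_iff.2 hfc)
  rw [← Real.log_pow, ← Real.log_exp M]
  exact Real.log_le_log (by positivity) h3

/-- Every divisor of `f` extends to one that exhausts the zeros of `f` in a disc. -/
lemma DividesBy.exists_extend {f g : ℂ → ℂ} {Z : Multiset ℂ} (h : DividesBy f Z g)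
    {c : ℂ} {r R M : ℝ} (hr : 0 < r) (hrR : r < R) (hfc : f c ≠ 0)
    (hB : ∀ z, ‖z - c‖ ≤ R → ‖f z‖ ≤ Real.exp M * ‖f c‖) (hZ : ∀ ρ ∈ Z, ‖ρ - c‖ ≤ r) :
    ∃ Z' g', Z ≤ Z' ∧ DividesBy f Z' g' ∧ (∀ ρ ∈ Z', ‖ρ - c‖ ≤ r) ∧
      ∀ z, ‖z - c‖ ≤ r → g' z ≠ 0 := by
  classical
  -- Jensen bounds the size of every divisor supported in the disc, so one of maximal size exists. A
  -- zero left in its cofactor could be adjoined, contradicting maximality.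
  let P : ℕ → Prop := fun n => ∃ Z' g', Z ≤ Z' ∧ DividesBy f Z' g' ∧ (∀ ρ ∈ Z', ‖ρ - c‖ ≤ r) ∧
    Z'.card = n
  have hlog : 0 < Real.log (R / r) := Real.log_pos ((one_lt_div hr).2 hrR)
  let N := ⌊M / Real.log (R / r)⌋₊
  have hPN : ∀ n, P n → n ≤ N := by
    rintro n ⟨Z', g', -, h', hZ', rfl⟩
    exact Nat.le_floor ((le_div_iff₀ hlog).2 (h'.card_mul_log_le hr hrR hfc hB hZ'))
  have hP0 : P Z.card := ⟨Z, g, le_rfl, h, hZ, rfl⟩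
  have hmax := Nat.findGreatest_spec (P := P) (hPN _ hP0) hP0
  obtain ⟨Z', g', hle, h', hZ', hcard⟩ := hmax
  refine ⟨Z', g', hle, h', hZ', fun z hz h0 => ?_⟩
  have hP1 : P (Z'.card + 1) := ⟨z ::ₘ Z', _, hle.trans (Multiset.le_cons_self Z' z), h'.cons h0,
    fun ρ hρ => by
      rcases Multiset.mem_cons.1 hρ with rfl | hρ
      · exact hz
      · exact hZ' ρ hρ, Multiset.card_cons z Z'⟩
  have := Nat.le_findGreatest (hPN _ hP1) hP1
  omega

/-- Borel–Carathéodory bound for the derivatives of `h'/h`, for `h` without zeros. -/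
lemma norm_iteratedDeriv_logDeriv_le {h : ℂ → ℂ} {c : ℂ} {r s M : ℝ} (hs : 0 < s) (hsr : s < r)
    (hM : 0 < M) (hh : Differentiable ℂ h) (h0 : ∀ z, ‖z - c‖ ≤ r → h z ≠ 0)
    (hb : ∀ z, ‖z - c‖ ≤ r → ‖h z‖ ≤ Real.exp M * ‖h c‖) (k : ℕ) :
    ‖iteratedDeriv k (logDeriv h) c‖ ≤ (k + 1)! * (2 * M * s / (r - s)) / s ^ (k + 1) := by
  have hr := hs.trans hsr
  have hmem : ∀ {z}, z ∈ ball c r → ‖z - c‖ ≤ r := fun hz => (mem_ball_iff_norm.1 hz).le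
  have hcb : c ∈ ball c r := mem_ball_self hr
  have hld : DifferentiableOn ℂ (logDeriv h) (ball c r) := by
    intro z hz
    have h1 : DifferentiableAt ℂ (deriv h) z :=
      (hh.contDiff (n := 2)).differentiable_deriv_two z
    exact (h1.div (hh z) (h0 z (hmem hz))).differentiableWithinAt
  -- H is the primitive of h'/h vanishing at c, hence a branch of log(h / h c). The growth
  -- hypothesis says Re H ≤ M, Borel–Carathéodory bounds |H| on the circle of radius s, and Cauchy's
  -- estimate for the derivative of order k + 1 of H concludes.
  obtain ⟨H, hHc, hH⟩ := (hld.isExactOn_ball).with_val_at c 0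
  have hexp : ∀ z ∈ ball c r, h z = h c * exp (H z) := by
    have hder : ∀ z ∈ ball c r, HasDerivAt (fun z => h z * exp (-H z)) 0 z := by
      intro z hz
      have h1 : HasDerivAt (fun z => h z * exp (-H z))
          (deriv h z * exp (-H z) + h z * (exp (-H z) * -logDeriv h z)) z :=
        (hh z).hasDerivAt.mul ((hH z hz).neg.cexp)
      have h2 := h0 z (hmem hz)
      have h3 : deriv h z * exp (-H z) + h z * (exp (-H z) * -logDeriv h z) = 0 := by
        rw [logDeriv_apply]
        field_simp
        ring
      rwa [h3] at h1
    intro z hz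
    have hconst := (convex_ball c r).is_const_of_fderivWithin_eq_zero (𝕜 := ℂ)
      (f := fun z => h z * exp (-H z))
      (fun w hw => (hder w hw).differentiableAt.differentiableWithinAt)
      (fun w hw => by
        rw [fderivWithin_of_isOpen isOpen_ball hw]
        ext; simp [(hder w hw).hasFDerivAt.fderiv]) hz hcb
    simp only [hHc, neg_zero, exp_zero, mul_one] at hconst
    rw [← hconst, mul_assoc, ← exp_add]
    simp
  have hre : ∀ z ∈ ball c r, (H z).re ≤ M := by
    intro z hz
    have h1 := hb z (hmem hz)
    rw [hexp z hz, norm_mul, Complex.norm_exp, mul_comm] at h1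
    exact Real.exp_le_exp.1 (le_of_mul_le_mul_right h1
      (norm_pos_iff.2 (h0 c (by simpa using hr.le))))
  have hbound : ∀ z ∈ sphere c s, ‖H z‖ ≤ 2 * M * s / (r - s) := by
    intro z hz
    have hz' : ‖z - c‖ = s := mem_sphere_iff_norm.1 hz
    have := Complex.borelCaratheodory_zero (f := fun w => H (c + w)) (R := r) (z := z - c) hM
      (fun w hw => by
        have hw' : c + w ∈ ball c r := by simpa [mem_ball_iff_norm] using hw
        have := (hH _ hw').differentiableAt
        exact (this.comp w ((differentiableAt_const c).add differentiableAt_id)).differentiableWithinAt)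
      (fun w hw => hre _ (by simpa [mem_ball_iff_norm] using hw)) hr
      (by simpa [hz'] using hsr) (by simpa using hHc)
    simpa [hz'] using this
  have hsub : closedBall c s ⊆ ball c r := closedBall_subset_ball hsr
  have hdc : DiffContOnCl ℂ H (ball c s) := by
    refine DifferentiableOn.diffContOnCl fun z hz => ?_
    rw [closure_ball c hs.ne'] at hz
    exact (hH z (hsub hz)).differentiableAt.differentiableWithinAt
  have hc := Complex.norm_iteratedDeriv_le_of_forall_mem_sphere_norm_le (k + 1) hs hdc hbound
  rw [iteratedDeriv_succ'] at hc
  have heq : deriv H =ᶠ[𝓝 c] logDeriv h := by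
    filter_upwards [isOpen_ball.mem_nhds hcb] with z hz using (hH z hz).deriv
  rwa [heq.iteratedDeriv_eq] at hc

end

/-! ### Local partial fractions for the derivatives of f'/f. -/

section

open Complex Metric Set Filter Topology
open scoped ComplexConjugate Nat

lemma contDiffAt_logDeriv {u : ℂ → ℂ} (hu : Differentiable ℂ u) {c : ℂ} (hc : u c ≠ 0) (k : ℕ) :
    ContDiffAt ℂ k (logDeriv u) c := by
  have h1 : ContDiff ℂ (k + 1) u := hu.contDiff
  have h2 : ContDiff ℂ k (deriv u) := (contDiff_succ_iff_deriv.1 h1).2.2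
  exact h2.contDiffAt.div hu.contDiff.contDiffAt hc

lemma iteratedDeriv_logDeriv_mul {u v : ℂ → ℂ} (hu : Differentiable ℂ u) (hv : Differentiable ℂ v)
    {c : ℂ} (huc : u c ≠ 0) (hvc : v c ≠ 0) (k : ℕ) :
    iteratedDeriv k (logDeriv fun z => u z * v z) c =
      iteratedDeriv k (logDeriv u) c + iteratedDeriv k (logDeriv v) c := by
  have heq : (logDeriv fun z => u z * v z) =ᶠ[𝓝 c] logDeriv u + logDeriv v := by
    filter_upwards [hu.continuous.continuousAt.eventually_ne huc,
      hv.continuous.continuousAt.eventually_ne hvc] with z h1 h2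
    exact logDeriv_mul z h1 h2 (hu z) (hv z)
  rw [heq.iteratedDeriv_eq]
  exact iteratedDeriv_add (contDiffAt_logDeriv hu huc k) (contDiffAt_logDeriv hv hvc k)

lemma iteratedDeriv_logDeriv_sub (k : ℕ) (ρ c : ℂ) :
    iteratedDeriv k (logDeriv fun z => z - ρ) c = (-1) ^ k * k ! * ((c - ρ) ^ (k + 1))⁻¹ := by
  have : (logDeriv fun z : ℂ => z - ρ) = fun z => (1 * z - ρ)⁻¹ := by
    ext z; simp [logDeriv_apply]
  rw [this, iteratedDeriv_eq_iterate, iter_deriv_inv_linear_sub]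
  simp only [one_pow, mul_one, one_mul]
  rw [show (-1 - k : ℤ) = -((k + 1 : ℕ) : ℤ) by push_cast; ring, zpow_neg, zpow_natCast]

lemma iteratedDeriv_logDeriv_blaschke_factor (k : ℕ) (w c : ℂ) {R : ℝ} (hR : 0 < R) :
    iteratedDeriv k (logDeriv fun z => ((R : ℂ) ^ 2 - w * (z - c)) / R) c =
      -(k ! * (w / R ^ 2) ^ (k + 1)) := by
  have hR' : (R : ℂ) ≠ 0 := by exact_mod_cast hR.ne'
  have hd : ∀ z, deriv (fun z => ((R : ℂ) ^ 2 - w * (z - c)) / R) z = -w / R := by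
    intro z
    have h : HasDerivAt (fun z => ((R : ℂ) ^ 2 - w * (z - c)) / R) (-(w * 1) / R) z :=
      ((((hasDerivAt_id z).sub_const c).const_mul w).const_sub ((R : ℂ) ^ 2)).div_const (R : ℂ)
    rw [h.deriv, mul_one]
  have : (logDeriv fun z => ((R : ℂ) ^ 2 - w * (z - c)) / R) =
      fun z => (-w) * ((-w) * z + (R ^ 2 + w * c))⁻¹ := by
    ext z
    rw [logDeriv_apply, hd, div_div_div_cancel_right₀ hR', div_eq_mul_inv]
    congr 2; ring
  rw [this, iteratedDeriv_const_mul_field, iteratedDeriv_eq_iterate, iter_deriv_inv_linear]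
  beta_reduce
  rw [show (-1 - k : ℤ) = -((k + 1 : ℕ) : ℤ) by push_cast; ring, zpow_neg, zpow_natCast,
    show -w * c + ((R : ℂ) ^ 2 + w * c) = R ^ 2 by ring, neg_pow w k]
  have h1 : ((-1 : ℂ)) ^ k * (-1) ^ k = 1 := by rw [← mul_pow]; simp
  linear_combination (-(w ^ (k + 1) * k ! * ((R : ℂ) ^ 2)⁻¹ ^ (k + 1))) * h1

lemma iteratedDeriv_logDeriv_prod_mul {g : ℂ → ℂ} (hg : Differentiable ℂ g) {c : ℂ}
    {u : ℂ → ℂ → ℂ} (hu : ∀ ρ, Differentiable ℂ (u ρ)) (Z : Multiset ℂ)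
    (hZ : ∀ ρ ∈ Z, u ρ c ≠ 0) (hgc : g c ≠ 0) (k : ℕ) :
    iteratedDeriv k (logDeriv fun z => (Z.map fun ρ => u ρ z).prod * g z) c =
      (Z.map fun ρ => iteratedDeriv k (logDeriv (u ρ)) c).sum +
        iteratedDeriv k (logDeriv g) c := by
  -- Differentiability and nonvanishing of the partial products have to travel with the induction.
  have key : (Differentiable ℂ fun z => (Z.map fun ρ => u ρ z).prod * g z) ∧
      (Z.map fun ρ => u ρ c).prod * g c ≠ 0 ∧
      iteratedDeriv k (logDeriv fun z => (Z.map fun ρ => u ρ z).prod * g z) c =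
      (Z.map fun ρ => iteratedDeriv k (logDeriv (u ρ)) c).sum +
        iteratedDeriv k (logDeriv g) c := by
    induction Z using Multiset.induction_on with
    | empty => simp [hg, hgc]
    | cons a Z ih =>
      obtain ⟨h1, h2, h3⟩ := ih fun ρ hρ => hZ ρ (Multiset.mem_cons_of_mem hρ)
      have ha := hZ a (Multiset.mem_cons_self a Z)
      simp only [Multiset.map_cons, Multiset.prod_cons, Multiset.sum_cons, mul_assoc, add_assoc]
      refine ⟨(hu a).mul h1, mul_ne_zero ha h2, ?_⟩
      rw [iteratedDeriv_logDeriv_mul (hu a) h1 ha h2, h3]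
  exact key.2.2

/-- The local partial fraction expansion of the derivatives of `f'/f`, with the error term given by
the zero-free part. -/
lemma DividesBy.iteratedDeriv_logDeriv {f g : ℂ → ℂ} {Z : Multiset ℂ} (h : DividesBy f Z g)
    {c : ℂ} {R : ℝ} (hR : 0 < R) (hfc : f c ≠ 0) (hZ : ∀ ρ ∈ Z, ‖ρ - c‖ < R) (k : ℕ) :
    iteratedDeriv k (logDeriv f) c =
      iteratedDeriv k (logDeriv fun z => g z * blaschkeNum Z c R z) c +
        k ! * (Z.map fun ρ => (-1) ^ k * ((c - ρ) ^ (k + 1))⁻¹ +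
          (conj (ρ - c) / R ^ 2) ^ (k + 1)).sum := by
  have hgc : g c ≠ 0 := fun h0 => hfc (by rw [h.2, h0, mul_zero])
  have h1 : ∀ ρ ∈ Z, c - ρ ≠ 0 := fun ρ hρ h0 =>
    hfc (by rw [sub_eq_zero.1 h0]; exact h.zero_of_mem hρ)
  have hf : f = fun z => (Z.map fun ρ => z - ρ).prod * g z := funext h.2
  have e1 := iteratedDeriv_logDeriv_prod_mul h.1 (c := c) (u := fun ρ z => z - ρ)
    (fun ρ => by fun_prop) Z h1 hgc k
  have e2 := iteratedDeriv_logDeriv_prod_mul h.1 (c := c)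
    (u := fun ρ z => ((R : ℂ) ^ 2 - conj (ρ - c) * (z - c)) / R)
    (fun ρ => by fun_prop) Z (fun ρ hρ => blaschke_factor_ne_zero (hZ ρ hρ) (by simpa using hR.le))
    hgc k
  have hb : (fun z => g z * blaschkeNum Z c R z) = fun z =>
      (Z.map fun ρ => ((R : ℂ) ^ 2 - conj (ρ - c) * (z - c)) / R).prod * g z := by
    ext z; rw [mul_comm]; rfl
  rw [hf, hb, e1, e2]
  simp only [iteratedDeriv_logDeriv_sub, iteratedDeriv_logDeriv_blaschke_factor k _ c hR]
  rw [← Multiset.sum_map_mul_left, add_right_comm, ← Multiset.sum_map_add]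
  congr 2
  refine Multiset.map_congr rfl fun ρ _ => ?_
  ring

/-- The error term in the local partial fraction expansion. -/
lemma DividesBy.norm_iteratedDeriv_blaschke_le {f g : ℂ → ℂ} {Z : Multiset ℂ}
    (h : DividesBy f Z g) {c : ℂ} {s r R M : ℝ} (hs : 0 < s) (hsr : s < r) (hrR : r < R)
    (hM : 0 < M) (hB : ∀ z, ‖z - c‖ ≤ R → ‖f z‖ ≤ Real.exp M * ‖f c‖)
    (hZ : ∀ ρ ∈ Z, ‖ρ - c‖ ≤ r) (hg : ∀ z, ‖z - c‖ ≤ r → g z ≠ 0) (k : ℕ) :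
    ‖iteratedDeriv k (logDeriv fun z => g z * blaschkeNum Z c R z) c‖ ≤
      (k + 1)! * (2 * M * s / (r - s)) / s ^ (k + 1) := by
  have hr := hs.trans hsr
  have hR := hr.trans hrR
  refine norm_iteratedDeriv_logDeriv_le hs hsr hM (h.1.mul (differentiable_blaschkeNum Z c R))
    (fun z hz => mul_ne_zero (hg z hz) (blaschkeNum_ne_zero (fun ρ hρ => (hZ ρ hρ).trans_lt hrR)
      (hz.trans hrR.le))) (fun z hz => ?_) k
  have h1 := h.pow_mul_norm_le hr hR hZ
  refine (h.norm_mul_blaschkeNum_le hR hB (hz.trans hrR.le)).trans ?_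
  gcongr
  refine le_trans ?_ h1
  exact le_mul_of_one_le_left (norm_nonneg _) (one_le_pow₀ ((one_le_div hr).2 hrR.le))

lemma norm_multiset_sum_map_le (Z : Multiset ℂ) (u : ℂ → ℂ) :
    ‖(Z.map u).sum‖ ≤ (Z.map fun ρ => ‖u ρ‖).sum := by
  induction Z using Multiset.induction_on with
  | empty => simp
  | cons a Z ih =>
    simp only [Multiset.map_cons, Multiset.sum_cons]
    exact (norm_add_le _ _).trans (by gcongr)

/-- Bound for the derivatives of `f'/f` in terms of the zeros of `f` in a disc. -/
theorem exists_zeros_norm_iteratedDeriv_logDeriv_le {f : ℂ → ℂ} (hf : Differentiable ℂ f) {c : ℂ}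
    {s r R M : ℝ} (hs : 0 < s) (hsr : s < r) (hrR : r < R) (hM : 0 < M) (hfc : f c ≠ 0)
    (hB : ∀ z, ‖z - c‖ ≤ R → ‖f z‖ ≤ Real.exp M * ‖f c‖) :
    ∃ Z g, DividesBy f Z g ∧ (∀ ρ ∈ Z, ‖ρ - c‖ ≤ r) ∧ ∀ k : ℕ,
      ‖iteratedDeriv k (logDeriv f) c‖ ≤ k ! * ((Z.map fun ρ => (‖c - ρ‖ ^ (k + 1))⁻¹).sum +
        (M / Real.log (R / r) + (k + 1) * (2 * M * s / (r - s))) / s ^ (k + 1)) := by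
  have hr := hs.trans hsr
  have hR := hr.trans hrR
  have hd0 : DividesBy f 0 f := ⟨hf, fun z => by simp⟩
  obtain ⟨Z, g, -, h, hZ, hg⟩ := hd0.exists_extend hr hrR hfc hB (by simp)
  refine ⟨Z, g, h, hZ, fun k => ?_⟩
  have hcard := h.card_mul_log_le hr hrR hfc hB hZ
  have hlog : 0 < Real.log (R / r) := Real.log_pos ((one_lt_div hr).2 hrR)
  rw [← le_div_iff₀ hlog] at hcard
  have herr := h.norm_iteratedDeriv_blaschke_le hs hsr hrR hM hB hZ hg k
  rw [h.iteratedDeriv_logDeriv hR hfc (fun ρ hρ => (hZ ρ hρ).trans_lt hrR) k]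
  have hsum : ‖(Z.map fun ρ => (-1) ^ k * ((c - ρ) ^ (k + 1))⁻¹ +
      (conj (ρ - c) / R ^ 2) ^ (k + 1)).sum‖ ≤
      (Z.map fun ρ => (‖c - ρ‖ ^ (k + 1))⁻¹).sum + Z.card * (1 / s ^ (k + 1)) := by
    refine (norm_multiset_sum_map_le _ _).trans ?_
    have : (Z.map fun _ => 1 / s ^ (k + 1)).sum = Z.card * (1 / s ^ (k + 1)) := by simp
    rw [← this, ← Multiset.sum_map_add]
    refine Multiset.sum_map_le_sum_map _ _ fun ρ hρ => ?_
    refine (norm_add_le _ _).trans (add_le_add (by simp) ?_)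
    -- The reflected zeros lie outside the disc of radius R: |ρ-c|/R² ≤ r/R² ≤ 1/s. Their number is
    -- controlled by Jensen.
    rw [norm_pow, norm_div, Complex.norm_conj, norm_pow, Complex.norm_real,
      Real.norm_of_nonneg hR.le, ← one_div_pow]
    refine pow_le_pow_left₀ (by positivity) ?_ _
    rw [div_le_div_iff₀ (by positivity) hs]
    nlinarith [hZ ρ hρ, norm_nonneg (ρ - c)]
  refine (norm_add_le _ _).trans ?_
  rw [norm_mul, Complex.norm_natCast]
  calc _ ≤ (k + 1)! * (2 * M * s / (r - s)) / s ^ (k + 1) +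
        k ! * ((Z.map fun ρ => (‖c - ρ‖ ^ (k + 1))⁻¹).sum +
          M / Real.log (R / r) * (1 / s ^ (k + 1))) := by gcongr; exact hsum.trans (by gcongr)
    _ = _ := by rw [Nat.factorial_succ]; push_cast; ring

/-- The zeros of `f` near `c` and to the left of `c` are controlled by the logarithmic derivative
at `c`. -/
theorem DividesBy.sum_inv_sq_le {f g : ℂ → ℂ} {Z : Multiset ℂ} (h : DividesBy f Z g) {c : ℂ}
    {s r R M d : ℝ} (hs : 0 < s) (hsr : s < r) (hrR : r < R) (hM : 0 < M) (hfc : f c ≠ 0)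
    (hB : ∀ z, ‖z - c‖ ≤ R → ‖f z‖ ≤ Real.exp M * ‖f c‖) (hd : 0 < d)
    (hleft : ∀ z, f z = 0 → z.re ≤ c.re - d) (hZ : ∀ ρ ∈ Z, ‖ρ - c‖ ≤ r) :
    (Z.map fun ρ => (‖c - ρ‖ ^ 2)⁻¹).sum * (d * (1 - r ^ 2 / R ^ 2)) ≤
      ‖logDeriv f c‖ + 2 * M / (r - s) := by
  have hr := hs.trans hsr
  have hR := hr.trans hrR
  obtain ⟨Z', g', hle, h', hZ', hg'⟩ := h.exists_extend hr hrR hfc hB hZ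
  have herr := h'.norm_iteratedDeriv_blaschke_le hs hsr hrR hM hB hZ' hg' 0
  have heq := h'.iteratedDeriv_logDeriv hR hfc (fun ρ hρ => (hZ' ρ hρ).trans_lt hrR) 0
  simp only [iteratedDeriv_zero, zero_add, pow_one, Nat.factorial_zero, Nat.factorial_one,
    Nat.cast_one, one_mul, pow_zero] at herr heq
  have hmono : (Z.map fun ρ => (‖c - ρ‖ ^ 2)⁻¹).sum ≤ (Z'.map fun ρ => (‖c - ρ‖ ^ 2)⁻¹).sum := by
    obtain ⟨Y, rfl⟩ := Multiset.le_iff_exists_add.1 hle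
    rw [Multiset.map_add, Multiset.sum_add]
    refine le_add_of_nonneg_right (Multiset.sum_nonneg fun x hx => ?_)
    obtain ⟨ρ, -, rfl⟩ := Multiset.mem_map.1 hx
    positivity
  have hfac : 0 ≤ d * (1 - r ^ 2 / R ^ 2) := by
    refine mul_nonneg hd.le (sub_nonneg.2 ?_)
    rw [div_le_one (by positivity)]
    gcongr
  -- Each zero contributes the real part (Re c - Re ρ)(|c-ρ|⁻² - R⁻²). This is nonnegative because
  -- all zeros lie to the left of c, so the real part of f'/f dominates the sum without
  -- cancellation.
  have hre : (Z'.map fun ρ => (‖c - ρ‖ ^ 2)⁻¹).sum * (d * (1 - r ^ 2 / R ^ 2)) ≤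
      ((Z'.map fun ρ => ((c - ρ))⁻¹ + (conj (ρ - c) / R ^ 2)).sum).re := by
    have h1 : ((Z'.map fun ρ => ((c - ρ))⁻¹ + (conj (ρ - c) / R ^ 2)).sum).re =
        (Z'.map fun ρ => (((c - ρ))⁻¹ + (conj (ρ - c) / R ^ 2) : ℂ).re).sum := by
      rw [← Complex.coe_reAddGroupHom, map_multiset_sum, Multiset.map_map]; rfl
    rw [h1, ← Multiset.sum_map_mul_right]
    refine Multiset.sum_map_le_sum_map _ _ fun ρ hρ => ?_
    have hx := hleft ρ (h'.zero_of_mem hρ)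
    have hne : c - ρ ≠ 0 := fun h0 => hfc (by rw [sub_eq_zero.1 h0]; exact h'.zero_of_mem hρ)
    have hn : 0 < ‖c - ρ‖ := norm_pos_iff.2 hne
    have hnr : ‖c - ρ‖ ≤ r := by rw [norm_sub_rev]; exact hZ' ρ hρ
    have h2 : (((c - ρ))⁻¹ + (conj (ρ - c) / R ^ 2) : ℂ).re =
        (c.re - ρ.re) * ((‖c - ρ‖ ^ 2)⁻¹ - (R ^ 2)⁻¹) := by
      rw [Complex.add_re, Complex.inv_re, ← Complex.ofReal_pow, Complex.div_ofReal_re,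
        Complex.conj_re, Complex.normSq_eq_norm_sq, Complex.sub_re, Complex.sub_re]
      ring
    rw [h2]
    have h3 : (R ^ 2)⁻¹ ≤ (‖c - ρ‖ ^ 2)⁻¹ * (r ^ 2 / R ^ 2) := by
      rw [← div_eq_inv_mul, le_div_iff₀ (by positivity), ← div_eq_inv_mul]
      gcongr
    have h4 : 0 ≤ (‖c - ρ‖ ^ 2)⁻¹ - (R ^ 2)⁻¹ := by
      refine sub_nonneg.2 (inv_anti₀ (by positivity) ?_)
      gcongr
      exact hnr.trans hrR.le
    calc (‖c - ρ‖ ^ 2)⁻¹ * (d * (1 - r ^ 2 / R ^ 2))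
        = d * ((‖c - ρ‖ ^ 2)⁻¹ - (‖c - ρ‖ ^ 2)⁻¹ * (r ^ 2 / R ^ 2)) := by ring
      _ ≤ d * ((‖c - ρ‖ ^ 2)⁻¹ - (R ^ 2)⁻¹) := by gcongr
      _ ≤ _ := mul_le_mul_of_nonneg_right (by linarith) h4
  have hfin : ((Z'.map fun ρ => ((c - ρ))⁻¹ + (conj (ρ - c) / R ^ 2)).sum).re ≤
      ‖logDeriv f c‖ + 2 * M / (r - s) := by
    have h5 : (Z'.map fun ρ => ((c - ρ))⁻¹ + (conj (ρ - c) / R ^ 2)).sum = logDeriv f c -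
        logDeriv (fun z => g' z * blaschkeNum Z' c R z) c := by rw [heq]; ring
    have h6 : 2 * M * s / (r - s) / s = 2 * M / (r - s) := by
      have := hs.ne'
      field_simp
    rw [h5, ← h6]
    exact (Complex.re_le_norm _).trans ((norm_sub_le _ _).trans (by gcongr))
  exact (mul_le_mul_of_nonneg_right hmono hfac).trans (hre.trans hfin)

end

/-! ### Dirichlet series to the right of 1, and growth of L(s, χ) for Re s > 0. -/

section

open Complex Metric Set Filter Topology
open scoped ComplexConjugate Nat

lemma term_ofReal_eq (f : ℕ → ℝ) {σ : ℝ} (hσ : σ ≠ 0) (n : ℕ) :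
    LSeries.term (fun n => (f n : ℂ)) σ n = ((f n * (n : ℝ) ^ (-σ) : ℝ) : ℂ) := by
  rcases eq_or_ne n 0 with rfl | hn
  -- At n = 0 the series term is 0, while `0 ^ (-σ)` would be 1 for σ = 0.
  · simp [Real.zero_rpow (neg_ne_zero.2 hσ)]
  · rw [LSeries.term_of_ne_zero hn, Complex.ofReal_mul, Complex.ofReal_cpow (Nat.cast_nonneg n),
      Complex.ofReal_neg, Complex.cpow_neg, div_eq_mul_inv, Complex.ofReal_natCast]

/-- A Dirichlet series with nonnegative coefficients whose partial sums are at most `B n`. -/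
lemma tsum_mul_rpow_neg_le {f : ℕ → ℝ} (hf : ∀ n, 0 ≤ f n) {B : ℝ} (hB : 0 ≤ B)
    (hfB : ∀ n : ℕ, ∑ k ∈ Finset.Icc 1 n, f k ≤ B * n) {σ : ℝ} (hσ : 1 < σ) :
    Summable (fun n : ℕ => f n * (n : ℝ) ^ (-σ)) ∧
      ∑' n : ℕ, f n * (n : ℝ) ^ (-σ) ≤ B * (σ / (σ - 1)) := by
  have hσ0 : σ ≠ 0 := by positivity
  have hO : (fun n => ∑ k ∈ Finset.Icc 1 n, f k) =O[atTop] fun n : ℕ => (n : ℝ) ^ (1 : ℝ) := by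
    refine Asymptotics.IsBigO.of_bound B (Eventually.of_forall fun n => ?_)
    rw [Real.norm_of_nonneg (Finset.sum_nonneg fun k _ => hf k), Real.rpow_one,
      Real.norm_of_nonneg (Nat.cast_nonneg n)]
    exact hfB n
  have hs : (1 : ℝ) < (σ : ℂ).re := by simpa using hσ
  have hsum := LSeriesSummable_of_sum_norm_bigO_and_nonneg hO hf zero_le_one hs
  have hint := LSeries_eq_mul_integral_of_nonneg f zero_le_one hs hO hf
  simp only [LSeriesSummable, LSeries] at hsum hint
  simp_rw [term_ofReal_eq f hσ0] at hint
  rw [show LSeries.term (fun n => (f n : ℂ)) σ = fun n : ℕ => ((f n * (n : ℝ) ^ (-σ) : ℝ) : ℂ) from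
    funext (term_ofReal_eq f hσ0)] at hsum
  have hsum' : Summable (fun n : ℕ => f n * (n : ℝ) ^ (-σ)) := Complex.summable_ofReal.1 hsum
  refine ⟨hsum', ?_⟩
  have h1 : ∑' n : ℕ, f n * (n : ℝ) ^ (-σ) ≤ ‖∑' n : ℕ, ((f n * (n : ℝ) ^ (-σ) : ℝ) : ℂ)‖ := by
    rw [← Complex.ofReal_tsum, Complex.norm_real]
    exact Real.le_norm_self _
  refine h1.trans ?_
  rw [hint, norm_mul, Complex.norm_real, Real.norm_of_nonneg (by positivity)]
  have h2 : ‖∫ t in Ioi (1 : ℝ), (∑ k ∈ Finset.Icc 1 ⌊t⌋₊, (f k : ℂ)) * (t : ℂ) ^ (-((σ : ℂ) + 1))‖ ≤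
      ∫ t in Ioi (1 : ℝ), B * t ^ (-σ) := by
    refine MeasureTheory.norm_integral_le_of_norm_le
      ((integrableOn_Ioi_rpow_of_lt (by linarith) one_pos).const_mul B) ?_
    refine (MeasureTheory.ae_restrict_iff' measurableSet_Ioi).2 (Eventually.of_forall fun t ht => ?_)
    have ht0 : (0 : ℝ) < t := one_pos.trans ht
    rw [norm_mul, Complex.norm_cpow_eq_rpow_re_of_pos ht0, ← Complex.ofReal_sum, Complex.norm_real,
      Real.norm_of_nonneg (Finset.sum_nonneg fun k _ => hf k)]
    have h3 : ∑ k ∈ Finset.Icc 1 ⌊t⌋₊, f k ≤ B * t :=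
      (hfB _).trans (mul_le_mul_of_nonneg_left (Nat.floor_le ht0.le) hB)
    have h4 : t ^ (-σ) = t * t ^ (-((σ : ℂ) + 1)).re := by
      rw [show (-((σ : ℂ) + 1)).re = -σ - 1 by simp; ring, Real.rpow_sub_one ht0.ne']
      field_simp
    rw [h4, ← mul_assoc]
    gcongr
  rw [MeasureTheory.integral_const_mul, integral_Ioi_rpow_of_lt (by linarith) one_pos,
    Real.one_rpow] at h2
  calc _ ≤ σ * (B * (-1 / (-σ + 1))) := by gcongr
    _ = B * (σ / (σ - 1)) := by
      have : σ - 1 ≠ 0 := by linarith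
      have : -σ + 1 ≠ 0 := by linarith
      field_simp
      ring

lemma tsum_rpow_neg_le {σ : ℝ} (hσ : 1 < σ) :
    Summable (fun n : ℕ => (n : ℝ) ^ (-σ)) ∧ ∑' n : ℕ, (n : ℝ) ^ (-σ) ≤ σ / (σ - 1) := by
  have := tsum_mul_rpow_neg_le (f := fun _ => 1) (fun _ => zero_le_one) zero_le_one
    (fun n => by simp) hσ
  simpa using this

open ArithmeticFunction in
lemma tsum_vonMangoldt_mul_rpow_neg_le {σ : ℝ} (hσ : 1 < σ) :
    Summable (fun n : ℕ => vonMangoldt n * (n : ℝ) ^ (-σ)) ∧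
      ∑' n : ℕ, vonMangoldt n * (n : ℝ) ^ (-σ) ≤ 6 * (σ / (σ - 1)) := by
  refine tsum_mul_rpow_neg_le (fun _ => vonMangoldt_nonneg) (by norm_num) (fun n => ?_) hσ
  -- The 6 is a rounded-up Chebyshev constant for ψ.
  have h1 := Chebyshev.psi_le_const_mul_self (x := n) (Nat.cast_nonneg n)
  rw [Chebyshev.psi, Nat.floor_natCast] at h1
  have h2 : Finset.Icc 1 n = Finset.Ioc 0 n := rfl
  rw [h2]
  refine h1.trans (mul_le_mul_of_nonneg_right ?_ (Nat.cast_nonneg n))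
  have := Real.log_two_lt_d9
  have h4 : Real.log 4 = 2 * Real.log 2 := by
    rw [show (4 : ℝ) = 2 ^ 2 by norm_num, Real.log_pow]; norm_num
  linarith

section Character

variable {q : ℕ} [NeZero q] (χ : DirichletCharacter ℂ q)

/-- A nontrivial character sums to 0 over a full period, so whole periods are removed until fewer
than q terms remain. -/
lemma norm_sum_range_le (hχ : χ ≠ 1) (n : ℕ) :
    ‖∑ k ∈ Finset.range n, χ (k : ZMod q)‖ ≤ q := by
  induction n using Nat.strong_induction_on with
  | _ n ih =>
    rcases lt_or_ge n q with h | h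
    · refine (norm_sum_le _ _).trans ?_
      calc _ ≤ ∑ k ∈ Finset.range n, (1 : ℝ) :=
            Finset.sum_le_sum fun k _ => χ.norm_le_one k
        _ ≤ q := by simpa using h.le
    · obtain ⟨m, rfl⟩ := Nat.exists_eq_add_of_le h
      have hq : 0 < q := Nat.pos_of_ne_zero (NeZero.ne q)
      have hper : ∑ k ∈ Finset.range q, χ (k : ZMod q) = 0 := by
        rw [← MulChar.sum_eq_zero_of_ne_one hχ]
        refine Finset.sum_nbij' (fun k => (k : ZMod q)) ZMod.val (by simp)
          (fun a _ => Finset.mem_range.2 (ZMod.val_lt a))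
          (fun k hk => ZMod.val_cast_of_lt (Finset.mem_range.1 hk))
          (fun a _ => ZMod.natCast_zmod_val a) (fun _ _ => rfl)
      rw [Finset.sum_range_add, hper, zero_add]
      simpa using ih m (by omega)

lemma norm_sum_Icc_le (hχ : χ ≠ 1) (n : ℕ) :
    ‖∑ k ∈ Finset.Icc 1 n, χ (k : ZMod q)‖ ≤ q := by
  have hq1 : q ≠ 1 := by
    rintro rfl
    exact hχ (Subsingleton.elim _ _)
  have h0 : χ ((0 : ℕ) : ZMod q) = 0 := by
    have : Nontrivial (ZMod q) := ZMod.nontrivial_iff.2 hq1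
    rw [Nat.cast_zero, MulChar.map_zero]
  have h1 := norm_sum_range_le χ hχ (n + 1)
  rw [Finset.range_eq_Ico, Finset.sum_eq_sum_Ico_succ_bot (by omega), h0, zero_add] at h1
  exact h1

/-- The integral is the Mellin transform at -s of a bounded function supported on (1, ∞), which is
holomorphic for Re s > 0. -/
lemma differentiableAt_integral_sum_char (hχ : χ ≠ 1) {s : ℂ} (hs : 0 < s.re) :
    DifferentiableAt ℂ (fun s : ℂ => ∫ t in Ioi (1 : ℝ),
      (∑ k ∈ Finset.Icc 1 ⌊t⌋₊, χ (k : ZMod q)) * (t : ℂ) ^ (-(s + 1))) s := by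
  let S : ℝ → ℂ := fun t => ∑ k ∈ Finset.Icc 1 ⌊t⌋₊, χ (k : ZMod q)
  let f : ℝ → ℂ := (Ioi (1 : ℝ)).indicator S
  have hSm : Measurable S :=
    (measurable_from_nat (f := fun n : ℕ => ∑ k ∈ Finset.Icc 1 n, χ (k : ZMod q))).comp
      Nat.measurable_floor
  have hfm : Measurable f := hSm.indicator measurableSet_Ioi
  have hfb : ∀ t, ‖f t‖ ≤ q := fun t =>
    (norm_indicator_le_norm_self S t).trans (norm_sum_Icc_le χ hχ _)
  have heq : (fun s : ℂ => ∫ t in Ioi (1 : ℝ), S t * (t : ℂ) ^ (-(s + 1))) =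
      fun s => mellin f (-s) := by
    ext s
    rw [mellin, ← MeasureTheory.integral_indicator measurableSet_Ioi,
      ← MeasureTheory.integral_indicator measurableSet_Ioi]
    congr 1
    ext t
    by_cases ht : t ∈ Ioi (1 : ℝ)
    · have ht0 : t ∈ Ioi (0 : ℝ) := (zero_lt_one' ℝ).trans ht
      rw [indicator_of_mem ht, indicator_of_mem ht0, smul_eq_mul]
      simp only [f, indicator_of_mem ht]
      rw [mul_comm, neg_add, sub_eq_add_neg]
    · rw [indicator_of_notMem ht]
      by_cases ht0 : t ∈ Ioi (0 : ℝ)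
      · rw [indicator_of_mem ht0]; simp [f, indicator_of_notMem ht]
      · rw [indicator_of_notMem ht0]
  change DifferentiableAt ℂ (fun s : ℂ => ∫ t in Ioi (1 : ℝ), S t * (t : ℂ) ^ (-(s + 1))) s
  rw [heq]
  have hd : DifferentiableAt ℂ (mellin f) (-s) := by
    refine mellin_differentiableAt_of_isBigO_rpow (a := 0) (b := (-s).re - 1) ?_ ?_
      (by simpa using hs) ?_ (by linarith)
    · refine MeasureTheory.LocallyIntegrable.locallyIntegrableOn ?_ _
      refine (MeasureTheory.locallyIntegrable_const (q : ℝ)).mono hfm.aestronglyMeasurable ?_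
      refine Eventually.of_forall fun t => (hfb t).trans ?_
      simp
    · refine Asymptotics.IsBigO.of_bound q (Eventually.of_forall fun t => ?_)
      simpa using hfb t
    · refine Asymptotics.IsBigO.of_bound 0 ?_
      filter_upwards [mem_nhdsWithin_of_mem_nhds (Iio_mem_nhds (zero_lt_one' ℝ))] with t ht
      have : t ∉ Ioi (1 : ℝ) := fun h => absurd (mem_Iio.1 ht) (not_lt.2 (mem_Ioi.1 h).le)
      simp [f, indicator_of_notMem this]
  exact hd.comp s differentiableAt_id.neg

/-- Abel summation gives the formula for Re s > 1, and the identity theorem carries it to Re s > 0.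
-/
lemma LFunction_eq_mul_integral (hχ : χ ≠ 1) {s : ℂ} (hs : 0 < s.re) :
    DirichletCharacter.LFunction χ s = s * ∫ t in Ioi (1 : ℝ),
      (∑ k ∈ Finset.Icc 1 ⌊t⌋₊, χ (k : ZMod q)) * (t : ℂ) ^ (-(s + 1)) := by
  have hopen : IsOpen {s : ℂ | 0 < s.re} := isOpen_lt continuous_const continuous_re
  have h1 : AnalyticOnNhd ℂ (DirichletCharacter.LFunction χ) {s : ℂ | 0 < s.re} :=
    (DirichletCharacter.differentiable_LFunction hχ).differentiableOn.analyticOnNhd hopen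
  have h2 : AnalyticOnNhd ℂ (fun s : ℂ => s * ∫ t in Ioi (1 : ℝ),
      (∑ k ∈ Finset.Icc 1 ⌊t⌋₊, χ (k : ZMod q)) * (t : ℂ) ^ (-(s + 1))) {s : ℂ | 0 < s.re} := by
    refine DifferentiableOn.analyticOnNhd (fun s hs => ?_) hopen
    exact (differentiableAt_id.mul (differentiableAt_integral_sum_char χ hχ hs)).differentiableWithinAt
  refine h1.eqOn_of_preconnected_of_eventuallyEq h2
    (convex_halfSpace_re_gt 0).isPreconnected (z₀ := 2) (by simp) ?_ hs
  have hnhds : {s : ℂ | 1 < s.re} ∈ 𝓝 (2 : ℂ) :=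
    (isOpen_lt continuous_const continuous_re).mem_nhds (by simp)
  filter_upwards [hnhds] with s hs
  rw [DirichletCharacter.LFunction_eq_LSeries χ hs]
  refine LSeries_eq_mul_integral _ le_rfl (zero_lt_one.trans hs)
    (DirichletCharacter.LSeriesSummable_of_one_lt_re χ hs) ?_
  refine Asymptotics.IsBigO.of_bound q (Eventually.of_forall fun n => ?_)
  simpa using norm_sum_Icc_le χ hχ n

lemma norm_LFunction_le (hχ : χ ≠ 1) {s : ℂ} (hs : 0 < s.re) :
    ‖DirichletCharacter.LFunction χ s‖ ≤ q * ‖s‖ / s.re := by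
  rw [LFunction_eq_mul_integral χ hχ hs, norm_mul]
  have h2 : ‖∫ t in Ioi (1 : ℝ), (∑ k ∈ Finset.Icc 1 ⌊t⌋₊, χ (k : ZMod q)) *
      (t : ℂ) ^ (-(s + 1))‖ ≤ ∫ t in Ioi (1 : ℝ), q * t ^ (-s.re - 1) := by
    refine MeasureTheory.norm_integral_le_of_norm_le
      ((integrableOn_Ioi_rpow_of_lt (by linarith) one_pos).const_mul _) ?_
    refine (MeasureTheory.ae_restrict_iff' measurableSet_Ioi).2 (Eventually.of_forall fun t ht => ?_)
    have ht0 : (0 : ℝ) < t := one_pos.trans ht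
    rw [norm_mul, Complex.norm_cpow_eq_rpow_re_of_pos ht0,
      show (-(s + 1)).re = -s.re - 1 by simp; ring]
    gcongr
    exact norm_sum_Icc_le χ hχ _
  rw [MeasureTheory.integral_const_mul, integral_Ioi_rpow_of_lt (by linarith) one_pos,
    Real.one_rpow] at h2
  calc _ ≤ ‖s‖ * (q * (-1 / (-s.re - 1 + 1))) := by gcongr
    _ = q * ‖s‖ / s.re := by
      have := hs.ne'
      rw [show -s.re - 1 + 1 = -s.re by ring]
      field_simp

lemma norm_LSeries_le_tsum {f : ℕ → ℂ} {b : ℕ → ℝ} (hfb : ∀ n, ‖f n‖ ≤ b n) {s : ℂ} (hs0 : 0 < s.re)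
    (hb : Summable fun n : ℕ => b n * (n : ℝ) ^ (-s.re)) :
    ‖LSeries f s‖ ≤ ∑' n : ℕ, b n * (n : ℝ) ^ (-s.re) := by
  refine tsum_of_norm_bounded hb.hasSum fun n => ?_
  rcases eq_or_ne n 0 with rfl | hn
  · simp [Real.zero_rpow (neg_ne_zero.2 hs0.ne')]
  · rw [LSeries.term_of_ne_zero hn, norm_div, Complex.norm_natCast_cpow_of_pos (by omega),
      Real.rpow_neg (Nat.cast_nonneg n), div_eq_mul_inv]
    gcongr
    exact hfb n

/-- The series of μχ for 1/L is majorized by ζ(Re s) ≤ Re s/(Re s - 1). This keeps L from being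
small at the centres of the discs. -/
lemma one_le_norm_LFunction_mul {s : ℂ} (hs : 1 < s.re) :
    1 ≤ ‖DirichletCharacter.LFunction χ s‖ * (s.re / (s.re - 1)) := by
  have h1 := DirichletCharacter.LSeries.mul_mu_eq_one χ hs
  rw [← DirichletCharacter.LFunction_eq_LSeries χ hs] at h1
  have h2 := congrArg norm h1
  rw [norm_mul, norm_one] at h2
  obtain ⟨h3, h4⟩ := tsum_rpow_neg_le hs
  have h5 : ‖LSeries ((fun n : ℕ => χ (n : ZMod q)) *
      fun n : ℕ => ((ArithmeticFunction.moebius n : ℤ) : ℂ)) s‖ ≤ s.re / (s.re - 1) := by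
    refine (norm_LSeries_le_tsum (b := fun _ => 1) (fun n => ?_) (by linarith)
      (by simpa using h3)).trans (by simpa using h4)
    rw [Pi.mul_apply, norm_mul]
    have ha := χ.norm_le_one (n : ZMod q)
    have hb : ‖((ArithmeticFunction.moebius n : ℤ) : ℂ)‖ ≤ 1 := by
      rw [Complex.norm_intCast]
      exact_mod_cast ArithmeticFunction.abs_moebius_le_one
    exact mul_le_one₀ ha (norm_nonneg _) hb
  exact h2.symm.le.trans (mul_le_mul_of_nonneg_left h5 (norm_nonneg _))

end Character

end

/-! ### L'/L and its derivatives as Dirichlet series over prime powers. -/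

section

open Complex Metric Set Filter Topology
open scoped ComplexConjugate Nat

section Character

variable {q : ℕ} [NeZero q] (χ : DirichletCharacter ℂ q)

open ArithmeticFunction in
lemma logDeriv_LFunction_eq {s : ℂ} (hs : 1 < s.re) :
    logDeriv (DirichletCharacter.LFunction χ) s =
      -LSeries ((fun n : ℕ => χ (n : ZMod q)) * fun n : ℕ => (vonMangoldt n : ℂ)) s := by
  rw [DirichletCharacter.LSeries_twist_vonMangoldt_eq χ hs, logDeriv_apply,
    DirichletCharacter.deriv_LFunction_eq_deriv_LSeries χ hs,
    DirichletCharacter.LFunction_eq_LSeries χ hs, neg_div, neg_neg]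

lemma logMul_iterate (f : ℕ → ℂ) (k n : ℕ) :
    LSeries.logMul^[k] f n = ((Real.log n : ℝ) : ℂ) ^ k * f n := by
  induction k with
  | zero => simp
  | succ k ih =>
    rw [Function.iterate_succ_apply', LSeries.logMul, ih, pow_succ', mul_assoc,
      Complex.natCast_log]

open ArithmeticFunction in
lemma abscissaOfAbsConv_twist_lt {s : ℂ} (hs : 1 < s.re) :
    LSeries.abscissaOfAbsConv ((fun n : ℕ => χ (n : ZMod q)) *
      fun n : ℕ => (vonMangoldt n : ℂ)) < s.re := by
  have : LSeries.abscissaOfAbsConv ((fun n : ℕ => χ (n : ZMod q)) *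
      fun n : ℕ => (vonMangoldt n : ℂ)) ≤ 1 :=
    LSeries.abscissaOfAbsConv_le_of_forall_lt_LSeriesSummable fun y hy =>
      DirichletCharacter.LSeriesSummable_twist_vonMangoldt χ (by simpa using hy)
  exact this.trans_lt (by exact_mod_cast hs)

open ArithmeticFunction in
/-- The derivatives of `L'/L` to the right of `1`, for a real character. -/
lemma iteratedDeriv_logDeriv_LFunction {a : ℕ → ℝ} (ha : ∀ n : ℕ, χ (n : ZMod q) = a n)
    {σ : ℝ} (hσ : 1 < σ) (k : ℕ) :
    iteratedDeriv k (logDeriv (DirichletCharacter.LFunction χ)) σ = (-1) ^ (k + 1) *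
      ((∑' n : ℕ, a n * vonMangoldt n * Real.log n ^ k * (n : ℝ) ^ (-σ) : ℝ) : ℂ) := by
  have hs : 1 < (σ : ℂ).re := by simpa using hσ
  have hnhds : {s : ℂ | 1 < s.re} ∈ 𝓝 (σ : ℂ) :=
    (isOpen_lt continuous_const continuous_re).mem_nhds hs
  have heq : logDeriv (DirichletCharacter.LFunction χ) =ᶠ[𝓝 (σ : ℂ)]
      -LSeries ((fun n : ℕ => χ (n : ZMod q)) * fun n : ℕ => (vonMangoldt n : ℂ)) := by
    filter_upwards [hnhds] with s hs using logDeriv_LFunction_eq χ hs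
  rw [heq.iteratedDeriv_eq, iteratedDeriv_neg, LSeries_iteratedDeriv k
    (abscissaOfAbsConv_twist_lt χ hs), LSeries]
  have hterm : LSeries.term (LSeries.logMul^[k] ((fun n : ℕ => χ (n : ZMod q)) *
      fun n : ℕ => (vonMangoldt n : ℂ))) σ = fun n : ℕ =>
      ((a n * vonMangoldt n * Real.log n ^ k * (n : ℝ) ^ (-σ) : ℝ) : ℂ) := by
    rw [← funext (term_ofReal_eq (fun n => a n * vonMangoldt n * Real.log n ^ k) (by linarith))]
    congr 1
    ext n
    rw [logMul_iterate, Pi.mul_apply, ha]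
    push_cast
    ring
  rw [hterm, ← Complex.ofReal_tsum]
  ring

open ArithmeticFunction in
lemma summable_vonMangoldt_mul_log_pow {σ : ℝ} (hσ : 1 < σ) (k : ℕ) :
    Summable fun n : ℕ => vonMangoldt n * Real.log n ^ k * (n : ℝ) ^ (-σ) := by
  have hs : 1 < (σ : ℂ).re := by simpa using hσ
  have h1 : LSeries.abscissaOfAbsConv (LSeries.logMul^[k] fun n : ℕ => (vonMangoldt n : ℂ))
      < (σ : ℂ).re := by
    rw [LSeries.absicssaOfAbsConv_logPowMul]
    have : LSeries.abscissaOfAbsConv (fun n : ℕ => (vonMangoldt n : ℂ)) ≤ 1 :=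
      LSeries.abscissaOfAbsConv_le_of_forall_lt_LSeriesSummable fun y hy =>
        LSeriesSummable_vonMangoldt (by simpa using hy)
    exact this.trans_lt (by exact_mod_cast hs)
  have h2 := LSeriesSummable_of_abscissaOfAbsConv_lt_re h1
  have hterm : LSeries.term (LSeries.logMul^[k] fun n : ℕ => (vonMangoldt n : ℂ)) σ =
      fun n : ℕ => ((vonMangoldt n * Real.log n ^ k * (n : ℝ) ^ (-σ) : ℝ) : ℂ) := by
    rw [← funext (term_ofReal_eq (fun n => vonMangoldt n * Real.log n ^ k) (by linarith))]
    congr 1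
    ext n
    rw [logMul_iterate]
    push_cast
    ring
  rw [LSeriesSummable, hterm] at h2
  exact Complex.summable_ofReal.1 h2

open ArithmeticFunction in
lemma norm_logDeriv_LFunction_le {σ : ℝ} (hσ : 1 < σ) :
    ‖logDeriv (DirichletCharacter.LFunction χ) σ‖ ≤ 6 * (σ / (σ - 1)) := by
  rw [logDeriv_LFunction_eq χ (by simpa using hσ), norm_neg]
  obtain ⟨h1, h2⟩ := tsum_vonMangoldt_mul_rpow_neg_le hσ
  refine (norm_LSeries_le_tsum (b := fun n => vonMangoldt n) (fun n => ?_)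
    (by simp; linarith) (by simpa using h1)).trans (by simpa using h2)
  rw [Pi.mul_apply, norm_mul, Complex.norm_real, Real.norm_of_nonneg vonMangoldt_nonneg]
  exact mul_le_of_le_one_left vonMangoldt_nonneg (χ.norm_le_one _)

end Character

end

/-! ### Chebyshev and Mertens estimates for Λ. -/

section

open Set Filter Topology
open scoped Nat

section Mertens
open ArithmeticFunction

/-- Chebyshev's identity: log = Λ * 1, summed over n ≤ N and grouped by divisors. -/
lemma sum_vonMangoldt_mul_div (N : ℕ) :
    ∑ n ∈ Finset.Ioc 0 N, vonMangoldt n * ((N / n : ℕ) : ℝ) = Real.log N ! := by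
  rw [← sum_Ioc_mul_zeta_eq_sum vonMangoldt N, vonMangoldt_mul_zeta]
  induction N with
  | zero => simp
  | succ N ih =>
    rw [Finset.sum_Ioc_succ_top (Nat.zero_le N), ih, log_apply, Nat.factorial_succ, Nat.cast_mul,
      Real.log_mul (by positivity) (by positivity), add_comm]

lemma mul_log_sub_le_log_factorial {N : ℕ} (hN : N ≠ 0) :
    N * Real.log N - N ≤ Real.log N ! := by
  have hN' : (0 : ℝ) < N := by positivity
  have h1 := Stirling.le_factorial_stirling N
  have h2 : (1 : ℝ) ≤ √(2 * Real.pi * N) := by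
    rw [Real.one_le_sqrt]
    have : (1 : ℝ) ≤ N := by exact_mod_cast Nat.one_le_iff_ne_zero.2 hN
    nlinarith [Real.pi_gt_three]
  have h3 : ((N : ℝ) / Real.exp 1) ^ N ≤ N ! :=
    (le_mul_of_one_le_left (by positivity) h2).trans h1
  have h4 := Real.log_le_log (by positivity) h3
  rw [Real.log_pow, Real.log_div hN'.ne' (Real.exp_pos 1).ne', Real.log_exp] at h4
  linarith

lemma sum_vonMangoldt_le (N : ℕ) : ∑ n ∈ Finset.Ioc 0 N, vonMangoldt n ≤ 6 * N := by
  have h1 := Chebyshev.psi_le_const_mul_self (x := N) (Nat.cast_nonneg N)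
  rw [Chebyshev.psi, Nat.floor_natCast] at h1
  refine h1.trans (mul_le_mul_of_nonneg_right ?_ (Nat.cast_nonneg N))
  have := Real.log_two_lt_d9
  have h4 : Real.log 4 = 2 * Real.log 2 := by
    rw [show (4 : ℝ) = 2 ^ 2 by norm_num, Real.log_pow]; norm_num
  linarith

/-- Replacing ⌊N/n⌋ by N/n in Chebyshev's identity costs at most ψ(N) ≤ 6N, and log N! is known up
to N. -/
lemma mertens_nat {N : ℕ} (hN : N ≠ 0) :
    Real.log N - 1 ≤ ∑ n ∈ Finset.Ioc 0 N, vonMangoldt n / n ∧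
      ∑ n ∈ Finset.Ioc 0 N, vonMangoldt n / n ≤ Real.log N + 6 := by
  have hN' : (0 : ℝ) < N := by positivity
  have h1 := sum_vonMangoldt_mul_div N
  have h2 := mul_log_sub_le_log_factorial hN
  have h3 : Real.log N ! ≤ N * Real.log N := by
    rw [← Real.log_pow]
    exact Real.log_le_log (by positivity) (by exact_mod_cast Nat.factorial_le_pow N)
  have h4 : ∑ n ∈ Finset.Ioc 0 N, vonMangoldt n * ((N / n : ℕ) : ℝ) ≤
      N * ∑ n ∈ Finset.Ioc 0 N, vonMangoldt n / n := by
    rw [Finset.mul_sum]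
    refine Finset.sum_le_sum fun n _ => ?_
    calc _ ≤ vonMangoldt n * ((N : ℝ) / n) :=
          mul_le_mul_of_nonneg_left Nat.cast_div_le vonMangoldt_nonneg
      _ = _ := by ring
  have h5 : N * ∑ n ∈ Finset.Ioc 0 N, vonMangoldt n / n ≤
      ∑ n ∈ Finset.Ioc 0 N, vonMangoldt n * ((N / n : ℕ) : ℝ) + 6 * N := by
    refine le_trans ?_ (add_le_add_right (sum_vonMangoldt_le N) _)
    rw [Finset.mul_sum, ← Finset.sum_add_distrib]
    refine Finset.sum_le_sum fun n hn => ?_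
    have hn0 : (0 : ℝ) < n := by exact_mod_cast (Finset.mem_Ioc.1 hn).1
    have h6 : (N : ℝ) / n ≤ ((N / n : ℕ) : ℝ) + 1 := by
      rw [← Nat.floor_div_eq_div (K := ℝ)]
      exact (Nat.lt_floor_add_one _).le
    calc N * (vonMangoldt n / n) = vonMangoldt n * ((N : ℝ) / n) := by ring
      _ ≤ vonMangoldt n * (((N / n : ℕ) : ℝ) + 1) :=
          mul_le_mul_of_nonneg_left h6 vonMangoldt_nonneg
      _ = _ := by ring
  constructor
  · refine le_of_mul_le_mul_left ?_ hN'
    linarith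
  · refine le_of_mul_le_mul_left ?_ hN'
    linarith

/-- Mertens' first theorem. -/
lemma mertens {x : ℝ} (hx : 1 ≤ x) :
    Real.log x - 2 ≤ ∑ n ∈ Finset.Ioc 0 ⌊x⌋₊, vonMangoldt n / n ∧
      ∑ n ∈ Finset.Ioc 0 ⌊x⌋₊, vonMangoldt n / n ≤ Real.log x + 6 := by
  have hN : ⌊x⌋₊ ≠ 0 := (Nat.floor_pos.2 hx).ne'
  have hN1 : (1 : ℝ) ≤ ⌊x⌋₊ := by exact_mod_cast Nat.one_le_iff_ne_zero.2 hN
  obtain ⟨h1, h2⟩ := mertens_nat hN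
  have h3 : Real.log ⌊x⌋₊ ≤ Real.log x :=
    Real.log_le_log (by linarith) (Nat.floor_le (by linarith))
  have h4 : Real.log x ≤ Real.log 2 + Real.log ⌊x⌋₊ := by
    rw [← Real.log_mul (by norm_num) (by linarith)]
    refine Real.log_le_log (by linarith) ?_
    linarith [(Nat.lt_floor_add_one x).le]
  have := Real.log_two_lt_d9
  constructor <;> linarith

lemma sum_Ioc_eq_sub (f : ℕ → ℝ) {a b : ℕ} (h : a ≤ b) :
    ∑ n ∈ Finset.Ioc a b, f n = ∑ n ∈ Finset.Ioc 0 b, f n - ∑ n ∈ Finset.Ioc 0 a, f n := by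
  rw [← Finset.sum_Ioc_consecutive f (Nat.zero_le a) h]
  ring

lemma le_sum_Ioc_vonMangoldt_div {x y : ℝ} (hx : 1 ≤ x) (hxy : x ≤ y) :
    Real.log y - Real.log x - 8 ≤ ∑ n ∈ Finset.Ioc ⌊x⌋₊ ⌊y⌋₊, vonMangoldt n / n := by
  rw [sum_Ioc_eq_sub _ (Nat.floor_le_floor hxy)]
  linarith [(mertens hx).2, (mertens (hx.trans hxy)).1]

/-- A tail bound for the logarithmic derivative of `ζ` near `1`. -/
lemma sum_Ioc_vonMangoldt_mul_rpow_le {X κ : ℝ} (hX : 1 ≤ X) (hκ : 0 < κ) (N : ℕ) :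
    ∑ n ∈ Finset.Ioc ⌊X⌋₊ N, (n : ℝ) ^ (-κ) * (vonMangoldt n / n) ≤
      X ^ (-κ) * (1 / κ + 8) := by
  rcases le_or_gt N ⌊X⌋₊ with h | h
  · rw [Finset.Ioc_eq_empty (by omega), Finset.sum_empty]; positivity
  have hX0 : 0 < X := by linarith
  have hXN : X ≤ N := ((Nat.floor_lt hX0.le).1 h).le
  have hdf : ∀ t ∈ Icc X (N : ℝ), HasDerivAt (fun t : ℝ => t ^ (-κ)) (-κ * t ^ (-κ - 1)) t :=
    fun t ht => Real.hasDerivAt_rpow_const (Or.inl (by linarith [ht.1]))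
  have hcont : ContinuousOn (fun t : ℝ => -κ * t ^ (-κ - 1)) (Icc X N) :=
    continuousOn_const.mul (continuousOn_id.rpow_const fun t ht =>
      Or.inl (ne_of_gt (hX0.trans_le ht.1)))
  have hderiv : EqOn (deriv fun t : ℝ => t ^ (-κ)) (fun t : ℝ => -κ * t ^ (-κ - 1)) (Icc X N) :=
    fun t ht => (hdf t ht).deriv
  have hint : MeasureTheory.IntegrableOn (deriv fun t : ℝ => t ^ (-κ)) (Icc X N) :=
    (hcont.integrableOn_Icc).congr_fun hderiv.symm measurableSet_Icc
  have habel := sum_mul_eq_sub_sub_integral_mul (fun n : ℕ => vonMangoldt n / n) hX0.le hXN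
    (f := fun t : ℝ => t ^ (-κ)) (fun t ht => (hdf t ht).differentiableAt) hint
  rw [Nat.floor_natCast] at habel
  have hIcc : ∀ M : ℕ, ∑ n ∈ Finset.Icc 0 M, vonMangoldt n / (n : ℝ) =
      ∑ n ∈ Finset.Ioc 0 M, vonMangoldt n / (n : ℝ) := fun M => by
    rw [Finset.sum_Ioc_add_eq_sum_Icc (Nat.zero_le M) |>.symm]; simp
  simp only [hIcc] at habel
  rw [habel]
  -- G is an antiderivative of κ t^(-κ-1)(log t + 6), the majorant that Mertens' upper bound
  -- provides for the integrand of the Abel summation. The boundary terms at N cancel up to a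
  -- favourable sign, and those at X leave 1/κ + 6 + 2.
  let G : ℝ → ℝ := fun t => -(t ^ (-κ) * (Real.log t + (6 + 1 / κ)))
  have hG : ∀ t ∈ uIcc X (N : ℝ), HasDerivAt G (κ * t ^ (-κ - 1) * (Real.log t + 6)) t := by
    intro t ht
    rw [uIcc_of_le hXN] at ht
    have ht0 : 0 < t := hX0.trans_le ht.1
    have h1 := ((hdf t ht).mul ((Real.hasDerivAt_log ht0.ne').add_const (6 + 1 / κ))).neg
    refine h1.congr_deriv ?_
    rw [show t ^ (-κ) = t ^ (-κ - 1) * t by rw [← Real.rpow_add_one ht0.ne']; ring_nf]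
    field_simp
    ring
  have hcont2 : ContinuousOn (fun t : ℝ => κ * t ^ (-κ - 1) * (Real.log t + 6)) (Icc X N) := by
    refine (continuousOn_const.mul (continuousOn_id.rpow_const fun t ht =>
      Or.inl (ne_of_gt (hX0.trans_le ht.1)))).mul ((Real.continuousOn_log.mono ?_).add
      continuousOn_const)
    exact fun t ht => ne_of_gt (hX0.trans_le ht.1)
  have hftc := intervalIntegral.integral_eq_sub_of_hasDerivAt hG
    (hcont2.mono (by rw [uIcc_of_le hXN])).intervalIntegrable
  rw [intervalIntegral.integral_of_le hXN] at hftc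
  have hle : -∫ t in Ioc X (N : ℝ), deriv (fun t : ℝ => t ^ (-κ)) t *
      ∑ n ∈ Finset.Ioc 0 ⌊t⌋₊, vonMangoldt n / (n : ℝ) ≤ G N - G X := by
    rw [← hftc, ← MeasureTheory.integral_neg]
    refine MeasureTheory.setIntegral_mono_on ?_ ?_ measurableSet_Ioc fun t ht => ?_
    · have := integrableOn_mul_sum_Icc (fun n : ℕ => vonMangoldt n / (n : ℝ)) (m := 0) hX0.le hint
      simp only [hIcc] at this
      exact (this.mono_set Ioc_subset_Icc_self).neg
    · exact hcont2.integrableOn_Icc.mono_set Ioc_subset_Icc_self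
    · rw [hderiv (Ioc_subset_Icc_self ht)]
      have ht1 : 1 ≤ t := hX.trans ht.1.le
      have := mul_le_mul_of_nonneg_left (mertens ht1).2
        (by positivity : 0 ≤ κ * t ^ (-κ - 1))
      linarith
  have e1 := mul_le_mul_of_nonneg_left (mertens (hX.trans hXN)).2
    (by positivity : 0 ≤ (N : ℝ) ^ (-κ))
  rw [Nat.floor_natCast] at e1
  have e2 := mul_le_mul_of_nonneg_left (mertens hX).1 (by positivity : 0 ≤ X ^ (-κ))
  have e3 : 0 ≤ (N : ℝ) ^ (-κ) * (1 / κ) := by positivity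
  simp only [G] at hle
  linarith

end Mertens

end

/-! ### The weight (log n)^(m²) n^(-1-ma): its peak and its tail. -/

section

open Set Filter Topology
open scoped Nat

section Weights
open ArithmeticFunction

/-- Used with x = t/m and raised to the power m²: the linear term becomes e^(tm) and the quadratic
one a factor independent of m. The next lemma is the matching upper bound. -/
lemma exp_sub_sq_div_two_le {x : ℝ} (hx : 0 ≤ x) : Real.exp (x - x ^ 2 / 2) ≤ 1 + x := by
  rw [← Real.le_log_iff_exp_le (by linarith)]
  refine le_trans ?_ (Real.le_log_one_add_of_nonneg hx)
  rw [le_div_iff₀ (by linarith)]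
  nlinarith [pow_nonneg hx 3]

lemma one_add_le_exp_sub_sq_div_six {x : ℝ} (hx : 0 ≤ x) (hx1 : x ≤ 1) :
    1 + x ≤ Real.exp (x - x ^ 2 / 6) := by
  have h0 : 0 ≤ x - x ^ 2 / 6 := by nlinarith
  refine le_trans ?_ (Real.quadratic_le_exp_of_nonneg h0)
  have : x * (5 / 6) ≤ x - x ^ 2 / 6 := by nlinarith
  nlinarith [mul_self_le_mul_self (by positivity : 0 ≤ x * (5 / 6)) this]

/-- The weight `(log n) ^ (m ^ 2) * n ^ (-1 - m a)`, which is concentrated near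
`log n = m / a`. -/
noncomputable def gammaWeight (m : ℕ) (a : ℝ) (n : ℕ) : ℝ :=
  Real.log n ^ (m ^ 2) * (n : ℝ) ^ (-(1 + m * a))

/-- The maximum of `u ^ (m ^ 2) * exp (-(m a u))`, attained at `u = m / a`. -/
noncomputable def gammaPeak (m : ℕ) (a : ℝ) : ℝ := (m / a) ^ (m ^ 2) * Real.exp (-(m : ℝ) ^ 2)

lemma gammaWeight_nonneg (m : ℕ) (a : ℝ) (n : ℕ) : 0 ≤ gammaWeight m a n := by
  unfold gammaWeight
  have := Real.log_natCast_nonneg n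
  positivity

lemma gammaPeak_pos {m : ℕ} (hm : 0 < m) {a : ℝ} (ha : 0 < a) : 0 < gammaPeak m a := by
  unfold gammaPeak; positivity

lemma gammaWeight_eq {m : ℕ} {a : ℝ} {n : ℕ} (hn : n ≠ 0) :
    gammaWeight m a n =
      Real.log n ^ (m ^ 2) * Real.exp (-(m * a * Real.log n)) * (n : ℝ)⁻¹ := by
  have hn' : (0 : ℝ) < n := by positivity
  rw [gammaWeight, show -(1 + (m : ℝ) * a) = -(m * a) - 1 by ring, Real.rpow_sub_one hn'.ne',
    Real.rpow_def_of_pos hn', div_eq_mul_inv, ← mul_assoc]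
  congr 3; ring

/-- For m ≤ a log n ≤ m + 1 the weight times n stays above e^(-1/2) of its peak. Mertens gives this
window mass at least 1/a - 8, which is at least 1/(2a) because a ≤ 1/16. -/
lemma le_sum_gammaWeight {m : ℕ} (hm : 0 < m) {a : ℝ} (ha : 0 < a) (ha1 : a ≤ 1 / 16) :
    Real.exp (-1 / 2) * gammaPeak m a / (2 * a) ≤
      ∑ n ∈ Finset.Ioc ⌊Real.exp (m / a)⌋₊ ⌊Real.exp ((m + 1) / a)⌋₊,
        vonMangoldt n * gammaWeight m a n := by
  have hm' : (0 : ℝ) < m := by exact_mod_cast hm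
  have hx : 1 ≤ Real.exp (m / a) := Real.one_le_exp (by positivity)
  have h1 := le_sum_Ioc_vonMangoldt_div hx
    (Real.exp_le_exp.2 (by gcongr; linarith) : Real.exp (m / a) ≤ Real.exp ((m + 1) / a))
  rw [Real.log_exp, Real.log_exp] at h1
  have h2 : 1 / (2 * a) ≤ (m + 1) / a - m / a - 8 := by
    rw [← sub_div, add_sub_cancel_left, div_le_iff₀ (by positivity), sub_mul]
    field_simp
    linarith
  have h3 : ∀ n ∈ Finset.Ioc ⌊Real.exp (m / a)⌋₊ ⌊Real.exp ((m + 1) / a)⌋₊,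
      Real.exp (-1 / 2) * gammaPeak m a * (vonMangoldt n / n) ≤
        vonMangoldt n * gammaWeight m a n := by
    intro n hn
    obtain ⟨hn1, hn2⟩ := Finset.mem_Ioc.1 hn
    have hn1 := (Nat.floor_lt (by positivity)).1 hn1
    have hn2 := (Nat.le_floor_iff (by positivity)).1 hn2
    have hn0 : (0 : ℝ) < n := (Real.exp_pos _).trans hn1
    have hne : n ≠ 0 := by rintro rfl; simp at hn0
    have hu1 : m / a < Real.log n := (Real.lt_log_iff_exp_lt hn0).2 hn1
    have hu2 : Real.log n ≤ (m + 1) / a := (Real.log_le_iff_le_exp hn0).2 hn2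
    rw [gammaWeight_eq hne]
    obtain ⟨t, ht⟩ : ∃ t, t = a * Real.log n - m := ⟨_, rfl⟩
    have ht0 : 0 ≤ t := by rw [ht, sub_nonneg, mul_comm]; exact ((div_lt_iff₀ ha).1 hu1).le
    have ht1 : t ≤ 1 := by
      have := (le_div_iff₀ ha).1 hu2
      rw [ht]; linarith
    have hlog : Real.log n = m / a * (1 + t / m) := by rw [ht]; field_simp; ring
    have hkey : Real.exp (-1 / 2) * gammaPeak m a ≤
        Real.log n ^ (m ^ 2) * Real.exp (-(m * a * Real.log n)) := by
      have e1 : Real.exp (t * m - t ^ 2 / 2) ≤ (1 + t / m) ^ (m ^ 2) := by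
        have := pow_le_pow_left₀ (Real.exp_nonneg _)
          (exp_sub_sq_div_two_le (by positivity : 0 ≤ t / m)) (m ^ 2)
        rwa [← Real.exp_nat_mul, show ((m ^ 2 : ℕ) : ℝ) * (t / m - (t / m) ^ 2 / 2) =
          t * m - t ^ 2 / 2 by push_cast; field_simp] at this
      have e2 : -(m * a * Real.log n) = -(m : ℝ) ^ 2 - t * m := by
        rw [hlog]; field_simp; ring
      rw [e2, hlog, mul_pow, gammaPeak]
      calc Real.exp (-1 / 2) * ((m / a) ^ m ^ 2 * Real.exp (-(m : ℝ) ^ 2))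
          ≤ Real.exp (-t ^ 2 / 2) * ((m / a) ^ m ^ 2 * Real.exp (-(m : ℝ) ^ 2)) := by
            gcongr; nlinarith
        _ = (m / a) ^ m ^ 2 * Real.exp (t * m - t ^ 2 / 2) * Real.exp (-(m : ℝ) ^ 2 - t * m) := by
            rw [mul_assoc, ← Real.exp_add, ← mul_assoc, mul_comm (Real.exp _), mul_assoc,
              ← Real.exp_add]
            congr 2; ring
        _ ≤ _ := by gcongr
    have := mul_le_mul_of_nonneg_right hkey
      (by positivity : 0 ≤ vonMangoldt n / (n : ℝ))
    refine this.trans_eq ?_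
    field_simp
  refine le_trans ?_ (Finset.sum_le_sum h3)
  rw [← Finset.mul_sum]
  have := mul_le_mul_of_nonneg_left (h2.trans h1)
    (by have := gammaPeak_pos hm ha; positivity : 0 ≤ Real.exp (-1 / 2) * gammaPeak m a)
  refine le_trans (le_of_eq ?_) this
  field_simp

/-- The function m² log u - m a u is concave, so past U = (m+6)/a the weight lies below the
exponential tangent at U, of decay rate κ = ma - m²/U. At U it has already dropped to e^(-6) of its
peak. The condition m ≥ 6 gives κ ≥ 3a, and 1/(3a) + 8 ≤ 1/a. -/
lemma sum_gammaWeight_tail_le {m : ℕ} (hm : 6 ≤ m) {a : ℝ} (ha : 0 < a) (ha1 : a ≤ 1 / 16)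
    (N : ℕ) : ∑ n ∈ Finset.Ioc ⌊Real.exp ((m + 6) / a)⌋₊ N,
      vonMangoldt n * gammaWeight m a n ≤ Real.exp (-6) * gammaPeak m a / a := by
  have hm' : (6 : ℝ) ≤ m := by exact_mod_cast hm
  have hm0 : (0 : ℝ) < m := by linarith
  set U : ℝ := (m + 6) / a with hU
  have hU0 : 0 < U := by positivity
  set κ : ℝ := m * a * 6 / (m + 6) with hκ
  have hκ0 : 0 < κ := by positivity
  have hκ1 : 3 * a ≤ κ := by
    rw [hκ, le_div_iff₀ (by positivity)]
    nlinarith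
  have hkU : κ = m * a - (m : ℝ) ^ 2 / U := by
    rw [hκ, hU]; field_simp; ring
  have hpeak : U ^ (m ^ 2) * Real.exp (-(m * a * U)) ≤ Real.exp (-6) * gammaPeak m a := by
    have e1 : (1 + 6 / (m : ℝ)) ^ (m ^ 2) ≤ Real.exp (6 * m - 6) := by
      have := pow_le_pow_left₀ (by positivity) (one_add_le_exp_sub_sq_div_six
        (by positivity : 0 ≤ 6 / (m : ℝ)) ((div_le_one hm0).2 hm')) (m ^ 2)
      rwa [← Real.exp_nat_mul, show ((m ^ 2 : ℕ) : ℝ) * (6 / m - (6 / m) ^ 2 / 6) =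
        6 * m - 6 by push_cast; field_simp] at this
    have e2 : U = m / a * (1 + 6 / m) := by rw [hU]; field_simp
    have e3 : -(m * a * U) = -(m : ℝ) ^ 2 - 6 * m := by rw [hU]; field_simp; ring
    rw [e3, e2, mul_pow, gammaPeak]
    calc (m / a) ^ m ^ 2 * (1 + 6 / (m : ℝ)) ^ (m ^ 2) * Real.exp (-(m : ℝ) ^ 2 - 6 * m)
        ≤ (m / a) ^ m ^ 2 * Real.exp (6 * m - 6) * Real.exp (-(m : ℝ) ^ 2 - 6 * m) := by gcongr
      _ = _ := by
        rw [mul_assoc, ← Real.exp_add, ← mul_assoc, mul_comm (Real.exp _), mul_assoc,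
          ← Real.exp_add]
        congr 2; ring
  have hX1 : 1 ≤ Real.exp U := Real.one_le_exp hU0.le
  have htail := sum_Ioc_vonMangoldt_mul_rpow_le hX1 hκ0 N
  have hterm : ∀ n ∈ Finset.Ioc ⌊Real.exp U⌋₊ N, vonMangoldt n * gammaWeight m a n ≤
      Real.exp (-6) * gammaPeak m a * Real.exp (κ * U) * ((n : ℝ) ^ (-κ) * (vonMangoldt n / n)) := by
    intro n hn
    have hn1 := (Nat.floor_lt (by positivity)).1 (Finset.mem_Ioc.1 hn).1
    have hn0 : (0 : ℝ) < n := (Real.exp_pos _).trans hn1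
    have hne : n ≠ 0 := by rintro rfl; simp at hn0
    have hu1 : U < Real.log n := (Real.lt_log_iff_exp_lt hn0).2 hn1
    set u := Real.log n with hu
    have e1 : u ^ (m ^ 2) ≤ U ^ (m ^ 2) * Real.exp ((m : ℝ) ^ 2 / U * (u - U)) := by
      have e2 : u / U ≤ Real.exp ((u - U) / U) := by
        refine le_trans (le_of_eq ?_) (Real.add_one_le_exp _)
        field_simp; ring
      have e3 := pow_le_pow_left₀ (div_nonneg (hU0.le.trans hu1.le) hU0.le) e2 (m ^ 2)
      rwa [div_pow, div_le_iff₀ (by positivity), ← Real.exp_nat_mul, mul_comm,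
        show ((m ^ 2 : ℕ) : ℝ) * ((u - U) / U) = (m : ℝ) ^ 2 / U * (u - U) by
          push_cast; ring] at e3
    rw [gammaWeight_eq hne, Real.rpow_def_of_pos hn0, ← hu]
    have e4 : u ^ (m ^ 2) * Real.exp (-(m * a * u)) ≤
        Real.exp (-6) * gammaPeak m a * Real.exp (κ * U) * Real.exp (u * -κ) := by
      calc u ^ (m ^ 2) * Real.exp (-(m * a * u))
          ≤ U ^ (m ^ 2) * Real.exp ((m : ℝ) ^ 2 / U * (u - U)) * Real.exp (-(m * a * u)) := by
            gcongr
        _ = U ^ (m ^ 2) * Real.exp (-(m * a * U)) * (Real.exp (κ * U) * Real.exp (u * -κ)) := by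
            rw [mul_assoc, ← Real.exp_add, mul_assoc (U ^ (m ^ 2)) (Real.exp _), ← Real.exp_add,
              ← Real.exp_add]
            congr 2
            rw [hkU]; ring
        _ ≤ _ := by rw [mul_assoc (Real.exp (-6) * gammaPeak m a)]; gcongr
    have := mul_le_mul_of_nonneg_right e4
      (by positivity : 0 ≤ vonMangoldt n / (n : ℝ))
    calc _ = u ^ (m ^ 2) * Real.exp (-(m * a * u)) * (vonMangoldt n / n) := by ring
      _ ≤ _ := this
      _ = _ := by ring
  refine (Finset.sum_le_sum hterm).trans ?_
  rw [← Finset.mul_sum]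
  have hP := gammaPeak_pos (by omega : 0 < m) ha
  calc _ ≤ Real.exp (-6) * gammaPeak m a * Real.exp (κ * U) *
        (Real.exp U ^ (-κ) * (1 / κ + 8)) := by gcongr
    _ = Real.exp (-6) * gammaPeak m a * (1 / κ + 8) := by
        rw [← Real.exp_mul]
        have : Real.exp (κ * U) * Real.exp (U * -κ) = 1 := by rw [← Real.exp_add]; simp [mul_comm]
        linear_combination (Real.exp (-6) * gammaPeak m a * (1 / κ + 8)) * this
    _ ≤ Real.exp (-6) * gammaPeak m a * (1 / a) := by
        gcongr
        have h5 : 1 / κ ≤ 1 / (3 * a) := by gcongr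
        have h6 : (8 : ℝ) ≤ 1 / (2 * a) := by rw [le_div_iff₀ (by positivity)]; linarith
        refine (add_le_add h5 h6).trans ?_
        have : 0 < a := ha
        rw [div_add_div _ _ (by positivity) (by positivity),
          div_le_div_iff₀ (by positivity) (by positivity)]
        nlinarith [sq_nonneg a]
    _ = _ := by ring

lemma sum_prime_pow_rpow_le {p : ℕ} (hp : p.Prime) (N : ℕ) :
    ∑ j ∈ Finset.Icc 1 N, ((p ^ j : ℕ) : ℝ) ^ (-(1 / 10) : ℝ) ≤ 14 := by
  have hp2 : (2 : ℝ) ≤ p := by exact_mod_cast hp.two_le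
  set x : ℝ := (p : ℝ) ^ (-(1 / 10) : ℝ) with hx
  have hx0 : 0 ≤ x := by positivity
  -- The ratio is at most 2^(-1/10) ≤ 14/15, and a geometric series of ratio 14/15 starting at its
  -- first power sums to 14.
  have hx1 : x ≤ 14 / 15 := by
    have h1 : x ^ 10 ≤ (14 / 15 : ℝ) ^ 10 := by
      rw [hx, ← Real.rpow_mul_natCast (by positivity)]
      norm_num
      rw [Real.rpow_neg_one]
      refine (inv_anti₀ (by norm_num) hp2).trans (by norm_num)
    exact le_of_pow_le_pow_left₀ (by norm_num) (by norm_num) h1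
  have h2 : ∀ j ∈ Finset.Icc 1 N, ((p ^ j : ℕ) : ℝ) ^ (-(1 / 10) : ℝ) = x ^ j := by
    intro j _
    rw [hx, ← Real.rpow_mul_natCast (by positivity), Nat.cast_pow, ← Real.rpow_natCast_mul
      (by positivity), mul_comm]
  rw [Finset.sum_congr rfl h2]
  have h4 : ∀ M : ℕ, ∑ j ∈ Finset.Icc 1 M, x ^ j ≤ 14 * (1 - (14 / 15) ^ M) := by
    intro M
    induction M with
    | zero => simp
    | succ M ih =>
      rw [Finset.sum_Icc_succ_top (by omega)]
      have := pow_le_pow_left₀ hx0 hx1 (M + 1)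
      rw [pow_succ (14 / 15 : ℝ)] at this ⊢
      linarith
  refine (h4 N).trans ?_
  have : (0 : ℝ) ≤ (14 / 15) ^ N := by positivity
  linarith

end Weights

end

/-! ### The contribution of primes dividing q, and Stirling's formula for (m²)!. -/

section

open Set Filter Topology
open scoped Nat

section Weights
open ArithmeticFunction

/-- Only powers of the primes p dividing q occur. Each p contributes at most 14 log p, and the sum
of these log p is at most log q. -/
lemma sum_vonMangoldt_not_coprime_le {q : ℕ} (hq : q ≠ 0) (N : ℕ) :
    ∑ n ∈ Finset.Ioc 0 N with ¬ n.Coprime q, vonMangoldt n * (n : ℝ) ^ (-(1 / 10) : ℝ) ≤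
      14 * Real.log q := by
  classical
  set f : ℕ → ℝ := fun n =>
    if n.Coprime q then 0 else vonMangoldt n * (n : ℝ) ^ (-(1 / 10) : ℝ) with hf
  have hf0 : ∀ n, 0 ≤ f n := fun n => by
    simp only [hf]; split_ifs
    · exact le_rfl
    · have := vonMangoldt_nonneg (n := n); positivity
  have h1 : ∑ n ∈ Finset.Ioc 0 N with ¬ n.Coprime q, vonMangoldt n * (n : ℝ) ^ (-(1 / 10) : ℝ) =
      ∑ n ∈ Finset.Ioc 0 ⌊(N : ℝ)⌋₊ with IsPrimePow n, f n := by
    rw [Nat.floor_natCast, Finset.sum_filter, Finset.sum_filter]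
    refine Finset.sum_congr rfl fun n _ => ?_
    by_cases hn : n.Coprime q
    · simp [hf, hn]
    · by_cases hp : IsPrimePow n
      · simp [hf, hn, hp]
      · simp [hn, hp, vonMangoldt_apply]
  rw [h1, Chebyshev.sum_PrimePow_eq_sum_sum' f (Nat.cast_nonneg N) le_rfl]
  set M := ⌊Real.log N / Real.log 2⌋₊
  have h2 : ∀ k ∈ Finset.Icc 1 M,
      ∑ p ∈ Finset.Ioc 0 ⌊(N : ℝ) ^ ((1 : ℝ) / k)⌋₊ with p.Prime, f (p ^ k) ≤
        ∑ p ∈ q.primeFactors, Real.log p * ((p ^ k : ℕ) : ℝ) ^ (-(1 / 10) : ℝ) := by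
    intro k hk
    have hk0 : k ≠ 0 := by have := (Finset.mem_Icc.1 hk).1; omega
    have h3 : ∀ p : ℕ, p.Prime → ¬ p.Coprime q → p ∈ q.primeFactors := fun p hp h =>
      Nat.mem_primeFactors.2 ⟨hp, by
        by_contra hd; exact h ((Nat.Prime.coprime_iff_not_dvd hp).2 hd), hq⟩
    rw [← Finset.sum_filter_ne_zero]
    refine (Finset.sum_le_sum_of_subset_of_nonneg (t := q.primeFactors) (fun p hp => ?_)
      fun p _ _ => hf0 _).trans (Finset.sum_le_sum fun p hp => ?_)
    · obtain ⟨hp, h0⟩ := Finset.mem_filter.1 hp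
      refine h3 p (Finset.mem_filter.1 hp).2 fun hc => h0 ?_
      simp [hf, Nat.Coprime.pow_left k hc]
    · simp only [hf]
      split_ifs
      · exact mul_nonneg (Real.log_natCast_nonneg p) (by positivity)
      · rw [vonMangoldt_apply_pow hk0, vonMangoldt_apply_prime (Nat.prime_of_mem_primeFactors hp)]
  refine (Finset.sum_le_sum h2).trans ?_
  rw [Finset.sum_comm]
  have h4 : ∀ p ∈ q.primeFactors, ∑ k ∈ Finset.Icc 1 M,
      Real.log p * ((p ^ k : ℕ) : ℝ) ^ (-(1 / 10) : ℝ) ≤ 14 * Real.log p := by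
    intro p hp
    rw [← Finset.mul_sum, mul_comm]
    exact mul_le_mul_of_nonneg_right (sum_prime_pow_rpow_le (Nat.prime_of_mem_primeFactors hp) M)
      (Real.log_natCast_nonneg p)
  refine (Finset.sum_le_sum h4).trans ?_
  rw [← Finset.mul_sum, ← Real.log_prod fun p hp => by
    have := (Nat.prime_of_mem_primeFactors hp).pos
    positivity]
  have h5 : ((∏ p ∈ q.primeFactors, p : ℕ) : ℝ) ≤ q := by
    exact_mod_cast Nat.le_of_dvd (Nat.pos_of_ne_zero hq) (Nat.prod_primeFactors_dvd q)
  have h6 : 0 < ∏ p ∈ q.primeFactors, p :=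
    Finset.prod_pos fun p hp => (Nat.prime_of_mem_primeFactors hp).pos
  rw [← Nat.cast_prod]
  gcongr

/-- A factor n^(-1/10) is kept for convergence over prime powers. The remaining n^(-9/10) shifts the
rate from ma to b = ma + 9/10, which lowers the maximum over u = log n by (ma/b)^(m²). -/
lemma gammaWeight_le {m : ℕ} (hm : 0 < m) {a : ℝ} (ha : 0 < a) {n : ℕ} (hn : n ≠ 0) :
    gammaWeight m a n ≤ gammaPeak m a * (m * a / (m * a + 9 / 10)) ^ (m ^ 2) *
      (n : ℝ) ^ (-(1 / 10) : ℝ) := by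
  have hm' : (0 : ℝ) < m := by exact_mod_cast hm
  have hn0 : (0 : ℝ) < n := by positivity
  set b : ℝ := m * a + 9 / 10 with hb
  have hb0 : 0 < b := by positivity
  have hu0 : 0 ≤ Real.log n := Real.log_natCast_nonneg n
  rw [gammaWeight_eq hn]
  set u := Real.log n with hu
  have e1 : u ^ (m ^ 2) ≤ ((m : ℝ) ^ 2 / b) ^ (m ^ 2) * Real.exp (b * u - (m : ℝ) ^ 2) := by
    have e2 : u / ((m : ℝ) ^ 2 / b) ≤ Real.exp (b * u / (m : ℝ) ^ 2 - 1) := by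
      refine le_trans (le_of_eq ?_) (Real.add_one_le_exp _)
      field_simp; ring
    have e3 := pow_le_pow_left₀ (by positivity) e2 (m ^ 2)
    rwa [div_pow, div_le_iff₀ (by positivity), ← Real.exp_nat_mul, mul_comm,
      show ((m ^ 2 : ℕ) : ℝ) * (b * u / (m : ℝ) ^ 2 - 1) = b * u - (m : ℝ) ^ 2 by
        push_cast; field_simp] at e3
  have e4 : (n : ℝ)⁻¹ = Real.exp (-(9 / 10) * u) * (n : ℝ) ^ (-(1 / 10) : ℝ) := by
    rw [Real.rpow_def_of_pos hn0, ← hu, ← Real.exp_add, show -(9 / 10) * u + u * -(1 / 10) = -u by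
      ring, Real.exp_neg, Real.exp_log hn0]
  have e5 : gammaPeak m a * (m * a / b) ^ (m ^ 2) =
      ((m : ℝ) ^ 2 / b) ^ (m ^ 2) * Real.exp (-(m : ℝ) ^ 2) := by
    rw [gammaPeak, mul_right_comm, ← mul_pow]
    congr 2
    field_simp
  rw [e4, e5, ← mul_assoc]
  refine mul_le_mul_of_nonneg_right ?_ (by positivity)
  calc _ ≤ ((m : ℝ) ^ 2 / b) ^ (m ^ 2) * Real.exp (b * u - (m : ℝ) ^ 2) *
        Real.exp (-(m * a * u)) * Real.exp (-(9 / 10) * u) := by gcongr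
    _ = _ := by
      rw [mul_assoc, mul_assoc, ← Real.exp_add, ← Real.exp_add]
      congr 2
      rw [hb]; ring

lemma sum_gammaWeight_not_coprime_le {m : ℕ} (hm : 0 < m) {a : ℝ} (ha : 0 < a) {q : ℕ}
    (hq : q ≠ 0) (N : ℕ) :
    ∑ n ∈ Finset.Ioc 0 N with ¬ n.Coprime q, vonMangoldt n * gammaWeight m a n ≤
      gammaPeak m a * (m * a / (m * a + 9 / 10)) ^ (m ^ 2) * (14 * Real.log q) := by
  refine le_trans ?_ (mul_le_mul_of_nonneg_left (sum_vonMangoldt_not_coprime_le hq N)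
    (by have := gammaPeak_pos hm ha; positivity))
  rw [Finset.mul_sum]
  refine Finset.sum_le_sum fun n hn => ?_
  have hn0 : n ≠ 0 := by
    have := (Finset.mem_Ioc.1 (Finset.mem_filter.1 hn).1).1; omega
  refine (mul_le_mul_of_nonneg_left (gammaWeight_le hm ha hn0) vonMangoldt_nonneg).trans_eq ?_
  ring

/-- The Stirling sequence decreases from its value e/√2 at 1. -/
lemma factorial_le_stirling {k : ℕ} (hk : k ≠ 0) :
    (k ! : ℝ) ≤ Real.exp 1 * √k * (k / Real.exp 1) ^ k := by
  obtain ⟨j, rfl⟩ := Nat.exists_eq_succ_of_ne_zero hk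
  have h1 := Stirling.stirlingSeq'_antitone (Nat.zero_le j)
  simp only [Function.comp, Nat.succ_eq_add_one, zero_add] at h1
  rw [Stirling.stirlingSeq_one, Stirling.stirlingSeq, div_le_iff₀ (by positivity)] at h1
  refine h1.trans (le_of_eq ?_)
  rw [Nat.succ_eq_add_one, Real.sqrt_mul (by norm_num)]
  have : √(2 : ℝ) ≠ 0 := by positivity
  field_simp

/-- The quotient (m²)!/(ma)^(m²+1) is the integral of u^(m²) e^(-mau), that is, about peak times
width 1/a. This puts the bound from the zeros and the bound from the primes on the same scale. -/
lemma factorial_sq_le {m : ℕ} (hm : 0 < m) {a : ℝ} (ha : 0 < a) :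
    ((m ^ 2)! : ℝ) ≤ Real.exp 1 * (gammaPeak m a / a) * (m * a) ^ (m ^ 2 + 1) := by
  have hm' : (0 : ℝ) < m := by exact_mod_cast hm
  refine (factorial_le_stirling (by positivity)).trans (le_of_eq ?_)
  rw [Nat.cast_pow, Real.sqrt_sq hm'.le, gammaPeak]
  have h1 : Real.exp (-(m : ℝ) ^ 2) = (1 / Real.exp 1) ^ (m ^ 2) := by
    rw [one_div, ← Real.exp_neg, ← Real.exp_nat_mul]; push_cast; congr 1; ring
  have h2 : ((m : ℝ) ^ 2 / Real.exp 1) ^ (m ^ 2) =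
      (m / a) ^ (m ^ 2) * (1 / Real.exp 1) ^ (m ^ 2) * (m * a) ^ (m ^ 2) := by
    rw [← mul_pow, ← mul_pow]; congr 1; field_simp
  rw [h1, h2, pow_succ _ (m ^ 2)]
  generalize (m / a : ℝ) ^ (m ^ 2) = A, (1 / Real.exp 1) ^ (m ^ 2) = B, (m * a : ℝ) ^ (m ^ 2) = X
  field_simp

end Weights

end

/-! ### Fundamental discriminants and primitivity of the Kronecker symbol. -/

lemma kroneckerSym_mul_left (d e : ℤ) {n : ℕ} (hn : n ≠ 0) :
    kroneckerSym (d * e) n = kroneckerSym d n * kroneckerSym e n := by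
  simp only [kroneckerSym, if_neg hn, Int.cast_mul, map_mul, mul_pow, jacobiSym.mul_left]
  ring

lemma kroneckerSym_eq_one_of_modEq {d : ℤ} (hd : d % 4 = 0 ∨ d % 4 = 1) {n : ℕ}
    (hn : n ≡ 1 [MOD d.natAbs]) : kroneckerSym d n = 1 := by
  rw [← kroneckerSym_mod d hd n, hn, kroneckerSym_mod d hd 1, kroneckerSym_one]

/-- `d` is a fundamental discriminant: `d ≡ 0, 1 mod 4`, and `d` is not of the form `p ^ 2 * d'` with `p`
prime and `d' ≡ 0, 1 mod 4`. -/
def IsFundamental (d : ℤ) : Prop :=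
  (d % 4 = 0 ∨ d % 4 = 1) ∧
    ∀ p : ℕ, p.Prime → ∀ d' : ℤ, d = p ^ 2 * d' → ¬ (d' % 4 = 0 ∨ d' % 4 = 1)

lemma exists_nonresidue {p : ℕ} (hp : p.Prime) (hp2 : p ≠ 2) : ∃ r : ℕ, J((r : ℤ) | p) = -1 := by
  have := Fact.mk hp
  obtain ⟨a, ha⟩ := quadraticChar_exists_neg_one (F := ZMod p) (by rwa [ZMod.ringChar_zmod_n])
  refine ⟨a.val, ?_⟩
  rw [← jacobiSym.legendreSym.to_jacobiSym, legendreSym]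
  simpa using ha

lemma kroneckerSym_congr {d : ℤ} (hd : d % 4 = 0 ∨ d % 4 = 1) {n m : ℕ}
    (h : n ≡ m [MOD d.natAbs]) : kroneckerSym d n = kroneckerSym d m := by
  rw [← kroneckerSym_mod d hd n, h, kroneckerSym_mod d hd m]

/-- Chinese remainders: n is k modulo e and 1 modulo m. It serves for e = -4, 8, -8, with c half of
|e|. -/
lemma exists_kroneckerSym_eq_neg_one_two {e m : ℤ} {k : ℕ} (he : e % 4 = 0 ∨ e % 4 = 1)
    (hm : m % 4 = 1) (hek : kroneckerSym e k = -1) (hcop : e.natAbs.Coprime m.natAbs)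
    {c : ℕ} (hc : c ∣ e.natAbs) (hkc : k ≡ 1 [MOD c]) :
    ∃ n : ℕ, n ≡ 1 [MOD c * m.natAbs] ∧ kroneckerSym (e * m) n = -1 := by
  obtain ⟨n, hn1, hn2⟩ := Nat.chineseRemainder hcop k 1
  have h1 : kroneckerSym e n = -1 := (kroneckerSym_congr he hn1).trans hek
  have h2 : kroneckerSym m n = 1 := kroneckerSym_eq_one_of_modEq (Or.inr hm) hn2
  refine ⟨n, ?_, ?_⟩
  · rw [← Nat.modEq_and_modEq_iff_modEq_mul (Nat.Coprime.coprime_dvd_left hc hcop)]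
    exact ⟨(hn1.of_dvd hc).trans hkc, hn2⟩
  · have hn0 : n ≠ 0 := by
      rintro rfl
      rcases (em (e.natAbs = 1)) with h3 | h3
      · simp [kroneckerSym, h3] at h1
      · simp [kroneckerSym, h3] at h1
    rw [kroneckerSym_mul_left _ _ hn0, h1, h2, mul_one]

/-- The obstruction to the character having a modulus dividing |d|/p: it is not trivial on the
residues ≡ 1 there. A prime discriminant divisible by p is split off from d, and only that factor is
made equal to -1. -/
lemma IsFundamental.exists_kroneckerSym_eq_neg_one {d : ℤ} (hd : IsFundamental d) (hd0 : d ≠ 0)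
    {p : ℕ} (hp : p.Prime) (hpd : p ∣ d.natAbs) :
    ∃ n : ℕ, n ≡ 1 [MOD d.natAbs / p] ∧ kroneckerSym d n = -1 := by
  obtain ⟨h4, hf⟩ := hd
  rcases eq_or_ne p 2 with rfl | hp2
  · have hd4 : d % 4 = 0 := by omega
    obtain ⟨d', rfl⟩ : (4 : ℤ) ∣ d := Int.dvd_of_emod_eq_zero hd4
    have h5 := hf 2 hp d' (by norm_num)
    -- The three cases split off -4, 8 and -8. The witnesses 3, 5, 5 are ≡ 1 modulo half of these
    -- and have symbol -1.
    rcases (by omega : d' % 4 = 3 ∨ d' % 8 = 2 ∨ d' % 8 = 6) with h | h | h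
    · have h1 := exists_kroneckerSym_eq_neg_one_two (e := -4) (m := -d') (k := 3) (c := 2)
        (by norm_num) (by omega)
        (by rw [kroneckerSym_of_zero_mod_four _ (by norm_num), if_pos (by decide)]; norm_num)
        (by
          rw [show (-4 : ℤ).natAbs = 2 ^ 2 by norm_num]
          exact Nat.Coprime.pow_left 2 ((Nat.Prime.coprime_iff_not_dvd hp).2 (by omega)))
        (by norm_num) (by decide)
      obtain ⟨n, hn, hk⟩ := h1
      refine ⟨n, ?_, ?_⟩
      · convert hn using 1; omega
      · rw [← hk]; congr 1; ring
    · obtain ⟨m, hm⟩ : ∃ m, d' = 2 * m := ⟨d' / 2, by omega⟩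
      have h1 := exists_kroneckerSym_eq_neg_one_two (e := 8) (m := m) (k := 5) (c := 4)
        (by norm_num) (by omega)
        (by rw [kroneckerSym_of_zero_mod_four _ (by norm_num), if_pos (by decide)]; norm_num)
        (by
          rw [show (8 : ℤ).natAbs = 2 ^ 3 by norm_num]
          exact Nat.Coprime.pow_left 3 ((Nat.Prime.coprime_iff_not_dvd hp).2 (by omega)))
        (by norm_num) (by decide)
      obtain ⟨n, hn, hk⟩ := h1
      refine ⟨n, ?_, ?_⟩
      · convert hn using 1; omega
      · rw [← hk]; congr 1; rw [hm]; ring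
    · obtain ⟨m, hm⟩ : ∃ m, d' = -2 * m := ⟨-(d' / 2), by omega⟩
      have h1 := exists_kroneckerSym_eq_neg_one_two (e := -8) (m := m) (k := 5) (c := 4)
        (by norm_num) (by omega)
        (by rw [kroneckerSym_of_zero_mod_four _ (by norm_num), if_pos (by decide)]; norm_num)
        (by
          rw [show (-8 : ℤ).natAbs = 2 ^ 3 by norm_num]
          exact Nat.Coprime.pow_left 3 ((Nat.Prime.coprime_iff_not_dvd hp).2 (by omega)))
        (by norm_num) (by decide)
      obtain ⟨n, hn, hk⟩ := h1
      refine ⟨n, ?_, ?_⟩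
      · convert hn using 1; omega
      · rw [← hk]; congr 1; rw [hm]; ring
  · have hodd : p % 2 = 1 := hp.eq_two_or_odd.resolve_left hp2
    -- The prime discriminant p* = ±p ≡ 1 mod 4. Fundamentality makes the cofactor prime to p.
    obtain ⟨ε, hε, hps⟩ : ∃ ε : ℤ, (ε = 1 ∨ ε = -1) ∧ (ε * p) % 4 = 1 := by
      rcases (by omega : p % 4 = 1 ∨ p % 4 = 3) with h | h
      · exact ⟨1, Or.inl rfl, by omega⟩
      · exact ⟨-1, Or.inr rfl, by omega⟩
    have hε2 : ε * ε = 1 := by rcases hε with rfl | rfl <;> norm_num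
    obtain ⟨d1', hd1'⟩ := Int.natCast_dvd.2 hpd
    obtain ⟨d1, hd1⟩ : ∃ d1, d = ε * p * d1 := ⟨ε * d1', by
      rw [hd1']; linear_combination (-(p : ℤ) * d1') * hε2⟩
    have hmod : d1 % 4 = d % 4 := by
      rw [hd1, Int.mul_emod, hps]; omega
    have hpd1 : ¬ p ∣ d1.natAbs := by
      intro h
      obtain ⟨d2, hd2⟩ := Int.natCast_dvd.2 h
      refine hf p hp (ε * d2) (by rw [hd1, hd2]; ring) ?_
      have : (ε * d2) % 4 = d1 % 4 := by
        have e1 : d1 = ε * p * (ε * d2) := by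
          rw [hd2]; linear_combination (-(p : ℤ) * d2) * hε2
        rw [e1, Int.mul_emod (ε * p), hps]; omega
      rw [this, hmod]; exact h4
    obtain ⟨r, hr⟩ := exists_nonresidue hp hp2
    have habs : (ε * p : ℤ).natAbs = p := by
      rcases hε with rfl | rfl <;> simp
    obtain ⟨n, hn1, hn2⟩ := Nat.chineseRemainder ((Nat.Prime.coprime_iff_not_dvd hp).2 hpd1) r 1
    have hJ : kroneckerSym (ε * p) n = -1 := by
      rw [kroneckerSym_of_one_mod_four _ hps, habs, ← hr]
      rw [jacobiSym.mod_left, jacobiSym.mod_left (r : ℤ)]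
      congr 1
      exact_mod_cast hn1
    have hn0 : n ≠ 0 := by
      rintro rfl
      rw [kroneckerSym, if_pos rfl, habs, if_neg hp.one_lt.ne'] at hJ
      norm_num at hJ
    refine ⟨n, ?_, ?_⟩
    · have : d.natAbs / p = d1.natAbs := by
        rw [hd1, Int.natAbs_mul, habs, Nat.mul_div_cancel_left _ hp.pos]
      rw [this]; exact hn2
    · rw [hd1, kroneckerSym_mul_left _ _ hn0, hJ,
        kroneckerSym_eq_one_of_modEq (by rw [hmod]; exact h4) hn2, mul_one]

lemma kroneckerChar_intCast (d : ℤ) [NeZero d.natAbs] (hd : d % 4 = 0 ∨ d % 4 = 1) (n : ℕ) :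
    kroneckerChar d hd ((n : ℤ) : ZMod d.natAbs) = (kroneckerSym d n : ℂ) := by
  rw [Int.cast_natCast, kroneckerChar_natCast]

/-- The Kronecker symbol of a fundamental discriminant is a primitive character. -/
lemma IsFundamental.isPrimitive {d : ℤ} (hd : IsFundamental d) [NeZero d.natAbs]
    (h4 : d % 4 = 0 ∨ d % 4 = 1) : (kroneckerChar d h4).IsPrimitive := by
  rw [DirichletCharacter.isPrimitive_def]
  by_contra hne
  set χ := kroneckerChar d h4
  have hN : d.natAbs ≠ 0 := NeZero.ne _
  obtain ⟨c, hc⟩ := χ.conductor_dvd_level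
  have hc1 : c ≠ 1 := by rintro rfl; exact hne (hc.trans (mul_one _)).symm
  -- A conductor strictly smaller than |d| divides |d|/p for some prime p, and the character would
  -- then be 1 at every unit n ≡ 1 mod |d|/p.
  obtain ⟨p, hp, hpc⟩ := Nat.exists_prime_and_dvd hc1
  have hpd : p ∣ d.natAbs := hc ▸ Dvd.dvd.mul_left hpc _
  have hcd : χ.conductor ∣ d.natAbs / p := by
    obtain ⟨c', rfl⟩ := hpc
    refine ⟨c', ?_⟩
    rw [Nat.div_eq_iff_eq_mul_left hp.pos hpd]
    exact hc.trans (by ring)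
  obtain ⟨n, hn, hk⟩ := hd.exists_kroneckerSym_eq_neg_one (by simpa using hN) hp hpd
  have hft := χ.factorsThrough_conductor
  have hval : χ ((n : ℤ) : ZMod d.natAbs) = -1 := by
    rw [kroneckerChar_intCast, hk]; norm_num
  have hcop : IsCoprime (n : ℤ) d.natAbs :=
    (χ.apply_ne_zero_iff n).1 (by rw [hval]; norm_num)
  rw [hft.eq_changeLevel, DirichletCharacter.changeLevel_eq_cast_of_dvd' _ _ hcop,
    Int.cast_natCast, (ZMod.natCast_eq_natCast_iff n 1 _).2 (hn.of_dvd hcd)] at hval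
  norm_num at hval

/-! ### Quadratic fields: the discriminant is fundamental, and symbol -1 means inert. -/

section QuadraticField

open NumberField Module

variable {F : Type*} [Field F] [NumberField F]

lemma exists_basis_embeddings (hF : finrank ℚ F = 2) :
    ∃ (B : Basis (Fin 2) ℤ (𝓞 F)) (σ τ : F →ₐ[ℚ] ℂ),
      (∀ z : 𝓞 F, ((Algebra.norm ℤ z : ℤ) : ℂ) = σ z * τ z) ∧
      (∀ z : 𝓞 F, ((Algebra.trace ℤ (𝓞 F) z : ℤ) : ℂ) = σ z + τ z) ∧
      ((discr F : ℤ) : ℂ) = (σ (B 0) * τ (B 1) - τ (B 0) * σ (B 1)) ^ 2 := by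
  classical
  let b := integralBasis F
  have hcE : Fintype.card (F →ₐ[ℚ] ℂ) = 2 := by rw [AlgHom.card, hF]
  have hcI : Fintype.card (Free.ChooseBasisIndex ℤ (𝓞 F)) = 2 := by
    rw [← hF, finrank_eq_card_basis b]
  let e := Fintype.equivFinOfCardEq hcE
  let f := Fintype.equivFinOfCardEq hcI
  have hsum : ∀ g : (F →ₐ[ℚ] ℂ) → ℂ, ∑ φ, g φ = g (e.symm 0) + g (e.symm 1) := fun g => by
    rw [← e.symm.sum_comp, Fin.sum_univ_two]
  have hprod : ∀ g : (F →ₐ[ℚ] ℂ) → ℂ, ∏ φ, g φ = g (e.symm 0) * g (e.symm 1) := fun g => by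
    rw [← e.symm.prod_comp, Fin.prod_univ_two]
  refine ⟨(RingOfIntegers.basis F).reindex f, e.symm 0, e.symm 1, fun z => ?_, fun z => ?_, ?_⟩
  · rw [← hprod (fun φ => φ (z : F)), ← Algebra.norm_eq_prod_embeddings ℚ ℂ (z : F),
      ← Algebra.coe_norm_int]
    simp
  · rw [← hsum (fun φ => φ (z : F)), ← trace_eq_sum_embeddings ℂ (K := ℚ) (x := (z : F)),
      ← Algebra.coe_trace_int]
    simp
  · have h1 : ((discr F : ℤ) : ℂ) = algebraMap ℚ ℂ (Algebra.discr ℚ b) := by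
      rw [← coe_discr]; simp
    have h2 : Algebra.discr ℚ b = Algebra.discr ℚ (b ∘ f.symm) :=
      (Algebra.discr_reindex ℚ b f).symm
    rw [h1, h2, Algebra.discr_eq_det_embeddingsMatrixReindex_pow_two ℚ ℂ _ e.symm,
      Matrix.det_fin_two]
    simp only [Algebra.embeddingsMatrixReindex, Matrix.reindex_apply, Matrix.submatrix_apply,
      Algebra.embeddingsMatrix_apply, Function.comp_apply, Equiv.refl_symm, Equiv.refl_apply,
      Equiv.symm_symm, b, integralBasis_apply, Basis.reindex_apply]

/-- The norm form of a quadratic field is a binary quadratic form of discriminant `discr F`. -/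
lemma exists_normForm (hF : finrank ℚ F = 2) :
    ∃ (B : Basis (Fin 2) ℤ (𝓞 F)) (u t v : ℤ), discr F = t ^ 2 - 4 * (u * v) ∧
      ∀ z : 𝓞 F, Algebra.norm ℤ z =
        u * B.repr z 0 ^ 2 + t * (B.repr z 0 * B.repr z 1) + v * B.repr z 1 ^ 2 := by
  obtain ⟨B, σ, τ, hn, ht, hd⟩ := exists_basis_embeddings hF
  refine ⟨B, Algebra.norm ℤ (B 0), Algebra.trace ℤ _ (B 0) * Algebra.trace ℤ _ (B 1) -
      Algebra.trace ℤ _ (B 0 * B 1), Algebra.norm ℤ (B 1), ?_, fun z => ?_⟩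
  · have : ((discr F : ℤ) : ℂ) = (((Algebra.trace ℤ _ (B 0) * Algebra.trace ℤ _ (B 1) -
        Algebra.trace ℤ _ (B 0 * B 1)) ^ 2 -
        4 * (Algebra.norm ℤ (B 0) * Algebra.norm ℤ (B 1)) : ℤ) : ℂ) := by
      push_cast
      rw [hd, ht, ht, ht, hn, hn]
      simp only [map_mul]
      ring
    exact_mod_cast this
  · have hz : z = B.repr z 0 • B 0 + B.repr z 1 • B 1 := by
      conv_lhs => rw [← B.sum_repr z, Fin.sum_univ_two]
    have key : ∀ φ : F →ₐ[ℚ] ℂ, φ z = B.repr z 0 * φ (B 0) + B.repr z 1 * φ (B 1) := fun φ => by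
      conv_lhs => rw [hz]
      simp
    have : ((Algebra.norm ℤ z : ℤ) : ℂ) = ((Algebra.norm ℤ (B 0) * B.repr z 0 ^ 2 +
        (Algebra.trace ℤ _ (B 0) * Algebra.trace ℤ _ (B 1) - Algebra.trace ℤ _ (B 0 * B 1)) *
        (B.repr z 0 * B.repr z 1) + Algebra.norm ℤ (B 1) * B.repr z 1 ^ 2 : ℤ) : ℂ) := by
      push_cast
      rw [hn, ht, ht, ht, hn, hn, key σ, key τ]
      simp only [map_mul]
      ring
    exact_mod_cast this

/-- The discriminant of a quadratic field is fundamental. -/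
lemma isFundamental_discr (hF : finrank ℚ F = 2) : IsFundamental (discr F) := by
  refine ⟨discr_mod_four_of_quadratic F hF, fun p hp d' hd hd' => ?_⟩
  obtain ⟨B, σ, τ, hn, ht, hdisc⟩ := exists_basis_embeddings hF
  have hp0 : (p : ℂ) ≠ 0 := by exact_mod_cast hp.ne_zero
  have hpF : (p : F) ≠ 0 := by exact_mod_cast hp.ne_zero
  -- This s is a square root of the discriminant: its conjugates are plus and minus the determinant
  -- of the embedding matrix.
  set s : F := (B 0 : F) * (Algebra.trace ℤ _ (B 1) : ℤ) - (B 1 : F) * (Algebra.trace ℤ _ (B 0) : ℤ)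
    with hs
  have hσ : σ s = σ (B 0) * τ (B 1) - τ (B 0) * σ (B 1) := by
    rw [hs]; simp only [map_sub, map_mul, map_intCast, ht]; ring
  have hτ : τ s = -σ s := by
    rw [hσ, hs]; simp only [map_sub, map_mul, map_intCast, ht]; ring
  have hs2 : s ^ 2 = (p : F) ^ 2 * (d' : F) := by
    have h : σ (s ^ 2) = σ ((p : F) ^ 2 * (d' : F)) := by
      rw [map_pow, hσ, ← hdisc, hd]; simp
    exact σ.injective h
  obtain ⟨c, hc⟩ : ∃ c : ℤ, d' ^ 2 - d' = 4 * c := by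
    rcases hd' with h | h
    · obtain ⟨e, rfl⟩ : (4 : ℤ) ∣ d' := Int.dvd_of_emod_eq_zero h
      exact ⟨4 * e ^ 2 - e, by ring⟩
    · obtain ⟨e, rfl⟩ : ∃ e, d' = 4 * e + 1 := ⟨d' / 4, by omega⟩
      exact ⟨4 * e ^ 2 + e, by ring⟩
  have hcF : (d' : F) ^ 2 - d' = 4 * c := by exact_mod_cast congrArg (Int.cast : ℤ → F) hc
  -- If the discriminant is p²d' with d' ≡ 0, 1 mod 4, then z is a root of X² - d'X + c, hence
  -- integral.
  set z : F := ((d' : F) + s / p) / 2 with hz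
  have hzi : IsIntegral ℤ z := by
    refine ⟨Polynomial.X ^ 2 - Polynomial.C d' * Polynomial.X + Polynomial.C c, by monicity!, ?_⟩
    have h3 : (s / p) ^ 2 = d' := by
      rw [div_pow, hs2]; field_simp
    have h4 : 2 * z = d' + s / p := by rw [hz]; ring
    have h5 : s / p = 2 * z - d' := by rw [h4]; ring
    rw [h5] at h3
    simp only [Polynomial.eval₂_add, Polynomial.eval₂_sub, Polynomial.eval₂_mul,
      Polynomial.eval₂_pow, Polynomial.eval₂_X, Polynomial.eval₂_C, algebraMap_int_eq,
      Int.coe_castRingHom]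
    have : (4 : F) * (z ^ 2 - d' * z + c) = 0 := by linear_combination h3 - hcF
    exact (mul_eq_zero.1 this).resolve_left (by norm_num)
  set w : 𝓞 F := ⟨z, hzi⟩
  have key : ∀ (v : 𝓞 F) (φ : F →ₐ[ℚ] ℂ), φ v = B.repr v 0 * φ (B 0) + B.repr v 1 * φ (B 1) := by
    intro v φ
    have hv : v = B.repr v 0 • B 0 + B.repr v 1 • B 1 := by
      conv_lhs => rw [← B.sum_repr v, Fin.sum_univ_two]
    conv_lhs => rw [hv]
    simp
  have h1 : ∀ φ : F →ₐ[ℚ] ℂ, (1 : ℂ) = B.repr 1 0 * φ (B 0) + B.repr 1 1 * φ (B 1) := fun φ => by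
    rw [← key]; simp
  have hw : ∀ φ : F →ₐ[ℚ] ℂ, φ w = (d' + φ s / p) / 2 := fun φ => by
    change φ z = _
    rw [hz, map_div₀, map_ofNat]; simp
  have hsub : σ s / p = σ w - τ w := by rw [hw, hw, hτ]; ring
  -- By Cramer's rule the difference of the conjugates of an integer is an integral multiple of the
  -- root of the discriminant. For w this difference is that root divided by p, so p would divide 1.
  have hidx : σ w - τ w = -((B.repr 1 0 * B.repr w 1 - B.repr 1 1 * B.repr w 0 : ℤ) : ℂ) * σ s := by
    have e1 : σ w - τ w = σ w * 1 - 1 * τ w := by ring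
    rw [e1, hσ]
    nth_rewrite 1 [h1 τ]
    rw [h1 σ, key w σ, key w τ]
    push_cast
    ring
  have hs0 : σ s ≠ 0 := by
    intro h
    rw [← hσ, h, zero_pow two_ne_zero] at hdisc
    exact discr_ne_zero F (by exact_mod_cast hdisc)
  generalize (B.repr 1 0 * B.repr w 1 - B.repr 1 1 * B.repr w 0 : ℤ) = n at hidx
  have h6 : (1 : ℂ) = -(n * p) := by
    rw [← hsub, div_eq_iff hp0] at hidx
    apply mul_right_cancel₀ hs0
    linear_combination hidx
  have h7 : (1 : ℤ) = -(n * p) := by exact_mod_cast h6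
  have h8 : (p : ℤ) ∣ 1 := ⟨-n, by rw [h7]; ring⟩
  have h9 : p ∣ 1 := by exact_mod_cast h8
  exact hp.one_lt.ne' (Nat.dvd_one.1 h9)

/-- A binary form whose discriminant D is a nonsquare mod p is anisotropic mod p, since 4u times the
form is (2ua + tb)² - D b². For p = 2 the discriminant is 5 mod 8, which forces all three
coefficients to be odd. -/
lemma dvd_of_prime_dvd_form {p : ℕ} (hp : p.Prime) {u t v a b : ℤ}
    (hk : kroneckerSym (t ^ 2 - 4 * (u * v)) p = -1)
    (h : (p : ℤ) ∣ u * a ^ 2 + t * (a * b) + v * b ^ 2) : (p : ℤ) ∣ a ∧ (p : ℤ) ∣ b := by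
  have hpi : Prime (p : ℤ) := Nat.prime_iff_prime_int.1 hp
  rcases eq_or_ne p 2 with rfl | hp2
  · have h8 : ZMod.χ₈ ((t ^ 2 - 4 * (u * v) : ℤ) : ZMod 8) = -1 := by
      simpa [kroneckerSym] using hk
    rw [ZMod.χ₈_int_eq_if_mod_eight] at h8
    have h35 : (t ^ 2 - 4 * (u * v)) % 8 = 3 ∨ (t ^ 2 - 4 * (u * v)) % 8 = 5 := by
      split_ifs at h8 <;> omega
    have hodd : t % 2 = 1 ∧ u % 2 = 1 ∧ v % 2 = 1 := by
      rcases Int.even_or_odd' t with ⟨t, rfl | rfl⟩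
      · exfalso; ring_nf at h35; omega
      · obtain ⟨j, hj⟩ : ∃ j, t ^ 2 + t = 2 * j := by
          obtain ⟨j, hj⟩ := (Int.even_mul_succ_self t).two_dvd
          exact ⟨j, by rw [← hj]; ring⟩
        have h9 : (2 * t + 1) ^ 2 - 4 * (u * v) = 8 * j + 1 - 4 * (u * v) := by
          linear_combination 4 * hj
        rw [h9] at h35
        have huv : u * v % 2 = 1 := by omega
        have := Int.odd_mul.1 (Int.odd_iff.2 huv)
        exact ⟨by omega, Int.odd_iff.1 this.1, Int.odd_iff.1 this.2⟩
    have h2 : (u * a ^ 2 + t * (a * b) + v * b ^ 2) % 2 = 0 := Int.emod_eq_zero_of_dvd h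
    obtain ⟨h3, h4, h5⟩ := hodd
    obtain ⟨t, rfl⟩ : ∃ k, t = 2 * k + 1 := ⟨t / 2, by omega⟩
    obtain ⟨u, rfl⟩ : ∃ k, u = 2 * k + 1 := ⟨u / 2, by omega⟩
    obtain ⟨v, rfl⟩ : ∃ k, v = 2 * k + 1 := ⟨v / 2, by omega⟩
    rcases Int.even_or_odd' a with ⟨a, rfl | rfl⟩ <;>
      rcases Int.even_or_odd' b with ⟨b, rfl | rfl⟩
    · exact ⟨⟨a, rfl⟩, ⟨b, rfl⟩⟩
    all_goals
      ring_nf at h2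
      omega
  · have := Fact.mk hp
    have hns : ¬ IsSquare ((t ^ 2 - 4 * (u * v) : ℤ) : ZMod p) := by
      rw [← legendreSym.eq_neg_one_iff, jacobiSym.legendreSym.to_jacobiSym, ← hk, kroneckerSym,
        if_neg hp.ne_zero, padicValNat.eq_zero_of_not_dvd
        (fun h => hp2 ((Nat.prime_dvd_prime_iff_eq Nat.prime_two hp).1 h).symm)]
      simp
    simp only [← ZMod.intCast_zmod_eq_zero_iff_dvd] at h ⊢
    push_cast at h hns ⊢
    have hb : (b : ZMod p) = 0 := by
      by_contra hb
      refine hns ⟨(2 * u * a + t * b) / b, ?_⟩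
      field_simp
      linear_combination (-4) * u * h
    have hu : (u : ZMod p) ≠ 0 := fun hu => hns ⟨t, by rw [hu]; ring⟩
    refine ⟨?_, hb⟩
    rw [hb] at h
    have : (u : ZMod p) * a ^ 2 = 0 := by linear_combination h
    simpa [hu] using this

/-- A prime `p` with `(d_F / p) = -1` is inert in `F`. -/
lemma isInertPrime_of_kroneckerSym (hF : finrank ℚ F = 2) {p : ℕ} (hp : p.Prime)
    (hk : kroneckerSym (discr F) p = -1) : IsInertPrime F p := by
  refine ⟨hp, ?_⟩
  obtain ⟨B, u, t, v, hd, hn⟩ := exists_normForm hF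
  rw [hd] at hk
  -- By anisotropy the ideal (p) consists of the integers whose norm p divides. Primality then
  -- follows from Euclid's lemma in ℤ and multiplicativity of the norm.
  have hmem : ∀ z : 𝓞 F, (p : ℤ) ∣ Algebra.norm ℤ z → z ∈ Ideal.span {(p : 𝓞 F)} := by
    intro z hz
    rw [hn] at hz
    obtain ⟨⟨a, ha⟩, ⟨b, hb⟩⟩ := dvd_of_prime_dvd_form hp hk hz
    refine Ideal.mem_span_singleton.2 ⟨a • B 0 + b • B 1, ?_⟩
    conv_lhs => rw [← B.sum_repr z, Fin.sum_univ_two, ha, hb]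
    simp only [zsmul_eq_mul]
    push_cast
    ring
  have hdvd : ∀ z : 𝓞 F, z ∈ Ideal.span {(p : 𝓞 F)} → (p : ℤ) ∣ Algebra.norm ℤ z := by
    intro z hz
    obtain ⟨w, rfl⟩ := Ideal.mem_span_singleton.1 hz
    rw [map_mul]
    refine Dvd.dvd.mul_right ?_ _
    have h1 := Algebra.norm_algebraMap_of_basis B (p : ℤ)
    simp only [algebraMap_int_eq, eq_intCast, Int.cast_natCast, Fintype.card_fin] at h1
    rw [h1]
    exact dvd_pow_self _ two_ne_zero
  refine Ideal.isPrime_iff.2 ⟨fun htop => ?_, fun {z w} hzw => ?_⟩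
  · have h1 := hdvd 1 (by rw [htop]; trivial)
    rw [map_one] at h1
    have h9 : p ∣ 1 := by exact_mod_cast h1
    exact hp.one_lt.ne' (Nat.dvd_one.1 h9)
  · have h1 := hdvd _ hzw
    rw [map_mul] at h1
    exact ((Nat.prime_iff_prime_int.1 hp).dvd_or_dvd h1).imp (hmem z) (hmem w)

end QuadraticField

/-! ### Values of the symbol, existence of inert primes, and bounded discriminants. -/

lemma kroneckerSym_trichotomy (d : ℤ) (n : ℕ) :
    kroneckerSym d n = 0 ∨ kroneckerSym d n = 1 ∨ kroneckerSym d n = -1 := by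
  unfold kroneckerSym
  split_ifs
  · simp
  · simp
  · have h8 : ZMod.χ₈ (d : ZMod 8) = 0 ∨ ZMod.χ₈ (d : ZMod 8) = 1 ∨ ZMod.χ₈ (d : ZMod 8) = -1 := by
      rw [ZMod.χ₈_int_eq_if_mod_eight]; split_ifs <;> simp
    generalize padicValNat 2 n = j
    rcases jacobiSym.trichotomy d (n / 2 ^ j) with h | h | h <;> rw [h]
    · simp
    all_goals
      rcases h8 with h' | h' | h' <;> rw [h']
      · rcases eq_or_ne j 0 with rfl | hj <;> simp [*]
      · simp
      · rcases neg_one_pow_eq_or ℤ j with h'' | h'' <;> rw [h''] <;> simp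

lemma kroneckerSym_pow (d : ℤ) (hd : d % 4 = 0 ∨ d % 4 = 1) (n j : ℕ) :
    kroneckerSym d (n ^ j) = kroneckerSym d n ^ j := by
  induction j with
  | zero => simp [kroneckerSym_one]
  | succ j ih => rw [pow_succ, kroneckerSym_mul d hd, ih, pow_succ]

lemma kroneckerSym_ne_zero {d : ℤ} [NeZero d.natAbs] (hd : d % 4 = 0 ∨ d % 4 = 1) {n : ℕ}
    (h : n.Coprime d.natAbs) : kroneckerSym d n ≠ 0 := by
  intro h0
  have h1 := ((ZMod.isUnit_iff_coprime n d.natAbs).2 h).map (kroneckerChar d hd)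
  rw [kroneckerChar_natCast, h0] at h1
  simp at h1

lemma IsFundamental.kroneckerChar_ne_one {d : ℤ} (hd : IsFundamental d) [NeZero d.natAbs]
    (h1 : 1 < d.natAbs) : kroneckerChar d hd.1 ≠ 1 := by
  intro h
  have h2 := hd.isPrimitive hd.1
  rw [DirichletCharacter.isPrimitive_def, h, DirichletCharacter.conductor_one] at h2
  exact h1.ne h2

/-- The character is nontrivial, so it differs from 1 on some unit class, and Dirichlet's theorem
finds a prime in that class. -/
lemma IsFundamental.exists_prime_kroneckerSym {d : ℤ} (hd : IsFundamental d)
    (h1 : 1 < d.natAbs) : ∃ p : ℕ, p.Prime ∧ kroneckerSym d p = -1 := by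
  have : NeZero d.natAbs := ⟨by omega⟩
  obtain ⟨a, ha⟩ := MulChar.ne_one_iff.1 (hd.kroneckerChar_ne_one h1)
  obtain ⟨p, -, hp, hpa⟩ := Nat.forall_exists_prime_gt_and_eq_mod a.isUnit 0
  refine ⟨p, hp, ?_⟩
  rw [← hpa, kroneckerChar_natCast] at ha
  have h0 : kroneckerSym d p ≠ 0 :=
    kroneckerSym_ne_zero hd.1 ((ZMod.isUnit_iff_coprime p d.natAbs).1 (hpa ▸ a.isUnit))
  rcases kroneckerSym_trichotomy d p with h | h | h
  · exact absurd h h0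
  · exact absurd (by rw [h, Int.cast_one]) ha
  · exact h

section
open NumberField Module

variable {F : Type*} [Field F] [NumberField F]

lemma two_lt_natAbs_discr (hF : finrank ℚ F = 2) : 2 < (discr F).natAbs := by
  have h := abs_discr_gt_two (K := F) (by rw [hF]; norm_num)
  rw [Int.abs_eq_natAbs] at h
  exact_mod_cast h

lemma quadraticFieldChar_isPrimitive (hF : finrank ℚ F = 2) :
    (quadraticFieldChar F hF).IsPrimitive :=
  (isFundamental_discr hF).isPrimitive _

lemma quadraticFieldChar_ne_one (hF : finrank ℚ F = 2) : quadraticFieldChar F hF ≠ 1 :=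
  (isFundamental_discr hF).kroneckerChar_ne_one (by have := two_lt_natAbs_discr hF; omega)

lemma quadraticFieldChar_natCast (hF : finrank ℚ F = 2) (n : ℕ) :
    quadraticFieldChar F hF n = ((kroneckerSym (discr F) n : ℝ) : ℂ) := by
  rw [quadraticFieldChar, kroneckerChar_natCast]; simp

lemma logDiscr_eq : logDiscr F = Real.log (discr F).natAbs := by
  rw [logDiscr, Nat.cast_natAbs, Int.cast_abs]

end

/-- The least inert prime is bounded in terms of the discriminant. -/
lemma exists_isInertPrime_le_of_natAbs_discr_le (N : ℕ) :
    ∃ P : ℕ, ∀ (F : Type u) [Field F] [NumberField F], Module.finrank ℚ F = 2 →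
      (NumberField.discr F).natAbs ≤ N → ∃ p : ℕ, IsInertPrime F p ∧ p ≤ P := by
  -- The chosen prime depends on the discriminant alone, so a maximum over finitely many integers
  -- bounds it for all fields at once.
  choose! f hf using fun (d : ℤ) (h : IsFundamental d ∧ 1 < d.natAbs) =>
    h.1.exists_prime_kroneckerSym h.2
  refine ⟨(Finset.Icc (-N : ℤ) N).sup f, fun F _ _ hF hN => ?_⟩
  have h2 := two_lt_natAbs_discr hF
  obtain ⟨hp, hk⟩ := hf _ ⟨isFundamental_discr hF, by omega⟩
  exact ⟨_, isInertPrime_of_kroneckerSym hF hp hk,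
    Finset.le_sup (f := f) (Finset.mem_Icc.2 (by omega))⟩

/-! ### A zero with real part at least 2/5 near the real axis, for large modulus. -/

section

open Complex Metric Set Filter Topology
open scoped Nat

section CentralValue

open DirichletCharacter

variable {q : ℕ} [NeZero q] {χ : DirichletCharacter ℂ q}

/-- The functional equation, differentiated at the central point. -/
lemma logDeriv_completedLFunction_one_half (hχ : χ.IsPrimitive) (hreal : χ⁻¹ = χ) (h1 : χ ≠ 1)
    (h0 : χ.completedLFunction (1 / 2) ≠ 0) :
    logDeriv χ.completedLFunction (1 / 2) = -(Real.log q / 2 : ℝ) := by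
  have hq : (q : ℂ) ≠ 0 := NeZero.ne _
  have hfe : ∀ s, χ.completedLFunction (1 - s) =
      q ^ (s - 1 / 2) * χ.rootNumber * χ.completedLFunction s := fun s => by
    rw [hχ.completedLFunction_one_sub, hreal]
  -- At the fixed point s = 1/2 a nonzero value forces the root number to be 1.
  have hw : χ.rootNumber = 1 := by
    have h := hfe (1 / 2)
    rw [sub_self, cpow_zero, one_mul, show (1 : ℂ) - 1 / 2 = 1 / 2 by norm_num] at h
    exact mul_right_cancel₀ h0 (by rw [← h, one_mul])
  have hd := (differentiable_completedLFunction h1 (1 / 2)).hasDerivAt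
  have hl : HasDerivAt (fun s => χ.completedLFunction (1 - s))
      (-deriv χ.completedLFunction (1 / 2)) (1 / 2) := by
    have h2 : HasDerivAt χ.completedLFunction (deriv χ.completedLFunction (1 / 2))
        (1 - (1 / 2 : ℂ)) := by
      rw [show (1 : ℂ) - 1 / 2 = 1 / 2 by norm_num]; exact hd
    simpa using h2.comp_const_sub 1 (1 / 2)
  have hr : HasDerivAt (fun s => χ.completedLFunction (1 - s))
      (log q * χ.completedLFunction (1 / 2) + deriv χ.completedLFunction (1 / 2)) (1 / 2) := by
    have h2 : (fun s => χ.completedLFunction (1 - s)) =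
        fun s => (q : ℂ) ^ (s - 1 / 2) * χ.completedLFunction s := by
      ext s; rw [hfe, hw, mul_one]
    rw [h2]
    have h3 := (((hasDerivAt_id (1 / 2 : ℂ)).sub_const (1 / 2)).const_cpow (c := (q : ℂ))
      (Or.inl hq)).mul hd
    have h5 : HasDerivAt (fun s => (q : ℂ) ^ (s - 1 / 2) * χ.completedLFunction s) _ _ := h3
    refine h5.congr_deriv ?_
    simp
  have h4 := hl.unique hr
  rw [logDeriv_apply, div_eq_iff h0]
  rw [← Complex.natCast_log] at h4
  rw [Complex.ofReal_div, Complex.ofReal_ofNat]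
  linear_combination (-1 / 2 : ℂ) * h4

/-- Only two gamma factors occur, one for each parity. Their logarithmic derivatives at 1/2 are
absolute constants, so the (log q)/2 of the functional equation survives. -/
lemma exists_le_norm_logDeriv_LFunction_one_half : ∃ C : ℝ, ∀ (q : ℕ) [NeZero q]
    (χ : DirichletCharacter ℂ q), χ.IsPrimitive → χ⁻¹ = χ → χ ≠ 1 → χ.LFunction (1 / 2) ≠ 0 →
      Real.log q / 2 - C ≤ ‖logDeriv χ.LFunction (1 / 2)‖ := by
  refine ⟨max ‖logDeriv (fun s => (Gammaℝ s)⁻¹) (1 / 2)‖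
    ‖logDeriv (fun s => (Gammaℝ (s + 1))⁻¹) (1 / 2)‖, fun q _ χ hχ hreal h1 h0 => ?_⟩
  have main : ∀ G : ℂ → ℂ, DifferentiableAt ℂ G (1 / 2) →
      (∀ s ≠ 0, χ.LFunction s = χ.completedLFunction s * G s) →
      Real.log q / 2 - ‖logDeriv G (1 / 2)‖ ≤ ‖logDeriv χ.LFunction (1 / 2)‖ := by
    intro G hG hL
    have h2 : χ.LFunction (1 / 2) = _ := hL (1 / 2) (by norm_num)
    rw [h2] at h0
    have h3 : logDeriv χ.LFunction (1 / 2) =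
        logDeriv χ.completedLFunction (1 / 2) + logDeriv G (1 / 2) := by
      have h4 : χ.LFunction =ᶠ[𝓝 (1 / 2)] fun s => χ.completedLFunction s * G s := by
        filter_upwards [isOpen_ne.mem_nhds (by norm_num : (1 / 2 : ℂ) ≠ 0)] with s hs using hL s hs
      rw [logDeriv_apply, h4.deriv_eq, h4.eq_of_nhds, ← logDeriv_apply]
      exact logDeriv_mul _ (left_ne_zero_of_mul h0) (right_ne_zero_of_mul h0)
        (differentiable_completedLFunction h1 _) hG
    rw [h3, logDeriv_completedLFunction_one_half hχ hreal h1 (left_ne_zero_of_mul h0)]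
    have hlog : 0 ≤ Real.log q := Real.log_natCast_nonneg q
    have h5 : Real.log q / 2 = ‖-((Real.log q / 2 : ℝ) : ℂ)‖ := by
      rw [norm_neg, Complex.norm_real, Real.norm_of_nonneg (by positivity)]
    have := norm_sub_le (-((Real.log q / 2 : ℝ) : ℂ) + logDeriv G (1 / 2)) (logDeriv G (1 / 2))
    rw [add_sub_cancel_right, ← h5] at this
    linarith
  rcases χ.even_or_odd with h | h
  · refine le_trans (sub_le_sub_left (le_max_left _ _) _) (main _ (differentiable_Gammaℝ_inv _) ?_)
    intro s hs
    rw [LFunction_eq_completed_div_gammaFactor χ s (Or.inl hs), h.gammaFactor_def, div_eq_mul_inv]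
  · refine le_trans (sub_le_sub_left (le_max_right _ _) _) (main (fun s => (Gammaℝ (s + 1))⁻¹)
      ((differentiable_Gammaℝ_inv.comp (differentiable_id.add_const 1)) _) ?_)
    intro s hs
    rw [LFunction_eq_completed_div_gammaFactor χ s (Or.inl hs), h.gammaFactor_def, div_eq_mul_inv]

lemma inv_eq_of_real {a : ℕ → ℝ} (ha : ∀ n : ℕ, χ (n : ZMod q) = a n) : χ⁻¹ = χ := by
  ext x
  have h := ha (x : ZMod q).val
  rw [ZMod.natCast_zmod_val] at h
  rw [← MulChar.star_apply', h]
  exact Complex.conj_ofReal _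

lemma norm_iteratedDeriv_logDeriv_LFunction_le {a : ℕ → ℝ} (ha : ∀ n : ℕ, χ (n : ZMod q) = a n)
    {σ : ℝ} (hσ : 1 < σ) (k : ℕ) : ‖iteratedDeriv k (logDeriv χ.LFunction) σ‖ ≤
      ∑' n : ℕ, ArithmeticFunction.vonMangoldt n * Real.log n ^ k * (n : ℝ) ^ (-σ) := by
  rw [iteratedDeriv_logDeriv_LFunction χ ha hσ, norm_mul, norm_pow, norm_neg, norm_one, one_pow,
    one_mul, Complex.norm_real]
  refine tsum_of_norm_bounded (summable_vonMangoldt_mul_log_pow hσ k).hasSum fun n => ?_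
  have h1 : |a n| ≤ 1 := by
    have := χ.norm_le_one (n : ZMod q)
    rwa [ha, Complex.norm_real] at this
  have h2 : (0 : ℝ) ≤ ArithmeticFunction.vonMangoldt n * Real.log n ^ k * (n : ℝ) ^ (-σ) :=
    mul_nonneg (mul_nonneg ArithmeticFunction.vonMangoldt_nonneg
      (pow_nonneg (Real.log_natCast_nonneg n) k)) (by positivity)
  rw [mul_assoc, mul_assoc, ← mul_assoc (ArithmeticFunction.vonMangoldt n), norm_mul,
    Real.norm_of_nonneg h2, Real.norm_eq_abs]
  exact mul_le_of_le_one_left h2 h1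

/-- L'/L is expanded in a Taylor series at 2, in a disc of radius 1.58 that contains 1/2 and stays
in Re s ≥ 0.42. The first K coefficients are bounded absolutely by the Dirichlet series. The tail
grows with log q, but K makes its factor less than 1/4, below the 1/2 of the functional equation. -/
lemma exists_norm_logDeriv_LFunction_one_half_le : ∃ C : ℝ, ∀ (q : ℕ) [NeZero q]
    (χ : DirichletCharacter ℂ q) (a : ℕ → ℝ), (∀ n : ℕ, χ (n : ZMod q) = a n) → χ ≠ 1 →
      (∀ s : ℂ, 2 / 5 ≤ s.re → s.re ≤ 1 → |s.im| ≤ 2 → χ.LFunction s ≠ 0) →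
      ‖logDeriv χ.LFunction (1 / 2)‖ ≤ C + Real.log q / 4 := by
  -- M v(k) is the Borel–Carathéodory bound for the k-th Taylor term at distance 1.5, with radii
  -- 1.55 < 1.58.
  set v : ℕ → ℝ := fun k => 2 / (1.58 - 1.55) * ((k + 1) * (1.5 / 1.55) ^ k) with hv
  have hvs : Summable v := by
    refine Summable.mul_left _ ?_
    have h1 := summable_pow_mul_geometric_of_norm_lt_one (R := ℝ) 1 (r := 1.5 / 1.55) (by norm_num)
    have h0 := summable_geometric_of_lt_one (r := (1.5 / 1.55 : ℝ)) (by norm_num) (by norm_num)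
    refine (h1.add h0).congr fun k => ?_
    ring
  obtain ⟨K, hK⟩ := ((tendsto_sum_nat_add v).eventually (gt_mem_nhds (by norm_num : (0 : ℝ) < 1 / 4))).exists
  refine ⟨(∑ k ∈ Finset.range K, (k ! : ℝ)⁻¹ * (1.5 ^ k *
    ∑' n : ℕ, ArithmeticFunction.vonMangoldt n * Real.log n ^ k * (n : ℝ) ^ (-2 : ℝ))) +
    Real.log 18 / 4, fun q _ χ a ha h1 hz => ?_⟩
  have hq : (1 : ℝ) ≤ q := by exact_mod_cast NeZero.one_le
  have hlq : 0 ≤ Real.log q := Real.log_natCast_nonneg q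
  set M := Real.log 18 + Real.log q with hM
  have hM0 : 0 < M := add_pos_of_pos_of_nonneg (Real.log_pos (by norm_num)) hlq
  have hre : ∀ z : ℂ, ‖z - 2‖ ≤ 1.58 → 0.42 ≤ z.re ∧ |z.im| ≤ 2 ∧ ‖z‖ ≤ 3.58 := fun z hzn => by
    have h2 := (abs_le.1 ((abs_re_le_norm _).trans hzn)).1
    have h3 := (abs_im_le_norm _).trans hzn
    have h4 : ‖z‖ ≤ ‖z - 2‖ + ‖(2 : ℂ)‖ := by simpa using norm_add_le (z - 2) 2
    simp only [sub_re, re_ofNat, sub_im, im_ofNat, sub_zero, Complex.norm_ofNat] at h2 h3 h4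
    exact ⟨by linarith, by linarith, by linarith⟩
  have h0 : ∀ z : ℂ, ‖z - 2‖ ≤ 1.58 → χ.LFunction z ≠ 0 := fun z hzn => by
    obtain ⟨h2, h3, -⟩ := hre z hzn
    rcases le_or_gt z.re 1 with h4 | h4
    · exact hz z (by linarith) h4 h3
    · exact LFunction_ne_zero_of_one_le_re χ (Or.inl h1) h4.le
  have hb : ∀ z : ℂ, ‖z - 2‖ ≤ 1.58 → ‖χ.LFunction z‖ ≤ Real.exp M * ‖χ.LFunction 2‖ := by
    intro z hzn
    obtain ⟨h2, -, h3⟩ := hre z hzn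
    have h4 := one_le_norm_LFunction_mul χ (s := 2) (by norm_num)
    norm_num at h4
    rw [hM, Real.exp_add, Real.exp_log (by norm_num), Real.exp_log (by linarith)]
    calc _ ≤ q * ‖z‖ / z.re := norm_LFunction_le χ h1 (by linarith)
      _ ≤ q * 3.58 / 0.42 := by gcongr
      _ ≤ 9 * q * 1 := by rw [mul_one, div_le_iff₀ (by norm_num)]; linarith
      _ ≤ 9 * q * (‖χ.LFunction 2‖ * 2) := by gcongr
      _ = _ := by ring
  have hdiff : DifferentiableOn ℂ (logDeriv χ.LFunction) (ball 2 1.58) := fun z hzb =>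
    ((((differentiable_LFunction h1).contDiff (n := 2)).differentiable_deriv_two z).div
      (differentiable_LFunction h1 z) (h0 z (mem_ball_iff_norm.1 hzb).le)).differentiableWithinAt
  have hsum := Complex.hasSum_taylorSeries_on_ball hdiff (z := 1 / 2)
    (by rw [mem_ball_iff_norm]; norm_num)
  have hnorm : ‖(1 / 2 - 2 : ℂ)‖ = 1.5 := by norm_num
  set t : ℕ → ℂ := fun n => (n ! : ℂ)⁻¹ • (1 / 2 - 2 : ℂ) ^ n •
    iteratedDeriv n (logDeriv χ.LFunction) 2 with ht
  have htn : ∀ k, ‖t k‖ = (k ! : ℝ)⁻¹ * (1.5 ^ k * ‖iteratedDeriv k (logDeriv χ.LFunction) 2‖) :=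
    fun k => by
      rw [ht]
      simp only [norm_smul, norm_pow, hnorm, norm_inv, Complex.norm_natCast]
  have hv1 : ∀ k, ‖t k‖ ≤ M * v k := fun k => by
    rw [htn]
    have h2 := norm_iteratedDeriv_logDeriv_le (s := 1.55) (by norm_num) (by norm_num) hM0
      (differentiable_LFunction h1) h0 hb k
    calc _ ≤ (k ! : ℝ)⁻¹ * (1.5 ^ k * ((k + 1)! * (2 * M * 1.55 / (1.58 - 1.55)) / 1.55 ^ (k + 1))) := by
          gcongr
      _ = _ := by
        simp only [hv]
        rw [Nat.factorial_succ, div_pow]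
        push_cast
        field_simp
        ring
  have htail : ‖∑' k, t (k + K)‖ ≤ M * ∑' k, v (k + K) :=
    tsum_of_norm_bounded (((summable_nat_add_iff K).2 hvs).hasSum.mul_left M) fun k => hv1 _
  have hsplit := hsum.summable.sum_add_tsum_nat_add K
  rw [hsum.tsum_eq] at hsplit
  rw [← hsplit]
  have hK' : M * ∑' k, v (k + K) ≤ M * (1 / 4) := by gcongr
  have hfin : ‖∑ k ∈ Finset.range K, t k‖ ≤ ∑ k ∈ Finset.range K, (k ! : ℝ)⁻¹ * (1.5 ^ k *
    ∑' n : ℕ, ArithmeticFunction.vonMangoldt n * Real.log n ^ k * (n : ℝ) ^ (-2 : ℝ)) := by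
    refine norm_sum_le_of_le _ fun k _ => ?_
    rw [htn]
    gcongr
    have := norm_iteratedDeriv_logDeriv_LFunction_le ha (σ := 2) (by norm_num) k
    simpa using this
  refine (norm_add_le _ _).trans ?_
  linarith

/-- Real primitive characters have a zero near the central point, if the modulus is large. -/
lemma exists_LFunction_eq_zero : ∃ N : ℕ, ∀ (q : ℕ) [NeZero q] (χ : DirichletCharacter ℂ q)
    (a : ℕ → ℝ), (∀ n : ℕ, χ (n : ZMod q) = a n) → χ.IsPrimitive → χ ≠ 1 → N < q →
      ∃ s : ℂ, 2 / 5 ≤ s.re ∧ s.re ≤ 1 ∧ |s.im| ≤ 2 ∧ χ.LFunction s = 0 := by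
  obtain ⟨C, hC⟩ := exists_le_norm_logDeriv_LFunction_one_half
  obtain ⟨C', hC'⟩ := exists_norm_logDeriv_LFunction_one_half_le
  refine ⟨⌈Real.exp (4 * (C + C'))⌉₊, fun q _ χ a ha hp h1 hq => ?_⟩
  by_contra! hz
  have h2 := hC q χ hp (inv_eq_of_real ha) h1 (hz _ (by norm_num) (by norm_num) (by norm_num))
  have h3 := hC' q χ a ha h1 hz
  have h4 : Real.exp (4 * (C + C')) < q := (Nat.le_ceil _).trans_lt (by exact_mod_cast hq)
  have h5 : 4 * (C + C') < Real.log q := (Real.lt_log_iff_exp_lt (by linarith [Real.exp_pos (4 * (C + C'))])).2 h4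
  linarith

end CentralValue

end

/-! ### Sums of |1+δ-ρ|⁻² over the zeros. -/

section

open Complex Metric Set Filter Topology
open scoped Nat

section ZeroSums

open DirichletCharacter

lemma Multiset.sum_map_le_sum_mul_of_cover {ι : Type*} {Z : Multiset ℂ} (s : Finset ι) (c : ι → ℝ)
    (f : ℂ → ℝ) (P : ι → ℂ → Prop) [∀ i, DecidablePred (P i)] {N : ℝ} (hc : ∀ i ∈ s, 0 ≤ c i)
    (hf : ∀ ρ ∈ Z, ∃ i ∈ s, P i ρ ∧ f ρ ≤ c i)
    (hN : ∀ i ∈ s, ((Z.filter (P i)).card : ℝ) ≤ N) :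
    (Z.map f).sum ≤ (∑ i ∈ s, c i) * N := by
  have h1 : (Z.map f).sum ≤ ∑ i ∈ s, c i * (Z.filter (P i)).card := by
    clear hN
    induction Z using Multiset.induction with
    | empty => simp
    | cons ρ Z ih =>
      have ih := ih fun ρ' h => hf ρ' (Multiset.mem_cons_of_mem h)
      obtain ⟨i, hi, hP, hle⟩ := hf ρ (Multiset.mem_cons_self ρ Z)
      have h2 : ∀ i ∈ s, c i * ((ρ ::ₘ Z).filter (P i)).card =
          (if P i ρ then c i else 0) + c i * (Z.filter (P i)).card := fun i _ => by
        by_cases h : P i ρ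
        · rw [Multiset.filter_cons_of_pos _ h, if_pos h, Multiset.card_cons]; push_cast; ring
        · rw [Multiset.filter_cons_of_neg _ h, if_neg h, zero_add]
      rw [Finset.sum_congr rfl h2, Finset.sum_add_distrib, Multiset.map_cons, Multiset.sum_cons]
      refine add_le_add (hle.trans ?_) ih
      have h3 := Finset.single_le_sum (f := fun i => if P i ρ then c i else 0)
        (fun i hi => by split_ifs; exacts [hc i hi, le_rfl]) hi
      simpa [hP] using h3
  refine h1.trans ?_
  rw [Finset.sum_mul]
  exact Finset.sum_le_sum fun i hi => mul_le_mul_of_nonneg_left (hN i hi) (hc i hi)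

variable {q : ℕ} [NeZero q] {χ : DirichletCharacter ℂ q}

/-- Supplies the growth hypothesis of the Jensen-type bounds with M = 2 log q: one power of q comes
from the convexity-free bound for L, and the other absorbs every factor up to 20000 (log q)². -/
lemma norm_LFunction_le_exp_mul (h1 : χ ≠ 1) (hq : 20000 * Real.log q ^ 2 ≤ q) {c z : ℂ}
    (hc : 1 < c.re) {b B : ℝ} (hb : 0 < b) (hbz : b ≤ z.re) (hB : ‖z‖ ≤ B)
    (h : B / b * (c.re / (c.re - 1)) ≤ 20000 * Real.log q ^ 2) :
    ‖χ.LFunction z‖ ≤ Real.exp (2 * Real.log q) * ‖χ.LFunction c‖ := by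
  have hq0 : (0 : ℝ) < q := by exact_mod_cast NeZero.pos q
  have hB0 : 0 ≤ B := (norm_nonneg z).trans hB
  have h2 := one_le_norm_LFunction_mul χ hc
  have hlc : 0 ≤ ‖χ.LFunction c‖ := norm_nonneg _
  calc _ ≤ q * ‖z‖ / z.re := norm_LFunction_le χ h1 (hb.trans_le hbz)
    _ ≤ q * B / b := by gcongr
    _ = q * (B / b) * 1 := by ring
    _ ≤ q * (B / b) * (‖χ.LFunction c‖ * (c.re / (c.re - 1))) := by gcongr
    _ = q * (B / b * (c.re / (c.re - 1))) * ‖χ.LFunction c‖ := by ring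
    _ ≤ q * q * ‖χ.LFunction c‖ := by gcongr; exact h.trans hq
    _ = _ := by
      rw [two_mul, Real.exp_add, Real.exp_log hq0]

lemma LFunction_ne_zero_of_one_lt_re {s : ℂ} (h1 : χ ≠ 1) (hs : 1 < s.re) : χ.LFunction s ≠ 0 :=
  LFunction_ne_zero_of_one_le_re χ (Or.inl h1) hs.le

/-- Jensen with radii 2.975 < 2.99 about 3 + iy. The larger disc stays in Re s ≥ 0.01, and 400 is
2/0.005 with 0.005 ≤ log(2.99/2.975). -/
lemma card_zeros_disc_le (h1 : χ ≠ 1) (hl : 1 ≤ Real.log q) (hq : 20000 * Real.log q ^ 2 ≤ q)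
    {Z : Multiset ℂ} {g : ℂ → ℂ} (h : DividesBy χ.LFunction Z g) {y : ℝ}
    (hy : |y| ≤ Real.log q ^ 2 + 2) (hZ : ∀ ρ ∈ Z, ‖ρ - (3 + y * I)‖ ≤ 2.975) :
    (Z.card : ℝ) ≤ 400 * Real.log q := by
  have hc : (3 + y * I : ℂ).re = 3 := by simp
  have h2 := h.card_mul_log_le (R := 2.99) (M := 2 * Real.log q) (by norm_num) (by norm_num)
    (LFunction_ne_zero_of_one_lt_re h1 (by rw [hc]; norm_num)) ?_ hZ
  · have h3 : (0.005 : ℝ) ≤ Real.log (2.99 / 2.975) := by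
      have := Real.one_sub_inv_le_log_of_pos (x := (2.99 / 2.975 : ℝ)) (by norm_num)
      norm_num at this ⊢
      linarith
    have h4 : (Z.card : ℝ) * 0.005 ≤ Z.card * Real.log (2.99 / 2.975) := by gcongr
    linarith
  · intro z hz
    have h3 := (abs_le.1 ((abs_re_le_norm _).trans hz)).1
    rw [sub_re, hc] at h3
    refine norm_LFunction_le_exp_mul h1 hq (B := Real.log q ^ 2 + 8) (b := 0.01)
      (by rw [hc]; norm_num) (by norm_num) (by linarith) ?_ ?_
    · have h4 : ‖z‖ ≤ ‖z - (3 + y * I)‖ + ‖(3 + y * I : ℂ)‖ := by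
        simpa using norm_add_le (z - (3 + y * I)) (3 + y * I)
      have h5 : ‖(3 + y * I : ℂ)‖ ≤ 3 + |y| := by
        refine (norm_add_le _ _).trans ?_
        simp
      linarith
    · rw [hc]
      norm_num
      nlinarith

lemma exists_sum_inv_sq_far_zeros_le : ∃ C : ℝ, 0 < C ∧ ∀ (q : ℕ) [NeZero q]
    (χ : DirichletCharacter ℂ q), χ ≠ 1 → 1 ≤ Real.log q → 20000 * Real.log q ^ 2 ≤ q →
    ∀ (Z : Multiset ℂ) (g : ℂ → ℂ) (x : ℝ), DividesBy χ.LFunction Z g →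
      (∀ ρ ∈ Z, 0.07 ≤ ρ.re ∧ ρ.re ≤ 1 ∧ |ρ.im| ≤ Real.log q ^ 2 ∧ 1 / 2 ≤ ‖(x : ℂ) - ρ‖) →
      (Z.map fun ρ => (‖(x : ℂ) - ρ‖ ^ 2)⁻¹).sum ≤ C * Real.log q := by
  have hs : Summable fun j : ℤ => (14 : ℝ) / (1 + (j : ℝ) ^ 2) := by
    have h := (Real.summable_one_div_int_pow (p := 2)).2 (by norm_num)
    refine Summable.of_norm_bounded_eventually (h.mul_left 14) ?_
    filter_upwards [(Set.finite_singleton (0 : ℤ)).compl_mem_cofinite] with j hj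
    have hj : (j : ℝ) ≠ 0 := by exact_mod_cast hj
    rw [Real.norm_of_nonneg (by positivity), mul_one_div]
    gcongr
    linarith
  have hpos : 0 < ∑' j : ℤ, (14 : ℝ) / (1 + (j : ℝ) ^ 2) :=
    hs.tsum_pos (fun j => by positivity) 0 (by norm_num)
  refine ⟨(∑' j : ℤ, (14 : ℝ) / (1 + (j : ℝ) ^ 2)) * 400, by positivity,
    fun q _ χ h1 hl hq Z g x h hZ => ?_⟩
  classical
  set ℓ := Real.log q with hℓ
  have key := Multiset.sum_map_le_sum_mul_of_cover (Z := Z)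
    ((Finset.Icc (-⌈ℓ ^ 2⌉) ⌈ℓ ^ 2⌉).filter fun j : ℤ => |(j : ℝ)| ≤ ℓ ^ 2 + 1)
    (fun j : ℤ => (14 : ℝ) / (1 + (j : ℝ) ^ 2)) (fun ρ => (‖(x : ℂ) - ρ‖ ^ 2)⁻¹)
    (fun j ρ => ‖ρ - (3 + ((j + 1 / 2 : ℝ) : ℂ) * I)‖ ≤ 2.975) (N := 400 * ℓ)
    (fun j _ => by positivity) ?_ ?_
  · refine key.trans ?_
    rw [mul_assoc]
    gcongr
    exact hs.sum_le_tsum _ fun j _ => by positivity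
  · intro ρ hρ
    obtain ⟨h2, h3, h4, h5⟩ := hZ ρ hρ
    have h6 := Int.floor_le ρ.im
    have h7 := (Int.lt_floor_add_one ρ.im).le
    obtain ⟨h8, h9⟩ := abs_le.1 h4
    have h10 := Int.le_ceil (ℓ ^ 2)
    refine ⟨⌊ρ.im⌋, ?_, ?_, ?_⟩
    · refine Finset.mem_filter.2 ⟨Finset.mem_Icc.2 ⟨?_, ?_⟩, ?_⟩
      · rw [Int.le_floor]; push_cast; linarith
      · exact (Int.floor_le_floor (by linarith)).trans (Int.floor_le_ceil _)
      · rw [abs_le]; constructor <;> linarith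
    · rw [← Real.sqrt_sq (norm_nonneg _), Real.sqrt_le_left (by norm_num), ← Complex.normSq_eq_norm_sq,
        Complex.normSq_apply]
      simp only [sub_re, add_re, re_ofNat, mul_re, ofReal_re, I_re, mul_zero, ofReal_im, I_im,
        mul_one, sub_self, add_zero, sub_im, add_im, im_ofNat, mul_im, zero_add]
      generalize (⌊ρ.im⌋ : ℝ) = j at *
      have e1 : (ρ.re - 3) * (ρ.re - 3) ≤ 2.93 * 2.93 := by nlinarith
      have e2 : (ρ.im - (j + 1 / 2)) * (ρ.im - (j + 1 / 2)) ≤ 1 / 4 := by nlinarith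
      norm_num at e1 e2 ⊢
      linarith
    · have h11 : ρ.im ^ 2 ≤ ‖(x : ℂ) - ρ‖ ^ 2 := by
        have := abs_im_le_norm ((x : ℂ) - ρ)
        rw [sub_im, ofReal_im, zero_sub, abs_neg] at this
        rw [← sq_abs]
        gcongr
      have h12 : (1 / 2) ^ 2 ≤ ‖(x : ℂ) - ρ‖ ^ 2 := by gcongr
      -- With j = ⌊Im ρ⌋ and |x-ρ| ≥ 1/2 one has 1 + j² ≤ 2(Im ρ)² + 3 ≤ 14 |x-ρ|².
      rw [inv_eq_one_div, div_le_div_iff₀ (by linarith) (by positivity)]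
      generalize (⌊ρ.im⌋ : ℝ) = j at *
      have h13 : j ^ 2 ≤ 2 * ρ.im ^ 2 + 2 := by nlinarith [sq_nonneg (ρ.im + (ρ.im - j))]
      nlinarith
  · intro j hj
    have hj2 := (Finset.mem_filter.1 hj).2
    obtain ⟨g', hg'⟩ := h.of_le (Multiset.filter_le
      (fun ρ => ‖ρ - (3 + ((j + 1 / 2 : ℝ) : ℂ) * I)‖ ≤ 2.975) Z)
    refine card_zeros_disc_le h1 hl hq hg' ?_ fun ρ hρ => (Multiset.mem_filter.1 hρ).2
    obtain ⟨h8, h9⟩ := abs_le.1 hj2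
    rw [abs_le]; constructor <;> linarith

/-- At 1 + δ every zero is at least δ to the left, and L'/L is O(1/δ), hence O(log q). Positivity of
the real parts then bounds the sum by a multiple of (log q)/δ, whereas counting zeros alone would
lose a factor 1/δ. -/
lemma sum_inv_sq_near_zeros_le (h1 : χ ≠ 1) (hl : 1 ≤ Real.log q)
    (hq : 20000 * Real.log q ^ 2 ≤ q) {Z : Multiset ℂ} {g : ℂ → ℂ} (h : DividesBy χ.LFunction Z g)
    {δ : ℝ} (hδ : 0 < δ) (hδ1 : δ ≤ 0.6) (hδl : 1 ≤ δ * Real.log q)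
    (hZ : ∀ ρ ∈ Z, ‖ρ - ((1 + δ : ℝ) : ℂ)‖ ≤ 1 / 2) :
    (Z.map fun ρ => (‖((1 + δ : ℝ) : ℂ) - ρ‖ ^ 2)⁻¹).sum ≤ 38 * (Real.log q / δ) := by
  set ℓ := Real.log q with hℓ
  have hc : (((1 + δ : ℝ) : ℂ)).re = 1 + δ := ofReal_re _
  have hinv : (1 + δ) / δ ≤ 1.6 * ℓ := by
    rw [div_le_iff₀ hδ]; nlinarith
  have h2 := h.sum_inv_sq_le (c := ((1 + δ : ℝ) : ℂ)) (s := 1 / 4) (r := 1 / 2) (R := 0.9) (M := 2 * ℓ) (d := δ)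
    (by norm_num) (by norm_num) (by norm_num) (by linarith)
    (LFunction_ne_zero_of_one_lt_re h1 (by rw [hc]; linarith)) ?_ hδ ?_ hZ
  · have h3 := norm_logDeriv_LFunction_le χ (σ := 1 + δ) (by linarith)
    rw [add_sub_cancel_left] at h3
    rw [← mul_div_assoc, le_div_iff₀ hδ]
    rw [show (1 - (1 / 2) ^ 2 / 0.9 ^ 2 : ℝ) = 56 / 81 by norm_num,
      show 2 * (2 * ℓ) / (1 / 2 - 1 / 4) = 16 * ℓ by ring] at h2
    generalize (Z.map fun ρ => (‖((1 + δ : ℝ) : ℂ) - ρ‖ ^ 2)⁻¹).sum = S at *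
    generalize (1 + δ) / δ = y at *
    linarith
  · intro z hz
    have h3 := (abs_le.1 ((abs_re_le_norm _).trans hz)).1
    rw [sub_re, hc] at h3
    refine norm_LFunction_le_exp_mul h1 hq (B := 2.5) (b := 0.1) (by rw [hc]; linarith)
      (by norm_num) (by linarith) ?_ ?_
    · have h4 : ‖z‖ ≤ ‖z - ((1 + δ : ℝ) : ℂ)‖ + ‖((1 + δ : ℝ) : ℂ)‖ := by
        simpa using norm_add_le (z - ((1 + δ : ℝ) : ℂ)) ((1 + δ : ℝ) : ℂ)
      rw [Complex.norm_real, Real.norm_of_nonneg (by linarith)] at h4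
      linarith
    · rw [hc, add_sub_cancel_left]
      nlinarith
  · intro z hz
    rw [hc, add_sub_cancel_right]
    by_contra! hlt
    exact LFunction_ne_zero_of_one_lt_re h1 hlt hz

/-- Sums over zeros near the real axis are controlled by the zero-free region. -/
lemma exists_sum_inv_sq_zeros_le : ∃ C : ℝ, 0 < C ∧ ∀ (q : ℕ) [NeZero q]
    (χ : DirichletCharacter ℂ q), χ ≠ 1 → 1 ≤ Real.log q → 20000 * Real.log q ^ 2 ≤ q →
    ∀ (Z : Multiset ℂ) (g : ℂ → ℂ) (δ : ℝ), DividesBy χ.LFunction Z g → 0 < δ → δ ≤ 0.6 →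
      1 ≤ δ * Real.log q → (∀ ρ ∈ Z, 0.07 ≤ ρ.re ∧ ρ.re ≤ 1 ∧ |ρ.im| ≤ Real.log q ^ 2) →
      (Z.map fun ρ => (‖((1 + δ : ℝ) : ℂ) - ρ‖ ^ 2)⁻¹).sum ≤ C * (Real.log q / δ) := by
  obtain ⟨C, hC, hfar⟩ := exists_sum_inv_sq_far_zeros_le
  refine ⟨38 + C, by positivity, fun q _ χ h1 hl hq Z g δ h hδ hδ1 hδl hZ => ?_⟩
  classical
  set P : ℂ → Prop := fun ρ => ‖ρ - ((1 + δ : ℝ) : ℂ)‖ ≤ 1 / 2 with hP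
  obtain ⟨g₁, hg₁⟩ := h.of_le (Multiset.filter_le P Z)
  obtain ⟨g₂, hg₂⟩ := h.of_le (Multiset.filter_le (fun ρ => ¬ P ρ) Z)
  have e1 := sum_inv_sq_near_zeros_le h1 hl hq hg₁ hδ hδ1 hδl fun ρ hρ => (Multiset.mem_filter.1 hρ).2
  have e2 := hfar q χ h1 hl hq _ g₂ (1 + δ) hg₂ fun ρ hρ => by
    obtain ⟨h2, h3⟩ := Multiset.mem_filter.1 hρ
    obtain ⟨h4, h5, h6⟩ := hZ ρ h2
    refine ⟨h4, h5, h6, ?_⟩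
    rw [norm_sub_rev]
    exact (not_le.1 h3).le
  rw [← Multiset.filter_add_not P Z, Multiset.map_add, Multiset.sum_add, add_mul]
  refine add_le_add e1 (e2.trans ?_)
  gcongr
  rw [le_div_iff₀ hδ]
  nlinarith

end ZeroSums

end

/-! ### Upper bound for the high derivatives of L'/L from the zero-free box. -/

section

open Complex Metric Set Filter Topology
open scoped Nat

section DerivativeBound

open DirichletCharacter

/-- A zero in Re ρ ≤ 1 - δ lies at distance y(η+δ) with y ≥ 1. The factor (η+δ)^(-m²-1) is the
saving, and Bernoulli's inequality for y^(m²+1) leaves δ²|1+δ-ρ|⁻². Summed over zeros this costs δ²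
(log q)/δ = δ log q rather than log q, which is what the final bound needs. -/
lemma inv_norm_pow_le_mul_inv_norm_sq {m : ℕ} (hm : 0 < m) {δ : ℝ} (hδ : 0 < δ) {ρ : ℂ}
    (hρ : ρ.re ≤ 1 - δ) :
    (‖((1 + m * (δ / 10) : ℝ) : ℂ) - ρ‖ ^ (m ^ 2 + 1))⁻¹ ≤
      8 * δ ^ 2 * ((m * (δ / 10) + δ) ^ (m ^ 2 + 1))⁻¹ * (‖((1 + δ : ℝ) : ℂ) - ρ‖ ^ 2)⁻¹ := by
  have hm1 : (1 : ℝ) ≤ m := by exact_mod_cast hm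
  set η : ℝ := m * (δ / 10) with hη
  have hη0 : 0 < η := by positivity
  have hsq : ∀ x : ℝ, ‖((1 + x : ℝ) : ℂ) - ρ‖ ^ 2 = (x + (1 - ρ.re)) ^ 2 + ρ.im ^ 2 := fun x => by
    rw [← Complex.normSq_eq_norm_sq, Complex.normSq_apply]
    simp only [sub_re, ofReal_re, sub_im, ofReal_im]
    ring
  set u : ℝ := 1 - ρ.re with hu
  have hu1 : δ ≤ u := by linarith
  set y : ℝ := ‖((1 + η : ℝ) : ℂ) - ρ‖ / (η + δ) with hy
  have hs : 0 < η + δ := by positivity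
  have hy2 : 1 + ((u - δ) ^ 2 + ρ.im ^ 2) / (η + δ) ^ 2 ≤ y ^ 2 := by
    rw [hy, div_pow, hsq, ← sub_nonneg]
    have e : ((η + u) ^ 2 + ρ.im ^ 2) / (η + δ) ^ 2 - (1 + ((u - δ) ^ 2 + ρ.im ^ 2) / (η + δ) ^ 2) =
        2 * ((u - δ) * (η + δ)) / (η + δ) ^ 2 := by
      field_simp
      ring
    rw [e]
    have := mul_nonneg (sub_nonneg.2 hu1) hs.le
    positivity
  have hy1 : 1 ≤ y := by
    have h0 : 0 ≤ ((u - δ) ^ 2 + ρ.im ^ 2) / (η + δ) ^ 2 := by positivity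
    exact (one_le_sq_iff₀ (by positivity)).1 (by linarith)
  -- The exponent is halved because Bernoulli is applied to y², for which a lower bound is explicit.
  set j : ℕ := (m ^ 2 + 1) / 2 with hj
  have hj1 : 2 * j ≤ m ^ 2 + 1 := by omega
  have hj2 : (m : ℝ) ^ 2 ≤ 2 * j := by
    have : m ^ 2 ≤ 2 * j := by omega
    exact_mod_cast this
  have hb : 1 + j * (((u - δ) ^ 2 + ρ.im ^ 2) / (η + δ) ^ 2) ≤ y ^ (m ^ 2 + 1) :=
    calc _ ≤ 1 + j * (y ^ 2 - 1) := by gcongr; linarith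
      _ ≤ (1 + (y ^ 2 - 1)) ^ j := one_add_mul_le_pow (by linarith [sq_nonneg y]) j
      _ = y ^ (2 * j) := by rw [add_sub_cancel, ← pow_mul]
      _ ≤ _ := pow_le_pow_right₀ hy1 hj1
  have hηδ : (η + δ) ^ 2 ≤ 2 * m ^ 2 * δ ^ 2 := by
    have : η + δ ≤ 1.1 * (m * δ) := by rw [hη]; nlinarith
    calc (η + δ) ^ 2 ≤ (1.1 * (m * δ)) ^ 2 := by gcongr
      _ ≤ _ := by nlinarith [sq_nonneg (m * δ)]
  have hc : ((u - δ) ^ 2 + ρ.im ^ 2) / (4 * δ ^ 2) ≤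
      j * (((u - δ) ^ 2 + ρ.im ^ 2) / (η + δ) ^ 2) := by
    rw [← mul_div_assoc, div_le_div_iff₀ (by positivity) (by positivity)]
    calc _ ≤ ((u - δ) ^ 2 + ρ.im ^ 2) * (2 * m ^ 2 * δ ^ 2) := by gcongr
      _ ≤ ((u - δ) ^ 2 + ρ.im ^ 2) * (2 * (2 * j) * δ ^ 2) := by gcongr
      _ = _ := by ring
  have hfin : ‖((1 + δ : ℝ) : ℂ) - ρ‖ ^ 2 ≤ 8 * δ ^ 2 * y ^ (m ^ 2 + 1) := by
    have h1 : 8 * δ ^ 2 * (1 + ((u - δ) ^ 2 + ρ.im ^ 2) / (4 * δ ^ 2)) ≤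
        8 * δ ^ 2 * y ^ (m ^ 2 + 1) := by gcongr; linarith
    refine le_trans ?_ h1
    rw [hsq, mul_add, mul_one, show 8 * δ ^ 2 * (((u - δ) ^ 2 + ρ.im ^ 2) / (4 * δ ^ 2)) =
      2 * ((u - δ) ^ 2 + ρ.im ^ 2) by field_simp; ring]
    nlinarith [sq_nonneg (u - δ - 2 * δ), sq_nonneg ρ.im]
  have hn : 0 < ‖((1 + δ : ℝ) : ℂ) - ρ‖ ^ 2 := by
    rw [hsq]
    have : 0 < δ + u := by linarith
    positivity
  have hyp : 0 < y := by linarith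
  have hceq : ‖((1 + η : ℝ) : ℂ) - ρ‖ = y * (η + δ) := by rw [hy]; field_simp
  rw [hceq, mul_pow, mul_inv, mul_right_comm, mul_comm (_ * _) ((_ : ℝ)⁻¹),
    mul_comm ((y ^ _)⁻¹)]
  gcongr
  rw [← div_eq_mul_inv, inv_eq_one_div, div_le_div_iff₀ (by positivity) hn, one_mul]
  exact hfin

/-- The derivatives of `L'/L` to the right of `1`, under a zero-free region of width `δ`. -/
lemma exists_norm_iteratedDeriv_logDeriv_LFunction_le : ∃ C : ℝ, 0 < C ∧ ∀ (q : ℕ) [NeZero q]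
    (χ : DirichletCharacter ℂ q) (δ : ℝ) (m : ℕ), χ ≠ 1 → 2 ≤ Real.log q →
    20000 * Real.log q ^ 2 ≤ q → 0 < δ → δ ≤ 0.6 → 1 ≤ δ * Real.log q → 6 ≤ m →
    m * (δ / 10) ≤ Real.log q →
    (∀ s : ℂ, 1 - δ ≤ s.re → s.re ≤ 1 → |s.im| ≤ Real.log q ^ 2 → χ.LFunction s ≠ 0) →
    ‖iteratedDeriv (m ^ 2) (logDeriv χ.LFunction) ((1 + m * (δ / 10) : ℝ) : ℂ)‖ ≤
      (m ^ 2)! * (C * (δ * Real.log q) * ((m * (δ / 10) + δ) ^ (m ^ 2 + 1))⁻¹ +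
        134 * Real.log q * (m * (δ / 10) + 1) * (m ^ 2 + 2) *
          ((m * (δ / 10) + 9 / 10) ^ (m ^ 2 + 1))⁻¹) := by
  obtain ⟨C, hC, hsum⟩ := exists_sum_inv_sq_zeros_le
  refine ⟨8 * C, by positivity, fun q _ χ δ m h1 hl hq hδ hδ1 hδl hm hηl hz => ?_⟩
  set ℓ := Real.log q with hℓ
  have hm6 : (6 : ℝ) ≤ m := by exact_mod_cast hm
  set η : ℝ := m * (δ / 10) with hη
  have hη0 : 0 < η := by positivity
  have hη1 : 0.6 * δ ≤ η := by rw [hη]; nlinarith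
  set c : ℂ := ((1 + η : ℝ) : ℂ) with hc
  have hcre : c.re = 1 + η := ofReal_re _
  have hcim : c.im = 0 := ofReal_im _
  -- The disc of radius η + 0.96 about 1 + η reaches Re s = 0.04, inside the range of the growth
  -- bound. The listed zeros have Re ρ ≥ 0.07, and s = η + 0.9 gives the rate of the error term.
  obtain ⟨Z, g, hdiv, hZ, hk⟩ := exists_zeros_norm_iteratedDeriv_logDeriv_le
    (differentiable_LFunction h1) (c := c) (s := η + 0.9) (r := η + 0.93) (R := η + 0.96)
    (M := 2 * ℓ) (by positivity) (by linarith) (by linarith) (by positivity)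
    (LFunction_ne_zero_of_one_lt_re h1 (by rw [hcre]; linarith)) (by
      intro z hzc
      have h2 := (abs_le.1 ((abs_re_le_norm _).trans hzc)).1
      rw [sub_re, hcre] at h2
      refine norm_LFunction_le_exp_mul h1 hq (B := 2 + 2 * η) (b := 0.04) (by rw [hcre]; linarith)
        (by norm_num) (by linarith) ?_ ?_
      · have h4 : ‖z‖ ≤ ‖z - c‖ + ‖c‖ := by simpa using norm_add_le (z - c) c
        rw [hc, Complex.norm_real, Real.norm_of_nonneg (by linarith)] at h4
        linarith
      · rw [hcre, add_sub_cancel_left]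
        have e : (2 + 2 * η) / 0.04 * ((1 + η) / η) = 50 * (1 / η + 2 + η) := by
          field_simp; ring
        have h3 : 1 / η ≤ 2 * ℓ := by
          rw [div_le_iff₀ hη0]; nlinarith
        rw [e]
        nlinarith)
  have hzero : ∀ ρ ∈ Z, 0.07 ≤ ρ.re ∧ ρ.re ≤ 1 ∧ |ρ.im| ≤ ℓ ^ 2 := by
    intro ρ hρ
    have h2 := (abs_le.1 ((abs_re_le_norm _).trans (hZ ρ hρ))).1
    have h3 := (abs_im_le_norm _).trans (hZ ρ hρ)
    rw [sub_re, hcre] at h2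
    rw [sub_im, hcim, sub_zero] at h3
    refine ⟨by linarith, ?_, by nlinarith⟩
    by_contra! hlt
    exact LFunction_ne_zero_of_one_lt_re h1 hlt (hdiv.zero_of_mem hρ)
  refine (hk (m ^ 2)).trans ?_
  gcongr ?_ * (?_ + ?_)
  · calc (Z.map fun ρ => (‖c - ρ‖ ^ (m ^ 2 + 1))⁻¹).sum
        ≤ (Z.map fun ρ => 8 * δ ^ 2 * ((η + δ) ^ (m ^ 2 + 1))⁻¹ *
            (‖((1 + δ : ℝ) : ℂ) - ρ‖ ^ 2)⁻¹).sum := by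
          refine Multiset.sum_map_le_sum_map _ _ fun ρ hρ => ?_
          refine inv_norm_pow_le_mul_inv_norm_sq (by omega) hδ ?_
          obtain ⟨-, h3, h4⟩ := hzero ρ hρ
          by_contra! hlt
          exact hz ρ hlt.le h3 h4 (hdiv.zero_of_mem hρ)
      _ = 8 * δ ^ 2 * ((η + δ) ^ (m ^ 2 + 1))⁻¹ *
            (Z.map fun ρ => (‖((1 + δ : ℝ) : ℂ) - ρ‖ ^ 2)⁻¹).sum := Multiset.sum_map_mul_left
      _ ≤ 8 * δ ^ 2 * ((η + δ) ^ (m ^ 2 + 1))⁻¹ * (C * (ℓ / δ)) := by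
          gcongr
          exact hsum q χ h1 (by linarith) hq Z g δ hdiv hδ hδ1 hδl hzero
      _ = _ := by field_simp
  · rw [div_eq_mul_inv, show (0.9 : ℝ) = 9 / 10 by norm_num]
    gcongr
    have h2 : 0.03 / (η + 0.96) ≤ Real.log ((η + 0.96) / (η + 0.93)) := by
      have := Real.one_sub_inv_le_log_of_pos (x := (η + 0.96) / (η + 0.93)) (by positivity)
      refine le_trans (le_of_eq ?_) this
      field_simp
      ring
    have h3 : 2 * ℓ / Real.log ((η + 0.96) / (η + 0.93)) ≤ 2 * ℓ / (0.03 / (η + 0.96)) := by gcongr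
    have h4 : 2 * ℓ / (0.03 / (η + 0.96)) ≤ 67 * (ℓ * (η + 1)) := by
      rw [div_div_eq_mul_div, div_le_iff₀ (by norm_num)]
      nlinarith [mul_pos (by linarith : 0 < ℓ) hη0]
    have h5 : 2 * (2 * ℓ) * (η + 9 / 10) / (η + 0.93 - (η + 9 / 10)) ≤ 134 * (ℓ * (η + 1)) := by
      rw [show η + 0.93 - (η + 9 / 10) = 0.03 by ring, div_le_iff₀ (by norm_num)]
      nlinarith [mul_pos (by linarith : 0 < ℓ) hη0]
    have h6 : ((m : ℝ) ^ 2 + 1) * (2 * (2 * ℓ) * (η + 9 / 10) / (η + 0.93 - (η + 9 / 10))) ≤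
        (m ^ 2 + 1) * (134 * (ℓ * (η + 1))) := by gcongr
    have h7 : 0 ≤ ℓ * (η + 1) := by positivity
    push_cast
    linarith

end DerivativeBound

end

/-! ### Lower bound for the prime sum when χ = 1 on small prime powers. -/

section

open Set Filter Topology
open scoped Nat

section NoInert
open ArithmeticFunction

lemma le_tsum_vonMangoldt_of_eq_one {q : ℕ} (hq : q ≠ 0) {a : ℕ → ℝ}
    (hcop : ∀ n : ℕ, ¬ n.Coprime q → a n = 0) (habs : ∀ n, |a n| ≤ 1) {m : ℕ} (hm : 6 ≤ m) {w : ℝ}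
    (hw : 0 < w) (hw1 : w ≤ 1 / 16)
    (hX : ∀ n ≤ ⌊Real.exp ((m + 6) / w)⌋₊, n.Coprime q → IsPrimePow n → a n = 1) :
    gammaPeak m w * (Real.exp (-1 / 2) / (2 * w) - Real.exp (-6) / w -
      (m * w / (m * w + 9 / 10)) ^ (m ^ 2) * (14 * Real.log q)) ≤
    ∑' n : ℕ, a n * vonMangoldt n * Real.log n ^ (m ^ 2) * (n : ℝ) ^ (-(1 + m * w)) := by
  classical
  have hm0 : 0 < m := by omega
  have hmw : 0 < m * w := by positivity
  have hWn := gammaWeight_nonneg m w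
  have hΛn : ∀ n, 0 ≤ vonMangoldt n * gammaWeight m w n := fun n =>
    mul_nonneg vonMangoldt_nonneg (hWn n)
  have hf : ∀ n : ℕ, a n * vonMangoldt n * Real.log n ^ (m ^ 2) * (n : ℝ) ^ (-(1 + m * w)) =
      a n * (vonMangoldt n * gammaWeight m w n) := fun n => by
    unfold gammaWeight; ring
  simp only [hf]
  have hsumm : Summable fun n : ℕ => a n * (vonMangoldt n * gammaWeight m w n) := by
    refine Summable.of_norm_bounded
      (summable_vonMangoldt_mul_log_pow (σ := 1 + m * w) (by linarith) (m ^ 2)) fun n => ?_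
    rw [norm_mul, Real.norm_eq_abs, Real.norm_of_nonneg (hΛn n), mul_assoc]
    exact mul_le_of_le_one_left (hΛn n) (habs n)
  have hlim := (tendsto_add_atTop_iff_nat 1).2 hsumm.hasSum.tendsto_sum_nat
  refine ge_of_tendsto hlim ?_
  set A := ⌊Real.exp (m / w)⌋₊
  set B := ⌊Real.exp ((m + 1) / w)⌋₊
  set X := ⌊Real.exp ((m + 6) / w)⌋₊
  have hBX : B ≤ X := Nat.floor_le_floor (Real.exp_le_exp.2 (by gcongr; norm_num))
  filter_upwards [eventually_ge_atTop X] with N hN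
  have hrange : ∑ n ∈ Finset.range (N + 1), a n * (vonMangoldt n * gammaWeight m w n) =
      ∑ n ∈ Finset.Ioc 0 N, a n * (vonMangoldt n * gammaWeight m w n) := by
    rw [Finset.range_eq_Ico, Finset.sum_eq_sum_Ico_succ_bot (by omega)]
    rw [ArithmeticFunction.map_zero, zero_mul, mul_zero, zero_add]
    exact Finset.sum_congr (by ext; simp; omega) fun _ _ => rfl
  rw [hrange]
  -- Below X the coefficient is 1 on prime powers prime to q, and 0 on n not prime to q, whose share
  -- of the window is subtracted. Beyond X only a n ≥ -1 is used.
  have hpt : ∀ n ∈ Finset.Ioc 0 N, (if n ∈ Finset.Ioc A B then vonMangoldt n * gammaWeight m w n else 0)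
      - (if ¬ n.Coprime q then vonMangoldt n * gammaWeight m w n else 0)
      - (if n ∈ Finset.Ioc X N then vonMangoldt n * gammaWeight m w n else 0) ≤
      a n * (vonMangoldt n * gammaWeight m w n) := by
    intro n hn
    have h0 := hΛn n
    by_cases hnX : n ≤ X
    · have h3 : n ∉ Finset.Ioc X N := by simp [hnX]
      rw [if_neg h3]
      by_cases hc : n.Coprime q
      · rw [if_neg (not_not.2 hc)]
        by_cases hp : IsPrimePow n
        · rw [hX n hnX hc hp]; split_ifs <;> linarith
        · have : vonMangoldt n = 0 := by rw [vonMangoldt_apply, if_neg hp]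
          rw [this]; simp
      · rw [if_pos hc, hcop n hc]; split_ifs <;> linarith
    · have h3 : n ∈ Finset.Ioc X N := Finset.mem_Ioc.2 ⟨by omega, (Finset.mem_Ioc.1 hn).2⟩
      have h4 : n ∉ Finset.Ioc A B := by rw [Finset.mem_Ioc]; omega
      rw [if_pos h3, if_neg h4]
      have h5 := mul_le_mul_of_nonneg_right (abs_le.1 (habs n)).1 h0
      split_ifs <;> linarith
  refine le_trans ?_ (Finset.sum_le_sum hpt)
  rw [Finset.sum_sub_distrib, Finset.sum_sub_distrib, Finset.sum_ite_mem, Finset.sum_ite_mem,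
    Finset.inter_eq_right.2 (Finset.Ioc_subset_Ioc (Nat.zero_le _) (hBX.trans hN)),
    Finset.inter_eq_right.2 (Finset.Ioc_subset_Ioc_left (Nat.zero_le _)), ← Finset.sum_filter]
  have e1 := le_sum_gammaWeight hm0 hw hw1
  have e2 := sum_gammaWeight_tail_le hm hw hw1 N
  have e3 := sum_gammaWeight_not_coprime_le hm0 hw hq N
  have e4 : gammaPeak m w * (Real.exp (-1 / 2) / (2 * w) - Real.exp (-6) / w -
      (m * w / (m * w + 9 / 10)) ^ (m ^ 2) * (14 * Real.log q)) =
      Real.exp (-1 / 2) * gammaPeak m w / (2 * w) -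
      gammaPeak m w * (m * w / (m * w + 9 / 10)) ^ (m ^ 2) * (14 * Real.log q) -
      Real.exp (-6) * gammaPeak m w / w := by ring
  rw [e4]
  linarith

end NoInert

end

/-! ### Choice of m and comparison of the two bounds. -/

section

open Set Filter Topology
open scoped Nat

section Conclusion

/-- The power is (1 + 10/m)^(-m²) ≤ e^(50-10m). -/
lemma div_add_pow_le_of_log_le {m : ℕ} (hm : 0 < m) {B : ℝ} (hB : 0 < B)
    (hmB : Real.log B ≤ 10 * m) {δ : ℝ} (hδ : 0 < δ) :
    (m * (δ / 10) / (m * (δ / 10) + δ)) ^ (m ^ 2) ≤ Real.exp 50 / B := by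
  have hm' : (0 : ℝ) < m := by exact_mod_cast hm
  have h1 : m * (δ / 10) / (m * (δ / 10) + δ) = (1 + 10 / (m : ℝ))⁻¹ := by
    field_simp
  have h2 := pow_le_pow_left₀ (Real.exp_pos _).le
    (exp_sub_sq_div_two_le (x := 10 / (m : ℝ)) (by positivity)) (m ^ 2)
  rw [← Real.exp_nat_mul] at h2
  have h3 : ((m ^ 2 : ℕ) : ℝ) * (10 / m - (10 / m) ^ 2 / 2) = 10 * m - 50 := by
    push_cast; field_simp; ring
  rw [h3, Real.exp_sub] at h2
  rw [h1, inv_pow, inv_eq_one_div, div_le_div_iff₀ (by positivity) hB, one_mul]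
  rw [div_le_iff₀ (Real.exp_pos _)] at h2
  exact (((Real.log_le_iff_le_exp hB).1 hmB).trans h2).trans_eq (mul_comm _ _)

/-- The exponent splits as m + m(m-1). The first m factors give 9/δ by Bernoulli. As δ ≤ 0.6 makes
9/δ ≥ 15, the others give e^(15m-128), where e^(10m) covers B and e^(5m) covers m³. The gain δ/m³
pays for the factor log q and the powers of m in the error terms. -/
lemma div_add_nine_tenths_pow_le_of_log_le {m : ℕ} (hm : 0 < m) {B : ℝ} (hB : 0 < B)
    (hmB : Real.log B ≤ 10 * m) {δ : ℝ} (hδ : 0 < δ) (hδ1 : δ ≤ 0.6) :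
    (m * (δ / 10) / (m * (δ / 10) + 9 / 10)) ^ (m ^ 2) ≤
      δ / (m : ℝ) ^ 3 * (Real.exp 128 / B) := by
  have hm' : (0 : ℝ) < m := by exact_mod_cast hm
  have hm1 : (1 : ℝ) ≤ m := by exact_mod_cast hm
  have h1 : m * (δ / 10) / (m * (δ / 10) + 9 / 10) = (1 + 9 / (δ * m))⁻¹ := by
    field_simp
  have h2 : 9 / δ ≤ (1 + 9 / (δ * m)) ^ m := by
    have h0 : 0 ≤ 9 / (δ * m) := by positivity
    refine le_trans ?_ (one_add_mul_le_pow (by linarith) m)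
    rw [mul_div_assoc', mul_comm δ, mul_div_mul_left _ _ hm'.ne']
    linarith
  have h3 : Real.exp (15 * m - 128) ≤ (1 + 9 / (δ * m)) ^ (m * (m - 1)) := by
    have h4 : 1 + 15 / (m : ℝ) ≤ 1 + 9 / (δ * m) := by
      have : 15 / (m : ℝ) = 9 / (0.6 * m) := by field_simp; norm_num
      rw [this]; gcongr
    have h5 := pow_le_pow_left₀ (Real.exp_pos _).le
      ((exp_sub_sq_div_two_le (x := 15 / (m : ℝ)) (by positivity)).trans h4) (m * (m - 1))
    refine le_trans ?_ h5
    rw [← Real.exp_nat_mul, Real.exp_le_exp]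
    push_cast [Nat.cast_sub hm]
    have : (m : ℝ) * (m - 1) * (15 / m - (15 / m) ^ 2 / 2) =
        15 * m - 15 - 112.5 + 112.5 / m := by
      field_simp; ring
    rw [this]
    have : 0 ≤ 112.5 / (m : ℝ) := by positivity
    linarith
  have h4 : (m : ℝ) ^ 3 ≤ Real.exp (5 * m) := by
    have h5 : (m : ℝ) ≤ Real.exp m := by linarith [Real.add_one_le_exp (m : ℝ)]
    calc (m : ℝ) ^ 3 ≤ Real.exp m ^ 3 := by gcongr
      _ = Real.exp (3 * m) := by rw [← Real.exp_nat_mul]; norm_num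
      _ ≤ _ := Real.exp_le_exp.2 (by linarith)
  have h5 : 1 / δ * ((m : ℝ) ^ 3 * (B / Real.exp 128)) ≤ (1 + 9 / (δ * m)) ^ (m ^ 2) := by
    have e : m ^ 2 = m + m * (m - 1) := by
      obtain ⟨k, rfl⟩ := Nat.exists_eq_succ_of_ne_zero hm.ne'
      simp; ring
    rw [e, pow_add]
    have h6 : Real.exp (15 * m - 128) = Real.exp (5 * m) * (Real.exp (10 * m) / Real.exp 128) := by
      rw [← Real.exp_sub, ← Real.exp_add]; ring_nf
    rw [h6] at h3
    have h7 : 1 / δ ≤ (1 + 9 / (δ * m)) ^ m := le_trans (by gcongr; norm_num) h2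
    refine mul_le_mul h7 (le_trans ?_ h3) (by positivity) (by positivity)
    gcongr
    exact (Real.log_le_iff_le_exp hB).1 hmB
  rw [h1, inv_pow]
  refine (inv_anti₀ (by positivity) h5).trans (le_of_eq ?_)
  field_simp

/-- Numerically, the left side is at least 1/4 - 1/7 up to about 10⁻⁹, while the right side is below
10⁻⁷. -/
lemma not_gammaPeak_inequality {C δ ℓ : ℝ} (hC : 0 < C) (hδ : 0 < δ) (hδ1 : δ ≤ 0.6)
    (hδl : 1 ≤ δ * ℓ) {m : ℕ} (hm20 : (20 : ℝ) ≤ m)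
    (hm1 : Real.log (Real.exp 200 * (1 + C) * (δ * ℓ)) ≤ 10 * m) {η : ℝ} (hη : η = m * (δ / 10))
    (hdiv : Real.exp (-1 / 2) / 2 - Real.exp (-6) -
        (η / (η + 9 / 10)) ^ (m ^ 2) * (14 * (δ / 10 * ℓ)) ≤
      Real.exp 1 * (C * (δ * ℓ) * (η ^ (m ^ 2 + 1) * ((η + δ) ^ (m ^ 2 + 1))⁻¹) +
        134 * ℓ * (η + 1) * (m ^ 2 + 2) *
          (η ^ (m ^ 2 + 1) * ((η + 9 / 10) ^ (m ^ 2 + 1))⁻¹))) : False := by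
  have hp0 : 0 < δ * ℓ := by linarith
  have hℓ0 : 0 < ℓ := pos_of_mul_pos_right hp0 hδ.le
  have hBpos : 0 < Real.exp 200 * (1 + C) * (δ * ℓ) := by positivity
  have hm0 : 0 < m := by exact_mod_cast (by linarith : (0 : ℝ) < m)
  have hm' : (0 : ℝ) < m := by linarith
  have hη0 : 0 < η := by rw [hη]; positivity
  have hT1 := div_add_nine_tenths_pow_le_of_log_le hm0 hBpos hm1 hδ hδ1
  have hT2 := div_add_pow_le_of_log_le hm0 hBpos hm1 hδ
  rw [← hη] at hT1 hT2
  set T := (η / (η + 9 / 10)) ^ (m ^ 2) with hT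
  have hT0 : 0 ≤ T := by positivity
  have hpow : ∀ x : ℝ, 0 ≤ x → η ^ (m ^ 2 + 1) * ((η + x) ^ (m ^ 2 + 1))⁻¹ ≤ (η / (η + x)) ^ (m ^ 2) :=
    fun x hx => by
      rw [← div_eq_mul_inv, ← div_pow]
      exact pow_le_pow_of_le_one (by positivity) ((div_le_one (by positivity)).2 (by linarith))
        (Nat.le_succ _)
  have hexp1 : Real.exp 1 ≤ 3 := by linarith [Real.exp_one_lt_d9]
  have hbig : ∀ x : ℝ, 71 ≤ x → (10 : ℝ) ^ 10 ≤ Real.exp x := fun x hx => by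
    have h2 : (2 : ℝ) ≤ Real.exp 1 := by linarith [Real.add_one_le_exp (1 : ℝ)]
    calc (10 : ℝ) ^ 10 ≤ 2 ^ 71 := by norm_num
      _ ≤ Real.exp 1 ^ 71 := by gcongr
      _ = Real.exp 71 := by rw [← Real.exp_nat_mul]; norm_num
      _ ≤ _ := Real.exp_le_exp.2 hx
  have hterm1 : C * (δ * ℓ) * (η ^ (m ^ 2 + 1) * ((η + δ) ^ (m ^ 2 + 1))⁻¹) ≤ 1 / 10 ^ 10 := by
    calc _ ≤ C * (δ * ℓ) * (Real.exp 50 / (Real.exp 200 * (1 + C) * (δ * ℓ))) := by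
          gcongr; exact (hpow δ hδ.le).trans hT2
      _ = C / (1 + C) * (Real.exp 50 / Real.exp 200) := by field_simp
      _ ≤ 1 * (1 / Real.exp 150) := by
          rw [← Real.exp_sub, one_div, ← Real.exp_neg]
          gcongr
          · rw [div_le_one (by positivity)]; linarith
          · norm_num
      _ ≤ _ := by rw [one_mul]; gcongr; exact hbig 150 (by norm_num)
  have hTm : T * (ℓ * m ^ 3) ≤ 1 / 10 ^ 10 := by
    calc _ ≤ δ / (m : ℝ) ^ 3 * (Real.exp 128 / (Real.exp 200 * (1 + C) * (δ * ℓ))) * (ℓ * m ^ 3) := by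
          gcongr
      _ = Real.exp 128 / Real.exp 200 / (1 + C) := by
          field_simp
      _ ≤ Real.exp 128 / Real.exp 200 := div_le_self (by positivity) (by linarith)
      _ = 1 / Real.exp 72 := by rw [← Real.exp_sub, one_div, ← Real.exp_neg]; norm_num
      _ ≤ _ := by gcongr; exact hbig 72 (by norm_num)
  have hm3 : (1 : ℝ) ≤ (m : ℝ) ^ 3 := one_le_pow₀ (by linarith)
  have hη1 : η + 1 ≤ m := by
    have : η ≤ m * 0.06 := by rw [hη]; gcongr; linarith
    linarith
  have hterm2 : 134 * ℓ * (η + 1) * (m ^ 2 + 2) * (η ^ (m ^ 2 + 1) * ((η + 9 / 10) ^ (m ^ 2 + 1))⁻¹) ≤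
      268 / 10 ^ 10 := by
    calc _ ≤ 134 * ℓ * m * (m ^ 2 + m ^ 2) * T := by
          gcongr
          · nlinarith only [hm20]
          · exact hpow _ (by norm_num)
      _ = 268 * (T * (ℓ * m ^ 3)) := by ring
      _ ≤ 268 * (1 / 10 ^ 10) := by gcongr
      _ = _ := by ring
  have hterm3 : T * (14 * (δ / 10 * ℓ)) ≤ 14 / 10 ^ 10 := by
    calc _ ≤ T * (14 * (1 * (ℓ * m ^ 3))) := by
          gcongr
          · linarith
          · exact le_mul_of_one_le_right hℓ0.le hm3
      _ = 14 * (T * (ℓ * m ^ 3)) := by ring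
      _ ≤ 14 * (1 / 10 ^ 10) := by gcongr
      _ = _ := by ring
  have h5 : (1 / 2 : ℝ) ≤ Real.exp (-1 / 2) := by
    have := Real.add_one_le_exp (-1 / 2 : ℝ); linarith
  have h6 : Real.exp (-6) ≤ 1 / 7 := by
    rw [Real.exp_neg, inv_eq_one_div]
    gcongr
    have := Real.add_one_le_exp (6 : ℝ); linarith
  have h7 := hdiv.trans (mul_le_mul hexp1 (add_le_add hterm1 hterm2) (by positivity) (by norm_num))
  norm_num at h7 hterm3
  linarith only [h5, h6, h7, hterm3]

open ArithmeticFunction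

/-- If `L(s, χ)` has a zero-free region of width `δ` for a real character `χ` modulo `q`, then some
prime power `n ≤ (A δ log q) ^ (1 / δ)` coprime to `q` satisfies `χ n ≠ 1`. -/
theorem exists_isPrimePow_ne_one : ∃ A : ℝ, 1 ≤ A ∧ ∃ N : ℕ, ∀ (q : ℕ) [NeZero q]
    (χ : DirichletCharacter ℂ q) (a : ℕ → ℝ) (δ : ℝ), N < q → (∀ n : ℕ, χ (n : ZMod q) = a n) →
    χ ≠ 1 → 0 < δ → δ ≤ 0.6 → 1 ≤ δ * Real.log q →
    (∀ s : ℂ, 1 - δ ≤ s.re → s.re ≤ 1 → |s.im| ≤ Real.log q ^ 2 → χ.LFunction s ≠ 0) →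
    ∃ n : ℕ, n.Coprime q ∧ IsPrimePow n ∧ a n ≠ 1 ∧ (n : ℝ) ≤ (A * δ * Real.log q) ^ (1 / δ) := by
  obtain ⟨C, hC, hder⟩ := exists_norm_iteratedDeriv_logDeriv_LFunction_le
  -- The factor 1 + C beats the constant of the derivative bound, and e^200 beats the numerical
  -- losses e^50 and e^128 with room to spare.
  set C₁ : ℝ := Real.exp 200 * (1 + C) with hC₁
  have hC₁pos : 0 < C₁ := by positivity
  have hC₁200 : Real.exp 200 ≤ C₁ := le_mul_of_one_le_right (Real.exp_pos _).le (by linarith)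
  have hlogC₁ : 200 ≤ Real.log C₁ := (Real.le_log_iff_exp_le hC₁pos).2 hC₁200
  have hev : ∀ᶠ q : ℕ in atTop, Real.log C₁ ≤ Real.log q ∧ 20000 * Real.log q ^ 2 ≤ q := by
    have h1 : Tendsto (fun q : ℕ => Real.log q) atTop atTop :=
      Real.tendsto_log_atTop.comp tendsto_natCast_atTop_atTop
    have h2 := (Real.isLittleO_pow_log_id_atTop (n := 2)).bound (by norm_num : (0 : ℝ) < 1 / 20000)
    filter_upwards [h1.eventually_ge_atTop (Real.log C₁),
      tendsto_natCast_atTop_atTop.eventually h2] with q h3 h4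
    refine ⟨h3, ?_⟩
    simp only [id, norm_pow, Real.norm_eq_abs, sq_abs, Nat.abs_cast] at h4
    linarith
  obtain ⟨N, hN⟩ := eventually_atTop.1 hev
  refine ⟨C₁ * Real.exp 70, ?_, N, fun q _ χ a δ hNq ha h1 hδ hδ1 hδl hz => ?_⟩
  · exact one_le_mul_of_one_le_of_one_le ((Real.one_le_exp (by norm_num)).trans hC₁200)
      (Real.one_le_exp (by norm_num))
  obtain ⟨hl, hq⟩ := hN q hNq.le
  set ℓ := Real.log q with hℓ
  set p := δ * ℓ with hp
  have hp0 : 0 < p := by linarith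
  have hBpos : 0 < C₁ * p := by positivity
  have hlogB : 200 ≤ Real.log (C₁ * p) := by
    rw [Real.log_mul hC₁pos.ne' hp0.ne']
    linarith [Real.log_nonneg hδl]
  -- The least m with e^(10m) ≥ C₁ δ log q.
  set m : ℕ := ⌈Real.log (C₁ * p) / 10⌉₊ with hm
  have hm1 : Real.log (C₁ * p) ≤ 10 * m := by
    have := Nat.le_ceil (Real.log (C₁ * p) / 10)
    linarith
  have hm2 : (m : ℝ) ≤ Real.log (C₁ * p) / 10 + 1 := (Nat.ceil_lt_add_one (by linarith)).le
  have hm20 : (20 : ℝ) ≤ m := by linarith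
  have hm20' : 20 ≤ m := by exact_mod_cast hm20
  set w := δ / 10 with hw
  have hw0 : 0 < w := by positivity
  have hη0 : 0 < m * w := by positivity
  by_contra! hcon
  -- Since 10m ≤ log(C₁ δ log q) + 10, one has 10(m+6) ≤ log(C₁ δ log q) + 70: hence the e^70 in A.
  have hXle : Real.exp ((m + 6) / w) ≤ (C₁ * Real.exp 70 * δ * ℓ) ^ (1 / δ) := by
    rw [show C₁ * Real.exp 70 * δ * ℓ = C₁ * p * Real.exp 70 by rw [hp]; ring,
      Real.rpow_def_of_pos (by positivity), Real.exp_le_exp,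
      Real.log_mul hBpos.ne' (Real.exp_pos _).ne', Real.log_exp, hw, div_div_eq_mul_div,
      mul_one_div]
    gcongr
    linarith
  have hlow := le_tsum_vonMangoldt_of_eq_one (q := q) (NeZero.ne q) (a := a) (m := m) (w := w)
    (fun n hn => by
      have h2 := χ.map_nonunit (fun h => hn ((ZMod.isUnit_iff_coprime n q).1 h))
      rw [ha] at h2
      exact_mod_cast h2)
    (fun n => by
      have := χ.norm_le_one (n : ZMod q)
      rwa [ha, Complex.norm_real] at this)
    (by omega) hw0 (by rw [hw]; linarith)
    (fun n hn hcop hpp => by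
      by_contra hne
      have h2 := hcon n hcop hpp hne
      have h3 : (n : ℝ) ≤ Real.exp ((m + 6) / w) :=
        (Nat.cast_le.2 hn).trans (Nat.floor_le (Real.exp_pos _).le)
      linarith)
  have hup := hder q χ δ m h1 (by linarith) hq hδ hδ1 hδl (by omega) (by
      have h2 : Real.log (C₁ * p) ≤ Real.log C₁ + p := by
        rw [Real.log_mul hC₁pos.ne' hp0.ne']
        linarith [Real.log_le_sub_one_of_pos hp0]
      have h3 : p ≤ 0.6 * ℓ := by rw [hp]; gcongr
      have h4 : m * (δ / 10) ≤ m * 0.06 := by gcongr; linarith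
      linarith) hz
  rw [iteratedDeriv_logDeriv_LFunction χ ha (by rw [← hw]; linarith), norm_mul, norm_pow, norm_neg, norm_one,
    one_pow, one_mul, Complex.norm_real] at hup
  have hfac := factorial_sq_le (m := m) (by omega) hw0
  have hP := gammaPeak_pos (m := m) (by omega) hw0
  set P := gammaPeak m w
  set η := m * w with hη
  set T := (η / (η + 9 / 10)) ^ (m ^ 2) with hT

  have hT0 : 0 ≤ T := by positivity
  have hbracket : 0 ≤ C * p * ((η + δ) ^ (m ^ 2 + 1))⁻¹ + 134 * ℓ * (η + 1) * (m ^ 2 + 2) *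
      ((η + 9 / 10) ^ (m ^ 2 + 1))⁻¹ := by
    have : 0 < ℓ := by linarith
    positivity
  have hcomb := hlow.trans ((le_abs_self _).trans
    (hup.trans (mul_le_mul_of_nonneg_right hfac hbracket)))
  have hdiv : Real.exp (-1 / 2) / 2 - Real.exp (-6) - T * (14 * (w * ℓ)) ≤
      Real.exp 1 * (C * p * (η ^ (m ^ 2 + 1) * ((η + δ) ^ (m ^ 2 + 1))⁻¹) +
        134 * ℓ * (η + 1) * (m ^ 2 + 2) * (η ^ (m ^ 2 + 1) * ((η + 9 / 10) ^ (m ^ 2 + 1))⁻¹)) := by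
    have e1 : P * (Real.exp (-1 / 2) / (2 * w) - Real.exp (-6) / w - T * (14 * ℓ)) =
        P / w * (Real.exp (-1 / 2) / 2 - Real.exp (-6) - T * (14 * (w * ℓ))) := by
      field_simp
    rw [e1] at hcomb
    refine le_of_mul_le_mul_left (hcomb.trans (le_of_eq ?_)) (div_pos hP hw0)
    ring
  exact not_gammaPeak_inequality hC hδ hδ1 hδl hm20 hm1 (by rw [hη, hw]) hdiv

end Conclusion

end

/-! ### From characters back to quadratic fields. -/

lemma exists_isInertPrime_le_of_isPrimePow {F : Type*} [Field F] [NumberField F]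
    (hF : Module.finrank ℚ F = 2) {n : ℕ} (hn : n.Coprime (NumberField.discr F).natAbs)
    (hpp : IsPrimePow n) (h1 : kroneckerSym (NumberField.discr F) n ≠ 1) :
    ∃ p : ℕ, IsInertPrime F p ∧ p ≤ n := by
  have h4 := discr_mod_four_of_quadratic F hF
  obtain ⟨p, j, hp, hj, rfl⟩ := (isPrimePow_nat_iff n).1 hpp
  refine ⟨p, isInertPrime_of_kroneckerSym hF hp ?_, Nat.le_self_pow hj.ne' p⟩
  have h0 := kroneckerSym_ne_zero h4 hn
  rw [kroneckerSym_pow _ h4] at h0 h1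
  -- The symbol at p^j is the j-th power of the symbol at p and is neither 0 nor 1, so the symbol at
  -- p is -1.
  rcases kroneckerSym_trichotomy (NumberField.discr F) p with h | h | h
  · exact absurd (by rw [h, zero_pow hj.ne']) h0
  · exact absurd (by rw [h, one_pow]) h1
  · exact h

/-- The bound for the least inert prime, for all quadratic fields of large discriminant. -/
lemma exists_isInertPrime_le_of_lt_natAbs_discr : ∃ A : ℝ, 1 ≤ A ∧ ∃ N : ℕ,
    ∀ (F : Type u) [Field F] [NumberField F] (hF : Module.finrank ℚ F = 2) (α : ℝ),
      N < (NumberField.discr F).natAbs → 0 < α → 1 ≤ α * logDiscr F → ZeroFreeBox F hF α →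
        ∃ p : ℕ, IsInertPrime F p ∧ (p : ℝ) ≤ (A * α * logDiscr F) ^ (1 / α) := by
  obtain ⟨A, hA, N₁, h₁⟩ := exists_isPrimePow_ne_one
  obtain ⟨N₂, h₂⟩ := exists_LFunction_eq_zero
  refine ⟨A, hA, max N₁ (max N₂ 8), fun F _ _ hF α hN hα hαl hz => ?_⟩
  have hN₁ := (le_max_left _ _).trans_lt hN
  have hN₂ := ((le_max_left _ _).trans (le_max_right _ _)).trans_lt hN
  have hN₃ := ((le_max_right _ _).trans (le_max_right _ _)).trans_lt hN
  rcases le_or_gt α 0.6 with hα1 | hα1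
  · unfold ZeroFreeBox at hz
    rw [logDiscr_eq] at hz hαl ⊢
    obtain ⟨n, hn, hpp, hne, hle⟩ := h₁ _ (quadraticFieldChar F hF) _ α hN₁
      (quadraticFieldChar_natCast hF) (quadraticFieldChar_ne_one hF) hα hα1 hαl hz
    obtain ⟨p, hp, hpn⟩ := exists_isInertPrime_le_of_isPrimePow hF hn hpp (by exact_mod_cast hne)
    exact ⟨p, hp, (Nat.cast_le.2 hpn).trans hle⟩
  -- For α > 0.6 the box would contain the zero with Re s ≥ 2/5 and |Im s| ≤ 2: a discriminant above
  -- 8 in absolute value makes (log |d|)² exceed 2.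
  · obtain ⟨s, hs1, hs2, hs3, hs0⟩ := h₂ _ (quadraticFieldChar F hF) _
      (quadraticFieldChar_natCast hF) (quadraticFieldChar_isPrimitive hF)
      (quadraticFieldChar_ne_one hF) hN₂
    refine absurd hs0 (hz s (by linarith) hs2 (hs3.trans ?_))
    have h8 : (8 : ℝ) ≤ (NumberField.discr F).natAbs := by exact_mod_cast hN₃.le
    have hl : 2 ≤ logDiscr F := by
      rw [logDiscr_eq]
      refine le_trans ?_ (Real.log_le_log (by norm_num) h8)
      rw [show (8 : ℝ) = 2 ^ 3 by norm_num, Real.log_pow]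
      have := Real.log_two_gt_d9
      push_cast
      linarith
    nlinarith

theorem mainTheorem10 :
    ∃ A : ℝ, 0 < A ∧
      (∃ C : ℝ, 0 < C ∧
        ∀ (F : Type u) [Field F] [NumberField F] (hF : Module.finrank ℚ F = 2) (α : ℝ),
          0 < α → 1 ≤ α * logDiscr F → ZeroFreeBox F hF α →
            ∃ p : ℕ, IsInertPrime F p ∧ (p : ℝ) ≤ C * (A * α * logDiscr F) ^ (1 / α)) ∧
      (∀ α : ℝ, 0 < α → ∃ C : ℝ, 0 < C ∧
        ∀ (F : Type u) [Field F] [NumberField F] (hF : Module.finrank ℚ F = 2),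
          ZeroFreeBox F hF α →
            ∃ p : ℕ, IsInertPrime F p ∧ (p : ℝ) ≤ C * (A * α * logDiscr F) ^ (1 / α)) := by
  obtain ⟨A, hA, N, hlarge⟩ := exists_isInertPrime_le_of_lt_natAbs_discr.{u}
  obtain ⟨P, hP⟩ := exists_isInertPrime_le_of_natAbs_discr_le.{u} N
  have hA0 : 0 < A := by linarith
  have main : ∀ (F : Type u) [Field F] [NumberField F] (hF : Module.finrank ℚ F = 2) (α : ℝ),
      0 < α → 1 ≤ α * logDiscr F → ZeroFreeBox F hF α →
        ∃ p : ℕ, IsInertPrime F p ∧ (p : ℝ) ≤ (P + 1) * (A * α * logDiscr F) ^ (1 / α) := by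
    intro F _ _ hF α hα hαl hz
    -- The bound is at least 1, so the constant P + 1 alone handles the small discriminants.
    have h1 : 1 ≤ (A * α * logDiscr F) ^ (1 / α) := by
      refine Real.one_le_rpow ?_ (by positivity)
      rw [mul_assoc]
      exact one_le_mul_of_one_le_of_one_le hA hαl
    rcases le_or_gt (NumberField.discr F).natAbs N with hN | hN
    · obtain ⟨p, hp, hpP⟩ := hP F hF hN
      refine ⟨p, hp, ?_⟩
      calc (p : ℝ) ≤ P := by exact_mod_cast hpP
        _ ≤ P + 1 := by linarith
        _ ≤ _ := le_mul_of_one_le_right (by positivity) h1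
    · obtain ⟨p, hp, hle⟩ := hlarge F hF α hN hα hαl hz
      refine ⟨p, hp, hle.trans (le_mul_of_one_le_left (by linarith) ?_)⟩
      linarith [Nat.cast_nonneg (α := ℝ) P]
  refine ⟨A, hA0, ⟨P + 1, by positivity, main⟩, fun α hα => ?_⟩
  obtain ⟨P', hP'⟩ := exists_isInertPrime_le_of_natAbs_discr_le.{u} ⌊Real.exp (1 / α)⌋₊
  have hlog2 : 0 < Real.log 2 := Real.log_pos (by norm_num)
  -- When α log |d| < 1 the discriminant is at most e^(1/α) in absolute value. The bound may then
  -- fall below 1, but never below κ, because log |d| ≥ log 2.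
  set κ := (A * α * Real.log 2) ^ (1 / α) with hκ
  have hκ0 : 0 < κ := by positivity
  refine ⟨max (P + 1) ((P' + 1) / κ), lt_max_of_lt_left (by positivity), fun F _ _ hF hz => ?_⟩
  have hl2 : Real.log 2 ≤ logDiscr F := by
    rw [logDiscr_eq]
    exact Real.log_le_log (by norm_num) (by exact_mod_cast (two_lt_natAbs_discr hF).le)
  have hl0 : 0 < logDiscr F := hlog2.trans_le hl2
  rcases le_or_gt 1 (α * logDiscr F) with hαl | hαl
  · obtain ⟨p, hp, hle⟩ := main F hF α hα hαl hz
    exact ⟨p, hp, hle.trans (by gcongr; exact le_max_left _ _)⟩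
  · have hN : (NumberField.discr F).natAbs ≤ ⌊Real.exp (1 / α)⌋₊ := by
      have h0 : (0 : ℝ) < (NumberField.discr F).natAbs := by
        exact_mod_cast (by have := two_lt_natAbs_discr hF; omega)
      rw [Nat.le_floor_iff (Real.exp_pos _).le, ← Real.log_le_iff_le_exp h0, ← logDiscr_eq,
        le_div_iff₀ hα]
      linarith
    obtain ⟨p, hp, hpP⟩ := hP' F hF hN
    refine ⟨p, hp, ?_⟩
    calc (p : ℝ) ≤ P' := by exact_mod_cast hpP
      _ ≤ P' + 1 := by linarith
      _ = (P' + 1) / κ * κ := by field_simp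
      _ ≤ max ((P : ℝ) + 1) ((P' + 1) / κ) * (A * α * logDiscr F) ^ (1 / α) := by
        gcongr
        exact le_max_right _ _
        rw [hκ]
        gcongr
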